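/- **Setting.** For $n\in\mathbb N$ let $M$ be a smooth $n$-dimensional manifold without boundary (Hausdorff, second countable) with at least one non-compact connected component, for instance $M$ connected and non-compact. $\mathrm{Diff}(M)$ is the group of smooth diffeomorphisms of $M$ under composition, with its functional diffeology: $\rho$ is a plot iff $(y,x)\mapsto\rho(y)(x)$ is smooth. For a group $G$ with a diffeology, ${}^iT_eG$ is the set of smooth paths $c:\mathbb R\to G$ with $c(0)=e$, modulo $c\sim c'$ iff $(f\circ c)'(0)=(f\circ c')'(0)$ for all smooth $f:G\to\mathbb R$. The class of $c$ is written $\partial_tc(0)$, and ${}^iT_eG$ carries the quotient of the functional diffeology. $G$ is a *diffeological group* if multiplication and inversion are smooth. It is a *diffeological Lie group* if moreover $\mathfrak g={}^iT_eG$, with $\partial_tc(0)+\partial_td(0)=\partial_t(cd)(0)$ and $a\,\partial_tc(0)=\partial_t(c(at))(0)$, is a diffeological vector space (its operations are smooth) and $[\partial_tc(0),Y]=\partial_t(\mathrm{Ad}_{c(t)}Y)(0)$ defines a smooth Lie bracket on $\mathfrak g$. Such a $G$ is *regular* if there is a smooth map $\mathrm{Exp}:C^\infty([0,1],\mathfrak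 g)\to C^\infty([0,1],G)$ such that for every $v$ the path $g=\mathrm{Exp}(v)$ is the unique solution of $$g(0)=e,\qquad \tfrac{dg(t)}{dt}\,g(t)^{-1}=v(t).\tag{1}$$ A *thick path* in $M$ is a smooth embedding $E:]0,1[\times B\to M$, with $B$ the open unit ball of $\mathbb R^{n-1}$ ($n\ge1$), such that $E(]0,1[\times\{\|y\|\le r\})$ is closed in $M$ for every $0\le r<1$; put $e(x)=E(x,0)$. A *cutoff* is a smooth function $\varphi:\mathbb R\to[0,1]$, equal to $1$ near $0$ and vanishing outside a compact subset of $]-1,1[$. Let $\phi(u)=\frac1Ke^{1/(u^2-1)}$ for $|u|<1$ and $\phi(u)=0$ otherwise, where $K=\int_{-1}^1e^{1/(u^2-1)}du$, and let $\phi_\alpha(u)=\frac1\alpha\phi(u/\alpha)$. For $|t|<1/4$ and $x\in{]0,1[}$ let $c_t(x)=x+t\,(\mathbf 1_{[|t|,1-|t|]}*\phi_{|t|})(x)$ (so $c_0(x)=x$). **Theorem.** $\mathrm{Diff}(M)$ with its functional diffeology is a diffeological Lie group, and it is not regular. Moreover, $M$ contains a thick path, and for every thick path $E$ in $M$ and every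 cutoff $\varphi$ there is a smooth path $C:\mathbb R\to\mathrm{Diff}(M)$ with $C_0=\mathrm{id}$ such that, for $|t|<1/4$, $$C_t(E(x,y))=E\big(c_{\varphi(\|y\|)t}(x),y\big)\ \ (0<x<1,\ y\in B),\qquad C_t(p)=p\ \text{ for } p\notin\mathrm{Im}\,E,$$ and such that $X=\partial_tC_t|_{t=0}$ is a smooth vector field on $M$ with $X(e(x))=e'(x)$ for $0<x<1$, $X$ has no global flow on $M$, and equation (1) in $G=\mathrm{Diff}(M)$ has no solution $g\in C^\infty([0,1],\mathrm{Diff}(M))$ for the constant path $v(t)=\partial_tC(0)\in\mathfrak g$. -/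

import Mathlib

open Set Topology Diffeology
open scoped Manifold ContDiff

noncomputable section

namespace DiffLie

universe u v w

/-! ### Constructions of diffeologies -/

section Constructions

variable {X : Type u} {Y : Type v} {S : Type w}

/-- Any point of an open set `u` of `ℝⁿ` has a neighbourhood on which the identity agrees with
a smooth map from `ℝⁿ` to `u`. -/
lemma exists_smooth_retract {n : ℕ} {u : Set (EuclideanSpace ℝ (Fin n))} (hu : IsOpen u)
    {x : EuclideanSpace ℝ (Fin n)} (hx : x ∈ u) :
    ∃ f : EuclideanSpace ℝ (Fin n) → EuclideanSpace ℝ (Fin n), ContDiff ℝ ∞ f ∧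
      (∀ z, f z ∈ u) ∧ ∃ v : Set (EuclideanSpace ℝ (Fin n)), IsOpen v ∧ x ∈ v ∧
        ∀ z ∈ v, f z = z := by
  obtain ⟨ε, hε, hεu⟩ := Metric.isOpen_iff.mp hu x hx
  let b : ContDiffBump x := ⟨ε / 2, ε, by positivity, by linarith⟩
  refine ⟨fun z => x + b z • (z - x), ?_, ?_, Metric.ball x (ε / 2), Metric.isOpen_ball,
    Metric.mem_ball_self (by positivity), ?_⟩
  · exact contDiff_const.add (b.contDiff.smul (contDiff_id.sub contDiff_const))
  · intro z
    apply hεu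
    by_cases hz : dist z x < ε
    · rw [Metric.mem_ball, dist_eq_norm, add_sub_cancel_left, norm_smul, Real.norm_eq_abs,
        abs_of_nonneg b.nonneg]
      calc b z * ‖z - x‖ ≤ 1 * ‖z - x‖ := by gcongr; exact b.le_one
        _ < ε := by rwa [one_mul, ← dist_eq_norm]
    · have : b z = 0 := b.zero_of_le_dist (not_lt.mp hz)
      simp [this, hε]
  · intro z hz
    have : b z = 1 := b.one_of_mem_closedBall (Metric.ball_subset_closedBall hz)
    simp [this]

/-- The product diffeology. -/
instance prodDiffeology [DiffeologicalSpace X] [DiffeologicalSpace Y] :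
    DiffeologicalSpace (X × Y) where
  plots n := {p | IsPlot (fun z => (p z).1) ∧ IsPlot (fun z => (p z).2)}
  constant_plots x := ⟨isPlot_const, isPlot_const⟩
  plot_reparam hp hf := ⟨isPlot_reparam hp.1 hf, isPlot_reparam hp.2 hf⟩
  locality {n p} hp := by
    refine ⟨DiffeologicalSpace.locality fun x => ?_, DiffeologicalSpace.locality fun x => ?_⟩
    · obtain ⟨u, hu, hxu, h⟩ := hp x
      exact ⟨u, hu, hxu, fun hfu hf => (h hfu hf).1⟩
    · obtain ⟨u, hu, hxu, h⟩ := hp x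
      exact ⟨u, hu, hxu, fun hfu hf => (h hfu hf).2⟩

/-- The subset diffeology. -/
instance subtypeDiffeology [DiffeologicalSpace X] {P : X → Prop} :
    DiffeologicalSpace {x : X // P x} where
  plots n := {p | IsPlot (fun z => (p z).1)}
  constant_plots x := isPlot_const
  plot_reparam hp hf := isPlot_reparam hp hf
  locality {n p} hp := DiffeologicalSpace.locality fun x => by
    obtain ⟨u, hu, hxu, h⟩ := hp x
    exact ⟨u, hu, hxu, fun hfu hf => h hfu hf⟩

/-- The quotient diffeology: plots are the maps which lift locally to plots. -/
instance quotientDiffeology [DiffeologicalSpace X] {s : Setoid X} :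
    DiffeologicalSpace (Quotient s) where
  plots n := {p | ∀ x, ∃ u : Set (EuclideanSpace ℝ (Fin n)), IsOpen u ∧ x ∈ u ∧
    ∃ q : EuclideanSpace ℝ (Fin n) → X, IsPlot q ∧ ∀ z ∈ u, p z = Quotient.mk s (q z)}
  constant_plots x := fun z => ⟨univ, isOpen_univ, mem_univ _, fun _ => x.out, isPlot_const,
    fun _ _ => (Quotient.out_eq x).symm⟩
  plot_reparam {n m p f} hp hf := fun x => by
    obtain ⟨u, hu, hxu, q, hq, h⟩ := hp (f x)
    exact ⟨f ⁻¹' u, hu.preimage hf.continuous, hxu, q ∘ f, isPlot_reparam hq hf,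
      fun z hz => h _ hz⟩
  locality {n p} hp := fun x => by
    obtain ⟨u, hu, hxu, h⟩ := hp x
    obtain ⟨f, hf, hfu, v, hv, hxv, hfv⟩ := exists_smooth_retract hu hxu
    obtain ⟨w, hw, hxw, q, hq, hqw⟩ := h hfu hf x
    refine ⟨v ∩ w, hv.inter hw, ⟨hxv, hxw⟩, q, hq, fun z hz => ?_⟩
    rw [← hqw z hz.2, Function.comp_apply, hfv z hz.1]

/-- The functional diffeology on a set `S` of smooth maps from `X` to `Y`, given through the
evaluation `ev : S → X → Y`: a map `ρ : ℝᵏ → S` is a plot iff `(y, x) ↦ ρ(y)(x)` is smooth,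
i.e. iff `z ↦ ρ(q(z))(p(z))` is a plot of `Y` for every plot `(q, p)` of `ℝᵏ × X`. -/
@[reducible]
def functionalDiffeology [DiffeologicalSpace X] [DiffeologicalSpace Y] (ev : S → X → Y)
    (hev : ∀ s, DSmooth (ev s)) : DiffeologicalSpace S where
  plots k := {ρ | ∀ (n : ℕ) (q : EuclideanSpace ℝ (Fin n) → EuclideanSpace ℝ (Fin k))
    (p : EuclideanSpace ℝ (Fin n) → X), ContDiff ℝ ∞ q → IsPlot p →
      IsPlot (fun z => ev (ρ (q z)) (p z))}
  constant_plots s := fun n q p _ hp => hev s n p hp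
  plot_reparam hρ hf := fun n q p hq hp => hρ n _ p (hf.comp hq) hp
  locality {k ρ} hρ := fun n q p hq hp => DiffeologicalSpace.locality fun x => by
    obtain ⟨u, hu, hxu, h⟩ := hρ (q x)
    refine ⟨q ⁻¹' u, hu.preimage hq.continuous, hxu, fun {m f} hfu hf => ?_⟩
    exact h (f := q ∘ f) hfu (hq.comp hf) m id (p ∘ f) contDiff_id (isPlot_reparam hp hf)

/-- The space `C^∞(X, Y)` of smooth maps between diffeological spaces. -/
structure SmoothMap (X : Type u) (Y : Type v) [DiffeologicalSpace X] [DiffeologicalSpace Y] where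
  /-- the underlying map -/
  toFun : X → Y
  smooth : DSmooth toFun

instance [DiffeologicalSpace X] [DiffeologicalSpace Y] :
    CoeFun (SmoothMap X Y) (fun _ => X → Y) := ⟨SmoothMap.toFun⟩

/-- `C^∞(X, Y)` carries the functional diffeology. -/
instance [DiffeologicalSpace X] [DiffeologicalSpace Y] : DiffeologicalSpace (SmoothMap X Y) :=
  functionalDiffeology SmoothMap.toFun SmoothMap.smooth

end Constructions

/-! ### The internal tangent cone -/

section Tangent

variable {X : Type u} [DiffeologicalSpace X]

/-- The smooth paths `c : ℝ → X` with `c 0 = x`. -/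
abbrev CurvesAt (x : X) := {c : SmoothMap ℝ X // c 0 = x}

/-- Two curves through `x` are tangent if all smooth functions have the same derivative along
them. -/
instance tangentSetoid (x : X) : Setoid (CurvesAt x) where
  r c c' := ∀ f : SmoothMap X ℝ, deriv (fun t => f (c.1 t)) 0 = deriv (fun t => f (c'.1 t)) 0
  iseqv := ⟨fun _ _ => rfl, fun h f => (h f).symm, fun h h' f => (h f).trans (h' f)⟩

/-- The internal tangent cone of `X` at `x`. -/
def TangentCone (x : X) : Type u := Quotient (tangentSetoid x)

/-- The tangent cone carries the quotient of the functional diffeology on curves. -/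
instance (x : X) : DiffeologicalSpace (TangentCone x) :=
  inferInstanceAs (DiffeologicalSpace (Quotient (tangentSetoid x)))

/-- The tangent vector `∂ₜ c(t)|_{t=0}` of a curve. -/
def tangent {x : X} (c : CurvesAt x) : TangentCone x := Quotient.mk _ c

/-- `Df(V)`, the derivative of a smooth function along a tangent vector. -/
def dirDeriv {x : X} (f : SmoothMap X ℝ) : TangentCone x → ℝ :=
  Quotient.lift (fun c : CurvesAt x => deriv (fun t => f (c.1 t)) 0) (fun _ _ h => h f)

@[simp] lemma dirDeriv_tangent {x : X} (f : SmoothMap X ℝ) (c : CurvesAt x) :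
    dirDeriv f (tangent c) = deriv (fun t => f (c.1 t)) 0 := rfl

lemma tangent_surjective {x : X} (V : TangentCone x) : ∃ c : CurvesAt x, tangent c = V :=
  Quotient.exists_rep V

lemma tangentCone_ext {x : X} {V W : TangentCone x} (h : ∀ f, dirDeriv f V = dirDeriv f W) :
    V = W := by
  obtain ⟨c, rfl⟩ := tangent_surjective V
  obtain ⟨d, rfl⟩ := tangent_surjective W
  exact Quotient.sound h

end Tangent

/-! ### Diffeological groups -/

/-- A diffeological group: multiplication and inversion are smooth. -/
class IsDiffeologicalGroup (G : Type u) [Group G] [DiffeologicalSpace G] : Prop where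
  smooth_mul : DSmooth (fun p : G × G => p.1 * p.2)
  smooth_inv : DSmooth (fun g : G => g⁻¹)

section LieAlgebra

variable (G : Type u) [Group G] [DiffeologicalSpace G]

/-- The tangent cone `𝔤` at the neutral element of a diffeological group. -/
abbrev LieAlg := TangentCone (1 : G)

variable {G}

lemma DSmooth.mul [IsDiffeologicalGroup G] {X : Type v} [DiffeologicalSpace X] {f g : X → G}
    (hf : DSmooth f) (hg : DSmooth g) : DSmooth (fun x => f x * g x) := fun n p hp =>
  IsDiffeologicalGroup.smooth_mul n (fun z => (f (p z), g (p z))) ⟨hf n p hp, hg n p hp⟩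

/-- The pointwise product of two curves through `1`. -/
def curveMul [IsDiffeologicalGroup G] (c d : CurvesAt (1 : G)) : CurvesAt (1 : G) :=
  ⟨⟨fun t => c.1 t * d.1 t, DSmooth.mul c.1.smooth d.1.smooth⟩, by simp [c.2, d.2]⟩

/-- The curve `t ↦ c(at)`. -/
def curveScale (a : ℝ) (c : CurvesAt (1 : G)) : CurvesAt (1 : G) :=
  ⟨⟨fun t => c.1 (a * t), c.1.smooth.comp (contDiff_const.mul contDiff_id).dSmooth⟩,
    by simp [c.2]⟩

/-- The constant curve. -/
def curveOne : CurvesAt (1 : G) := ⟨⟨fun _ => 1, dSmooth_const⟩, rfl⟩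

lemma deriv_curveMul [IsDiffeologicalGroup G] (f : SmoothMap G ℝ) (c d : CurvesAt (1 : G)) :
    deriv (fun t => f (c.1 t * d.1 t)) 0 =
      deriv (fun t => f (c.1 t)) 0 + deriv (fun t => f (d.1 t)) 0 := by
  have hproj : ∀ i : Fin 2, ContDiff ℝ ∞ (fun z : EuclideanSpace ℝ (Fin 2) => z i) := fun i =>
    (EuclideanSpace.proj (𝕜 := ℝ) i).contDiff
  have hP : ContDiff ℝ ∞ (fun z : EuclideanSpace ℝ (Fin 2) => f (c.1 (z 0) * d.1 (z 1))) :=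
    (f.smooth.comp (DSmooth.mul (c.1.smooth.comp (hproj 0).dSmooth)
      (d.1.smooth.comp (hproj 1).dSmooth))).contDiff
  have hj : ContDiff ℝ ∞ (fun w : ℝ × ℝ => (!₂[w.1, w.2] : EuclideanSpace ℝ (Fin 2))) := by
    rw [contDiff_euclidean]
    intro i
    fin_cases i
    · exact contDiff_fst
    · exact contDiff_snd
  have hF : ContDiff ℝ ∞ (fun w : ℝ × ℝ => f (c.1 w.1 * d.1 w.2)) := hP.comp hj
  have hL := (hF.differentiable (by simp) (0, 0)).hasFDerivAt
  set L := fderiv ℝ (fun w : ℝ × ℝ => f (c.1 w.1 * d.1 w.2)) (0, 0)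
  have h1 : HasDerivAt (fun t : ℝ => f (c.1 t * d.1 t)) (L (1, 1)) 0 :=
    hL.comp_hasDerivAt (f := fun t : ℝ => (t, t)) 0 ((hasDerivAt_id 0).prodMk (hasDerivAt_id 0))
  have h2 : HasDerivAt (fun t : ℝ => f (c.1 t)) (L (1, 0)) 0 := by
    have := hL.comp_hasDerivAt (f := fun t : ℝ => (t, (0 : ℝ))) 0
      ((hasDerivAt_id 0).prodMk (hasDerivAt_const 0 0))
    simpa [Function.comp_def, d.2] using this
  have h3 : HasDerivAt (fun t : ℝ => f (d.1 t)) (L (0, 1)) 0 := by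
    have := hL.comp_hasDerivAt (f := fun t : ℝ => ((0 : ℝ), t)) 0
      ((hasDerivAt_const 0 0).prodMk (hasDerivAt_id 0))
    simpa [Function.comp_def, c.2] using this
  rw [h1.deriv, h2.deriv, h3.deriv, ← map_add]
  simp

lemma deriv_curveScale (f : SmoothMap G ℝ) (a : ℝ) (c : CurvesAt (1 : G)) :
    deriv (fun t => f (c.1 (a * t))) 0 = a * deriv (fun t => f (c.1 t)) 0 := by
  have := deriv_comp_mul_left a (fun t => f (c.1 t)) 0
  simpa using this

/-- Addition on `𝔤`: `∂ₜ c(0) + ∂ₜ d(0) = ∂ₜ (c d)(0)`. -/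
instance [IsDiffeologicalGroup G] : Add (LieAlg G) :=
  ⟨Quotient.map₂ curveMul (fun c c' h d d' h' f => by
    have h1 := h f
    have h2 := h' f
    simp only [curveMul, deriv_curveMul, h1, h2])⟩

/-- Scalar multiplication on `𝔤`: `a ∂ₜ c(0) = ∂ₜ c(at)(0)`. -/
instance : SMul ℝ (LieAlg G) :=
  ⟨fun a => Quotient.map (curveScale a) (fun c c' h f => by
    have h1 := h f
    simp only [curveScale, deriv_curveScale, h1])⟩

instance : Zero (LieAlg G) := ⟨tangent curveOne⟩

instance : Neg (LieAlg G) := ⟨fun V => (-1 : ℝ) • V⟩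

instance [IsDiffeologicalGroup G] : Sub (LieAlg G) := ⟨fun V W => V + -W⟩

instance : SMul ℕ (LieAlg G) := ⟨fun n V => (n : ℝ) • V⟩

instance : SMul ℤ (LieAlg G) := ⟨fun n V => (n : ℝ) • V⟩

@[simp] lemma dirDeriv_add [IsDiffeologicalGroup G] (f : SmoothMap G ℝ) (V W : LieAlg G) :
    dirDeriv f (V + W) = dirDeriv f V + dirDeriv f W := by
  obtain ⟨c, rfl⟩ := tangent_surjective V
  obtain ⟨d, rfl⟩ := tangent_surjective W
  exact deriv_curveMul f c d

@[simp] lemma dirDeriv_smul (f : SmoothMap G ℝ) (a : ℝ) (V : LieAlg G) :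
    dirDeriv f (a • V) = a * dirDeriv f V := by
  obtain ⟨c, rfl⟩ := tangent_surjective V
  exact deriv_curveScale f a c

lemma dirDeriv_zero (f : SmoothMap G ℝ) : dirDeriv f (0 : LieAlg G) = 0 :=
  deriv_const 0 (f 1)

lemma dirDeriv_injective :
    Function.Injective (fun (V : LieAlg G) (f : SmoothMap G ℝ) => dirDeriv f V) :=
  fun _ _ h => tangentCone_ext fun f => congrFun h f

instance [IsDiffeologicalGroup G] : AddCommGroup (LieAlg G) :=
  dirDeriv_injective.addCommGroup _
    (funext fun f => dirDeriv_zero f)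
    (fun V W => funext fun f => dirDeriv_add f V W)
    (fun V => funext fun f => by
      change dirDeriv f ((-1 : ℝ) • V) = -dirDeriv f V
      simp)
    (fun V W => funext fun f => by
      change dirDeriv f (V + (-1 : ℝ) • W) = dirDeriv f V - dirDeriv f W
      simp [sub_eq_add_neg])
    (fun V n => funext fun f => by
      change dirDeriv f ((n : ℝ) • V) = n • dirDeriv f V
      simp)
    (fun V n => funext fun f => by
      change dirDeriv f ((n : ℝ) • V) = n • dirDeriv f V
      simp)

instance [IsDiffeologicalGroup G] : Module ℝ (LieAlg G) :=
  dirDeriv_injective.module ℝ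
    { toFun := fun V f => dirDeriv f V
      map_zero' := funext fun f => dirDeriv_zero f
      map_add' := fun V W => funext fun f => dirDeriv_add f V W }
    (fun a V => funext fun f => dirDeriv_smul f a V)

/-- The curve `t ↦ g c(t) g⁻¹`. -/
def curveConj [IsDiffeologicalGroup G] (g : G) (c : CurvesAt (1 : G)) : CurvesAt (1 : G) :=
  ⟨⟨fun t => g * c.1 t * g⁻¹,
    DSmooth.mul (DSmooth.mul dSmooth_const c.1.smooth) dSmooth_const⟩, by simp [c.2]⟩

/-- The adjoint action `Ad_g (∂ₜ c(0)) = ∂ₜ (g c g⁻¹)(0)` of `G` on `𝔤`. -/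
def Ad [IsDiffeologicalGroup G] (g : G) : LieAlg G → LieAlg G :=
  Quotient.map (curveConj g) (fun _ _ h f =>
    h ⟨fun x => f (g * x * g⁻¹), f.smooth.comp
      (DSmooth.mul (DSmooth.mul dSmooth_const dSmooth_id) dSmooth_const)⟩)

/-- The derivative at `0` of the path `γ` in `𝔤` is `Z`: the path is smooth and has the same
tangent vector at `0` as the affine path `t ↦ γ(0) + tZ`. -/
def HasVelocity [IsDiffeologicalGroup G] (γ : ℝ → LieAlg G) (Z : LieAlg G) : Prop :=
  DSmooth γ ∧ ∀ F : SmoothMap (LieAlg G) ℝ,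
    deriv (fun t => F (γ t)) 0 = deriv (fun t : ℝ => F (γ 0 + t • Z)) 0

/-- `br` is the derivative of the adjoint action, `[∂ₜ c(0), Y] = ∂ₜ (Ad_{c(t)} Y)(0)`, and is
a smooth Lie bracket. -/
structure IsSmoothLieBracket [IsDiffeologicalGroup G] (br : LieAlg G → LieAlg G → LieAlg G) :
    Prop where
  deriv_Ad : ∀ (c : CurvesAt (1 : G)) (Y : LieAlg G),
    HasVelocity (fun t => Ad (c.1 t) Y) (br (tangent c) Y)
  add_left : ∀ X Y Z, br (X + Y) Z = br X Z + br Y Z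
  smul_left : ∀ (a : ℝ) X Y, br (a • X) Y = a • br X Y
  add_right : ∀ X Y Z, br X (Y + Z) = br X Y + br X Z
  smul_right : ∀ (a : ℝ) X Y, br X (a • Y) = a • br X Y
  self : ∀ X, br X X = 0
  jacobi : ∀ X Y Z, br X (br Y Z) + br Y (br Z X) + br Z (br X Y) = 0
  smooth : DSmooth (fun p : LieAlg G × LieAlg G => br p.1 p.2)

end LieAlgebra

/-- A diffeological Lie group: a diffeological group such that the tangent cone `𝔤` at `1` is
a diffeological vector space and the derivative of the adjoint action on `𝔤` defines a smooth
Lie bracket. -/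
structure IsDiffeologicalLieGroup (G : Type u) [Group G] [DiffeologicalSpace G] : Prop extends
    IsDiffeologicalGroup G where
  smooth_add : DSmooth (fun p : LieAlg G × LieAlg G => p.1 + p.2)
  smooth_smul : DSmooth (fun p : ℝ × LieAlg G => p.1 • p.2)
  exists_bracket : ∃ br : LieAlg G → LieAlg G → LieAlg G, IsSmoothLieBracket br

section Regular

variable {G : Type u} [Group G] [DiffeologicalSpace G]

/-- `g` solves `g(0) = 1`, `(dg/dt)(t) g(t)⁻¹ = v(t)` on `[0, 1]`: for each `t`, the path
`s ↦ g(s) g(t)⁻¹`, which passes through `1` at `s = t`, has tangent vector `v(t)` there, i.e. every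
smooth function on `G` has derivative `Df(v(t))` along it (one-sided at the end points). -/
def IsSolution (v : SmoothMap (Icc (0 : ℝ) 1) (LieAlg G)) (g : SmoothMap (Icc (0 : ℝ) 1) G) :
    Prop :=
  g 0 = 1 ∧ ∀ (t : Icc (0 : ℝ) 1) (f : SmoothMap G ℝ),
    HasDerivWithinAt (fun s : ℝ => f (g (projIcc 0 1 zero_le_one s) * (g t)⁻¹))
      (dirDeriv f (v t)) (Icc 0 1) t

variable (G) in
/-- A diffeological Lie group `G` is regular if there is a smooth map
`Exp : C^∞([0,1], 𝔤) → C^∞([0,1], G)` such that `Exp v` is the unique solution of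
`g(0) = 1`, `(dg/dt) g⁻¹ = v`. -/
def IsRegular : Prop :=
  ∃ Exp : SmoothMap (Icc (0 : ℝ) 1) (LieAlg G) → SmoothMap (Icc (0 : ℝ) 1) G, DSmooth Exp ∧
    ∀ v, IsSolution v (Exp v) ∧ ∀ g, IsSolution v g → g = Exp v

end Regular

/-! ### The group of diffeomorphisms of a manifold -/

section DiffGroup

variable {E : Type u} [NormedAddCommGroup E] [NormedSpace ℝ E] {H : Type v} [TopologicalSpace H]
  (I : ModelWithCorners ℝ E H) (M : Type w) [TopologicalSpace M] [ChartedSpace H M]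

/-- The nebulae diffeology of a manifold: the plots are the smooth maps. -/
@[reducible]
def manifoldDiffeology : DiffeologicalSpace M :=
  .ofCorePlotsOn {
    isPlotOn := fun {n u} _ p => ContMDiffOn 𝓘(ℝ, EuclideanSpace ℝ (Fin n)) I ∞ p u
    isPlotOn_congr := fun _ _ _ h => contMDiffOn_congr h
    isPlot := fun {n} p => ContMDiff 𝓘(ℝ, EuclideanSpace ℝ (Fin n)) I ∞ p
    isPlotOn_univ := contMDiffOn_univ
    isPlot_const := fun _ => contMDiff_const
    isPlotOn_reparam := fun _ _ _ h hp hf => hp.comp hf.contMDiffOn h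
    locality := fun _ _ h x hxu => by
      obtain ⟨v, hv, hxv, hv'⟩ := h x hxu
      exact ((hv' x hxv).contMDiffAt (hv.mem_nhds hxv)).contMDiffWithinAt }

/-- The group `Diff(M)` of smooth diffeomorphisms of `M`. -/
abbrev Diff := M ≃ₘ⟮I, I⟯ M

variable {M}

/-- The group law on `Diff(M)` is composition. -/
instance : Group (Diff I M) where
  mul f g := g.trans f
  one := Diffeomorph.refl I M ∞
  inv f := f.symm
  mul_assoc _ _ _ := rfl
  one_mul _ := rfl
  mul_one _ := rfl
  inv_mul_cancel f := Diffeomorph.ext fun x => f.symm_apply_apply x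

/-- The functional diffeology of `Diff(M)`. -/
instance : DiffeologicalSpace (Diff I M) :=
  letI := manifoldDiffeology I M
  functionalDiffeology (fun (φ : Diff I M) (x : M) => φ x)
    (fun φ _ _ hp => φ.contMDiff.comp hp)

/-- The vector field `x ↦ ∂ₜ C(t)(x)|_{t=0}` of a path `C` in `Diff(M)` with `C(0) = id`. -/
def velocityField (C : CurvesAt (1 : Diff I M)) (x : M) : TangentSpace I x :=
  (mfderiv 𝓘(ℝ, ℝ) I (fun t : ℝ => C.1 t x) 0 (1 : ℝ) : E)

/-- A vector field has a global flow if there is `Φ : ℝ × M → M` such that, for all `x`,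
`Φ(·, x)` is an integral curve defined on all of `ℝ` and starting at `x`. -/
def HasGlobalFlow (V : (x : M) → TangentSpace I x) : Prop :=
  ∃ Φ : ℝ → M → M, ∀ x, Φ 0 x = x ∧ IsMIntegralCurve (I := I) (fun t => Φ t x) V

end DiffGroup

/-! ### The path of diffeomorphisms of the interval and its transport to a manifold -/

/-- The standard mollifier `exp(1/(u²-1))/K` on `]-1, 1[`, extended by `0`. -/
def mollifier (u : ℝ) : ℝ :=
  if |u| < 1 then
    Real.exp (1 / (u ^ 2 - 1)) / ∫ w in (-1 : ℝ)..1, Real.exp (1 / (w ^ 2 - 1))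
  else 0

/-- `φ_α(u) = φ(u/α)/α`. -/
def mollifierScaled (α u : ℝ) : ℝ := mollifier (u / α) / α

/-- `c_t(x) = x + t (𝟏_{[|t|, 1-|t|]} * φ_{|t|})(x)`. -/
def intervalPath (t x : ℝ) : ℝ :=
  x + t * ∫ y in Icc |t| (1 - |t|), mollifierScaled |t| (x - y)

/-- The domain `]0, 1[ × B` of a thick path, `B` being the open unit ball of `ℝᵏ`. -/
def tubeDomain (k : ℕ) : Set (ℝ × EuclideanSpace ℝ (Fin k)) := Ioo 0 1 ×ˢ Metric.ball 0 1

/-- A thick path in an `n`-manifold, i.e. a tubular neighbourhood of a closed copy of `]0, 1[`: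
a smooth embedding `]0, 1[ × B → M` of codimension zero for which the images of
`]0, 1[ × {0}` and of the closed tubes `]0, 1[ × {‖y‖ ≤ r}`, `r < 1`, are closed in `M`. The values
of `T` outside `]0, 1[ × B` are irrelevant. -/
structure IsThickPath {n k : ℕ} {M : Type u} [TopologicalSpace M]
    [ChartedSpace (EuclideanSpace ℝ (Fin n)) M] (T : ℝ × EuclideanSpace ℝ (Fin k) → M) : Prop where
  codim_zero : n = k + 1
  smooth : ContMDiffOn 𝓘(ℝ, ℝ × EuclideanSpace ℝ (Fin k)) (𝓡 n) ∞ T (tubeDomain k)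
  immersion : ∀ z ∈ tubeDomain k,
    Function.Injective (mfderiv 𝓘(ℝ, ℝ × EuclideanSpace ℝ (Fin k)) (𝓡 n) T z)
  embedding : IsEmbedding (fun z : tubeDomain k => T z)
  closed : ∀ r < (1 : ℝ), IsClosed (T '' (Ioo 0 1 ×ˢ Metric.closedBall 0 r))

/-- A smooth cutoff function with values in `[0, 1]`, equal to `1` near `0`, with compact support
in `]-1, 1[`. -/
structure IsCutoff (φ : ℝ → ℝ) : Prop where
  smooth : ContDiff ℝ ∞ φ
  mem_Icc : ∀ r, φ r ∈ Icc (0 : ℝ) 1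
  eq_one : ∀ᶠ r in 𝓝 0, φ r = 1
  eq_zero : ∃ a < (1 : ℝ), ∀ r, a ≤ |r| → φ r = 0

/-- `C` is the path transported from the interval to `M` along the thick path `T`, damped by
`φ`: `C_t(T(x, y)) = T(c_{φ(‖y‖)t}(x), y)`, and `C_t` is the identity outside the tube. -/
def IsTransported {n k : ℕ} {M : Type u} [TopologicalSpace M]
    [ChartedSpace (EuclideanSpace ℝ (Fin n)) M] (T : ℝ × EuclideanSpace ℝ (Fin k) → M) (φ : ℝ → ℝ)
    (C : CurvesAt (1 : Diff (𝓡 n) M)) : Prop :=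
  ∀ t : ℝ, |t| < 1 / 4 →
    (∀ z ∈ tubeDomain k, C.1 t (T z) = T (intervalPath (φ ‖z.2‖ * t) z.1, z.2)) ∧
    ∀ p ∉ T '' tubeDomain k, C.1 t p = p

end DiffLie

end

open DiffLie

open Set Topology Diffeology
open scoped Manifold ContDiff

noncomputable section

/-! There are three independent strands.

Lie group structure. A map from a Euclidean space to `Diff(M)` is a plot iff it is jointly smooth
(`isPlot_diff_iff`), and inversion is smooth by the inverse function theorem (`SmoothFam.inv`). The
heart is that `𝔤` is the space of smooth vector fields, with smooth families of fields as plots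
(`isPlot_lie_iff`).

Injectivity: tangent vectors are tested against all smooth functions `f` on `Diff(M)`, and it must
be shown that evaluations already suffice (`deriv_eq_zero_of_zeroVel`). Locally a curve of zero
velocity has the form `id + t w(t, ·)` with `w(0, ·) = 0`. The two-parameter family `id + s w(t, ·)`
is trivial on both axes, so `f` has zero derivative along its diagonal. Dividing by finitely many
such factors makes the curve trivial near a compact set without changing the derivative `λ` of `f`.
Such curves, trivial on larger and larger compact sets and run at speed `i + 1` about the times
`2⁻ⁱ`, fit into one smooth path, along which `f` has derivative `(i + 1) λ` at `2⁻ⁱ`. These values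
converge, so `λ = 0`.

Surjectivity: a partition of unity cuts a smooth family of fields into pieces supported in charts,
each piece gives a small perturbation of the identity, and the locally finite product of these has
the required velocity (`SmoothField.exists_curves`). The derivative of the adjoint action is then a
commutator of derivations (`hasDerivAt_lieD_Ad`), and the axioms are checked on functions.

Non-regularity. Near any fixed `x` in `]0,1[` one has `c_t(x) = x + t` for small `t`, so `c` is
smooth at `t = 0` although each `c_t` fixes the end points. Transported along a thick path, it has a
velocity field equal to `e'` on the axis. An integral curve starting on the axis follows it to its
end in finite time; the axis being closed, this end is not in `M`
(`IsThickPath.not_isMIntegralCurveOn`). A global flow, or a solution of the equation in `Diff(M)`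
for the constant path, would yield an integral curve that survives this time.

Existence of a thick path. In a non-compact component a point can be pushed to infinity along a ray
of a locally finite cover: there is a locally diffeomorphic injection `Θ` of `M` whose range misses
the point (`exists_push`). At a boundary point `z` of the range there is a ball inside the range
touching the boundary only at `z` (`exists_boundary_ball`). In dimension at least two, inversion at
`z` turns a straight cylinder into a tube in this ball with both ends at `z`
(`exists_tube_in_ball`), and `Θ⁻¹` sends `z` to infinity. In dimension one pushes embed the whole
component in an arc (`exists_isThickPath_of_dim_one`). -/

namespace DiffLie

universe u v w

/-! ### The inverse function theorem on manifolds -/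

section LocalInverse

variable {E₁ : Type*} [NormedAddCommGroup E₁] [NormedSpace ℝ E₁] [CompleteSpace E₁]
  {E₂ : Type*} [NormedAddCommGroup E₂] [NormedSpace ℝ E₂] [CompleteSpace E₂]
  {H₁ : Type*} [TopologicalSpace H₁] {H₂ : Type*} [TopologicalSpace H₂]
  {I₁ : ModelWithCorners ℝ E₁ H₁} [I₁.Boundaryless]
  {I₂ : ModelWithCorners ℝ E₂ H₂}
  {M₁ : Type*} [TopologicalSpace M₁] [ChartedSpace H₁ M₁] [IsManifold I₁ ∞ M₁]
  {M₂ : Type*} [TopologicalSpace M₂] [ChartedSpace H₂ M₂]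

/-- The inverse function theorem on manifolds. -/
theorem exists_localInverse_of_bijective_mfderiv {f : M₁ → M₂} {x : M₁}
    (hf : ContMDiffAt I₁ I₂ ∞ f x) (hbij : Function.Bijective (mfderiv I₁ I₂ f x)) :
    ∃ g : M₂ → M₁, ContMDiffAt I₂ I₁ ∞ g (f x) ∧ g (f x) = x ∧
      (∀ᶠ y in 𝓝 (f x), f (g y) = y) ∧ ∀ᶠ x' in 𝓝 x, g (f x') = x' := by
  set e₁ := extChartAt I₁ x
  set e₂ := extChartAt I₂ (f x)
  set F : E₁ → E₂ := e₂ ∘ f ∘ e₁.symm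
  have hFc : ContDiffAt ℝ ∞ F (e₁ x) := by
    have := (contMDiffAt_iff.1 hf).2
    rwa [I₁.range_eq_univ, contDiffWithinAt_univ] at this
  have hmd : mfderiv I₁ I₂ f x = fderiv ℝ F (e₁ x) := by
    refine (if_pos (hf.mdifferentiableAt (by simp))).trans ?_
    change fderivWithin ℝ F (range I₁) (e₁ x) = _
    rw [I₁.range_eq_univ, fderivWithin_univ]
  set L : E₁ →L[ℝ] E₂ := fderiv ℝ F (e₁ x)
  have hL : Function.Bijective L := by
    rw [hmd] at hbij
    exact hbij
  let L' : E₁ ≃L[ℝ] E₂ := ContinuousLinearEquiv.ofBijective L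
    (LinearMap.ker_eq_bot.2 hL.1) (LinearMap.range_eq_top.2 hL.2)
  have hFL : HasFDerivAt F (L' : E₁ →L[ℝ] E₂) (e₁ x) := by
    -- The coercion of `L'` is `L` by construction.
    have := (hFc.differentiableAt (by simp)).hasFDerivAt
    convert! this
  have hstrict := hFc.hasStrictFDerivAt' hFL (by simp)
  set G : E₂ → E₁ := hFc.localInverse hFL (by simp)
  have hGc : ContDiffAt ℝ ∞ G (F (e₁ x)) := hFc.to_localInverse hFL (by simp)
  have hG1 : ∀ᶠ y in 𝓝 (F (e₁ x)), F (G y) = y := hstrict.eventually_right_inverse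
  have hG2 : ∀ᶠ y in 𝓝 (e₁ x), G (F y) = y := hstrict.eventually_left_inverse
  have hG0 : G (F (e₁ x)) = e₁ x := hFc.localInverse_apply_image hFL (by simp)
  have hFx : F (e₁ x) = e₂ (f x) := by simp [F, e₁]
  rw [hFx] at hGc hG1 hG0
  have hc₂ : ContinuousAt e₂ (f x) := continuousAt_extChartAt _
  have hGe : ContMDiffAt I₂ 𝓘(ℝ, E₁) ∞ (G ∘ e₂) (f x) :=
    hGc.contMDiffAt.comp _ contMDiffAt_extChartAt
  have hes : ContMDiffAt 𝓘(ℝ, E₁) I₁ ∞ e₁.symm (e₁ x) :=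
    (contMDiffOn_extChartAt_symm x).contMDiffAt (extChartAt_target_mem_nhds x)
  have hg : ContMDiffAt I₂ I₁ ∞ (e₁.symm ∘ (G ∘ e₂)) (f x) := by
    refine ContMDiffAt.comp (f x) ?_ hGe
    rw [Function.comp_apply, hG0]
    exact hes
  have hgx : (e₁.symm ∘ (G ∘ e₂)) (f x) = x := by
    simp only [Function.comp_apply, hG0]
    exact extChartAt_to_inv x
  refine ⟨e₁.symm ∘ (G ∘ e₂), hg, hgx, ?_, ?_⟩
  · have hsrc : ∀ᶠ y in 𝓝 (f x), f ((e₁.symm ∘ (G ∘ e₂)) y) ∈ e₂.source := by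
      have : ContinuousAt (fun y => f ((e₁.symm ∘ (G ∘ e₂)) y)) (f x) := by
        refine ContinuousAt.comp (g := f) ?_ hg.continuousAt
        rw [hgx]
        exact hf.continuousAt
      refine this.preimage_mem_nhds ?_
      rw [hgx]
      exact extChartAt_source_mem_nhds (f x)
    filter_upwards [hc₂.eventually hG1, hsrc, extChartAt_source_mem_nhds (I := I₂) (f x)]
      with y h1 h2 h3
    exact e₂.injOn h2 h3 h1
  · have hc₁ : ContinuousAt e₁ x := continuousAt_extChartAt _
    filter_upwards [hc₁.eventually hG2, extChartAt_source_mem_nhds (I := I₁) x] with y h1 h2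
    have hy : e₁.symm (e₁ y) = y := e₁.left_inv h2
    simp only [F, Function.comp_apply, hy] at h1
    simp [h1, hy]

end LocalInverse

/-! ### Smooth families of diffeomorphisms -/

section SmoothFamilies

variable {n : ℕ} {M : Type u} [TopologicalSpace M] [ChartedSpace (EuclideanSpace ℝ (Fin n)) M]
  {P : Type*} [NormedAddCommGroup P] [NormedSpace ℝ P]
  {Q : Type*} [NormedAddCommGroup Q] [NormedSpace ℝ Q]

@[simp] lemma diff_mul_apply (f g : Diff (𝓡 n) M) (x : M) : (f * g) x = f (g x) := rfl

@[simp] lemma diff_one_apply (x : M) : (1 : Diff (𝓡 n) M) x = x := rfl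

@[simp] lemma diff_inv_apply_self (f : Diff (𝓡 n) M) (x : M) : f⁻¹ (f x) = x :=
  f.symm_apply_apply x

@[simp] lemma diff_apply_inv_self (f : Diff (𝓡 n) M) (x : M) : f (f⁻¹ x) = x :=
  f.apply_symm_apply x

/-- A family of diffeomorphisms depending smoothly on a parameter in a normed space. -/
def SmoothFam (a : P → Diff (𝓡 n) M) : Prop :=
  ContMDiff (𝓘(ℝ, P).prod (𝓡 n)) (𝓡 n) ∞ (fun q : P × M => a q.1 q.2)

/-- A smooth family of diffeomorphisms applied to smoothly varying points. -/
lemma SmoothFam.apply {a : P → Diff (𝓡 n) M} (ha : SmoothFam a) {E' : Type*}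
    [NormedAddCommGroup E'] [NormedSpace ℝ E'] {H' : Type*} [TopologicalSpace H']
    {J : ModelWithCorners ℝ E' H'} {N : Type*} [TopologicalSpace N] [ChartedSpace H' N]
    {f : N → P} {g : N → M} (hf : ContMDiff J 𝓘(ℝ, P) ∞ f) (hg : ContMDiff J (𝓡 n) ∞ g) :
    ContMDiff J (𝓡 n) ∞ (fun z => a (f z) (g z)) :=
  ContMDiff.comp ha (hf.prodMk hg)

lemma SmoothFam.one : SmoothFam (fun _ : P => (1 : Diff (𝓡 n) M)) := contMDiff_snd

lemma SmoothFam.mul {a b : P → Diff (𝓡 n) M} (ha : SmoothFam a) (hb : SmoothFam b) :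
    SmoothFam (fun p => a p * b p) :=
  ha.apply contMDiff_fst hb

lemma SmoothFam.comp {a : P → Diff (𝓡 n) M} (ha : SmoothFam a) {f : Q → P}
    (hf : ContDiff ℝ ∞ f) : SmoothFam (fun q => a (f q)) :=
  ha.apply (hf.contMDiff.comp contMDiff_fst) contMDiff_snd

/-- The map `(p, x) ↦ (p, a_p x)` has a block triangular derivative, with the identity of `P` and
the invertible derivative of `a_p` on the diagonal. It is therefore locally invertible, and the
second component of the local inverse is `a_p⁻¹ y`. -/
lemma SmoothFam.inv [IsManifold (𝓡 n) ∞ M] [CompleteSpace P] {a : P → Diff (𝓡 n) M}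
    (ha : SmoothFam a) : SmoothFam (fun p => (a p)⁻¹) := by
  rintro ⟨p, y⟩
  set x := (a p)⁻¹ y
  have hxy : a p x = y := by simp [x]
  set f : P × M → P × M := fun q => (q.1, a q.1 q.2)
  have hf : ContMDiff (𝓘(ℝ, P).prod (𝓡 n)) (𝓘(ℝ, P).prod (𝓡 n)) ∞ f := contMDiff_fst.prodMk ha
  let D : P × EuclideanSpace ℝ (Fin n) →L[ℝ] EuclideanSpace ℝ (Fin n) :=
    mfderiv (𝓘(ℝ, P).prod (𝓡 n)) (𝓡 n) (fun q : P × M => a q.1 q.2) (p, x)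
  let A : P × EuclideanSpace ℝ (Fin n) →L[ℝ] P × EuclideanSpace ℝ (Fin n) :=
    mfderiv (𝓘(ℝ, P).prod (𝓡 n)) (𝓘(ℝ, P).prod (𝓡 n)) f (p, x)
  let B : EuclideanSpace ℝ (Fin n) →L[ℝ] EuclideanSpace ℝ (Fin n) := mfderiv (𝓡 n) (𝓡 n) (a p) x
  have hmd : MDifferentiableAt (𝓘(ℝ, P).prod (𝓡 n)) (𝓡 n) (fun q : P × M => a q.1 q.2) (p, x) :=
    (ha (p, x)).mdifferentiableAt (by simp)
  have h1 : ∀ v, A v = (v.1, D v) := by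
    intro v
    have h := mfderiv_prodMk (I := 𝓘(ℝ, P).prod (𝓡 n)) (I' := 𝓘(ℝ, P)) (I'' := 𝓡 n)
      (f := fun q : P × M => q.1) (x := (p, x)) mdifferentiableAt_fst hmd
    have h' := congrArg (fun T : P × EuclideanSpace ℝ (Fin n) →L[ℝ] P × EuclideanSpace ℝ (Fin n) =>
      T v) h
    refine h'.trans (Prod.ext ?_ rfl)
    have := mfderiv_fst (I := 𝓘(ℝ, P)) (I' := 𝓡 n) (x := (p, x))
    exact congrArg (fun T : P × EuclideanSpace ℝ (Fin n) →L[ℝ] P => T v) this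
  have h2 : ∀ w : EuclideanSpace ℝ (Fin n), D ((0 : P), w) = B w := by
    intro w
    have hs : MDifferentiableAt (𝓡 n) (𝓘(ℝ, P).prod (𝓡 n)) (fun x' : M => (p, x')) x :=
      (contMDiff_const.prodMk contMDiff_id : ContMDiff (𝓡 n) (𝓘(ℝ, P).prod (𝓡 n)) ∞
        (fun x' : M => (p, x'))).mdifferentiable (by simp) x
    have hc := mfderiv_comp x hmd hs
    have hc' := congrArg (fun T : EuclideanSpace ℝ (Fin n) →L[ℝ] EuclideanSpace ℝ (Fin n) => T w) hc
    have h3 := congrArg (fun T : EuclideanSpace ℝ (Fin n) →L[ℝ] P × EuclideanSpace ℝ (Fin n) => T w)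
      (mfderiv_prod_right (I := 𝓘(ℝ, P)) (I' := 𝓡 n) (x₀ := p) (y₀ := x))
    exact (hc'.trans (congrArg D h3)).symm
  have hb : Function.Bijective B :=
    ((a p).mfderivToContinuousLinearEquiv (by simp) x).bijective
  have hbij : Function.Bijective A := by
    have hadd : ∀ (v : P) (w : EuclideanSpace ℝ (Fin n)), D (v, w) = D (v, 0) + B w := by
      intro v w
      rw [← h2, ← D.map_add]
      simp
    constructor
    · rw [injective_iff_map_eq_zero]
      rintro ⟨v, w⟩ hvw
      rw [h1] at hvw
      have hv : v = 0 := congrArg Prod.fst hvw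
      have hw : D (v, w) = 0 := congrArg Prod.snd hvw
      subst hv
      rw [h2] at hw
      rw [(injective_iff_map_eq_zero B).1 hb.1 w hw]
      rfl
    · rintro ⟨v, w⟩
      obtain ⟨w', hw'⟩ := hb.2 (w - D (v, 0))
      refine ⟨(v, w'), ?_⟩
      rw [h1]
      refine Prod.ext rfl ?_
      change D (v, w') = w
      rw [hadd, hw', add_sub_cancel]
  obtain ⟨g, hg, hgx, hfg, -⟩ := exists_localInverse_of_bijective_mfderiv (hf (p, x)) hbij
  have hfx : f (p, x) = (p, y) := by simp [f, hxy]
  rw [hfx] at hg hfg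
  refine (contMDiffAt_snd.comp _ hg).congr_of_eventuallyEq ?_
  filter_upwards [hfg] with q hq
  have hq1 : (f (g q)).1 = q.1 := by rw [hq]
  change (g q).1 = q.1 at hq1
  have hq2 : (f (g q)).2 = q.2 := by rw [hq]
  change a (g q).1 (g q).2 = q.2 at hq2
  rw [hq1] at hq2
  simp [← hq2]

end SmoothFamilies

/-! ### Plots of the diffeomorphism group -/

section Plots

variable {n : ℕ} {M : Type u} [TopologicalSpace M] [ChartedSpace (EuclideanSpace ℝ (Fin n)) M]
  [IsManifold (𝓡 n) ∞ M]

/-- The plots of `Diff(M)` are the smooth families. -/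
lemma isPlot_diff_iff {k : ℕ} {ρ : EuclideanSpace ℝ (Fin k) → Diff (𝓡 n) M} :
    IsPlot ρ ↔ SmoothFam ρ := by
  refine ⟨fun h => ?_, fun h m q p hq hp => ?_⟩
  · rintro ⟨z₀, x₀⟩
    set e := extChartAt (𝓡 n) x₀
    -- Plots are tested on maps defined on all of a Euclidean space. The retraction `f` into the
    -- chart target turns the inverse chart into such a map without changing it near `x₀`, and `τ`
    -- identifies parameters times chart with a Euclidean space.
    obtain ⟨f, hf, hft, v, hv, hxv, hfv⟩ :=
      exists_smooth_retract (isOpen_extChartAt_target (I := 𝓡 n) x₀) (mem_extChartAt_target x₀)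
    let W := EuclideanSpace ℝ (Fin k) × EuclideanSpace ℝ (Fin n)
    let τ := toEuclidean (E := W)
    have hp : ContMDiff 𝓘(ℝ, EuclideanSpace ℝ (Fin (Module.finrank ℝ W))) (𝓡 n) ∞
        (fun z => e.symm (f (τ.symm z).2)) := by
      have h1 : ContMDiff 𝓘(ℝ, EuclideanSpace ℝ (Fin (Module.finrank ℝ W)))
          𝓘(ℝ, EuclideanSpace ℝ (Fin n)) ∞ (fun z => f (τ.symm z).2) :=
        (hf.comp (contDiff_snd.comp τ.symm.contDiff)).contMDiff
      intro z
      exact (((contMDiffOn_extChartAt_symm x₀).contMDiffAt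
        ((isOpen_extChartAt_target x₀).mem_nhds (hft _)))).comp z (h1 z)
    have hpl := h _ (fun z => (τ.symm z).1) (fun z => e.symm (f (τ.symm z).2))
      (contDiff_fst.comp τ.symm.contDiff) hp
    have hW : ContMDiff 𝓘(ℝ, W) (𝓡 n) ∞ (fun w : W => ρ w.1 (e.symm (f w.2))) := by
      have := ContMDiff.comp (I' := 𝓘(ℝ, EuclideanSpace ℝ (Fin (Module.finrank ℝ W))))
        (show ContMDiff _ _ _ _ from hpl) τ.contDiff.contMDiff
      simpa [Function.comp_def] using this
    have hch : ContMDiffAt (𝓘(ℝ, EuclideanSpace ℝ (Fin k)).prod (𝓡 n)) 𝓘(ℝ, W) ∞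
        (fun q : EuclideanSpace ℝ (Fin k) × M => ((q.1, e q.2) : W)) (z₀, x₀) :=
      contMDiffAt_fst.prodMk_space
        ((contMDiffAt_extChartAt (I := 𝓡 n)).comp (z₀, x₀) contMDiffAt_snd)
    refine ((hW _).comp (z₀, x₀) hch).congr_of_eventuallyEq ?_
    have hc : ContinuousAt (fun q : EuclideanSpace ℝ (Fin k) × M => e q.2) (z₀, x₀) :=
      (continuousAt_extChartAt (I := 𝓡 n) x₀).comp continuousAt_snd
    filter_upwards [hc.preimage_mem_nhds (hv.mem_nhds hxv),
      continuousAt_snd.preimage_mem_nhds (extChartAt_source_mem_nhds (I := 𝓡 n) x₀)] with q h1 h2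
    simp only [Function.comp_apply]
    rw [hfv _ h1, e.left_inv h2]
  · exact h.apply hq.contMDiff hp

variable {P : Type*} [NormedAddCommGroup P] [NormedSpace ℝ P] [FiniteDimensional ℝ P]

lemma dSmooth_diff_iff [DiffeologicalSpace P] [IsContDiffCompatible P] {a : P → Diff (𝓡 n) M} :
    DSmooth a ↔ SmoothFam a := by
  refine ⟨fun h => ?_, fun h m p hp => isPlot_diff_iff.2 (h.comp hp.contDiff)⟩
  have h1 := isPlot_diff_iff.1 (h _ (toEuclidean (E := P)).symm (ContDiff.isPlot
    (toEuclidean (E := P)).symm.contDiff))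
  simpa using h1.comp (toEuclidean (E := P)).contDiff

/-- A smooth map on `Diff(M)` sends smooth families to smooth maps. -/
lemma SmoothFam.contDiff_comp {a : P → Diff (𝓡 n) M} (ha : SmoothFam a)
    (f : SmoothMap (Diff (𝓡 n) M) ℝ) : ContDiff ℝ ∞ (fun p => f (a p)) := by
  have h1 := (f.smooth _ _ (isPlot_diff_iff.2 (ha.comp
    (toEuclidean (E := P)).symm.contDiff))).contDiff
  simpa [Function.comp_def] using h1.comp (toEuclidean (E := P)).contDiff

instance : IsDiffeologicalGroup (Diff (𝓡 n) M) where
  smooth_mul _ _ hp := isPlot_diff_iff.2 ((isPlot_diff_iff.1 hp.1).mul (isPlot_diff_iff.1 hp.2))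
  smooth_inv _ _ hp := isPlot_diff_iff.2 (isPlot_diff_iff.1 hp).inv

lemma SmoothFam.of_curve (c : CurvesAt (1 : Diff (𝓡 n) M)) : SmoothFam c.1.toFun :=
  dSmooth_diff_iff.1 c.1.smooth

/-- The curve in `Diff(M)` given by a smooth family. -/
def SmoothFam.curve {a : ℝ → Diff (𝓡 n) M} (ha : SmoothFam a) (h0 : a 0 = 1) :
    CurvesAt (1 : Diff (𝓡 n) M) :=
  ⟨⟨a, dSmooth_diff_iff.2 ha⟩, h0⟩

/-- The smooth function `g ↦ h (g x)` on `Diff(M)`. -/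
def evalMap (h : M → ℝ) (hh : ContMDiff (𝓡 n) 𝓘(ℝ, ℝ) ∞ h) (x : M) :
    SmoothMap (Diff (𝓡 n) M) ℝ :=
  ⟨fun g => h (g x), fun _ _ hp => ContDiff.isPlot (contMDiff_iff_contDiff.1
    (hh.comp ((isPlot_diff_iff.1 hp).apply contMDiff_id contMDiff_const)))⟩

end Plots

/-! ### Transporting diffeomorphisms through a parametrization -/

section Transport

variable {n : ℕ} {M : Type u} [TopologicalSpace M] [ChartedSpace (EuclideanSpace ℝ (Fin n)) M]
  {P : Type*} [NormedAddCommGroup P] [NormedSpace ℝ P]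
  {W : Type*} [NormedAddCommGroup W] [NormedSpace ℝ W]

/-- `T` is a diffeomorphism of the open set `U` of a normed space onto an open subset of `M`, with
inverse `S`. -/
structure IsSmoothParam (T : W → M) (S : M → W) (U : Set W) : Prop where
  isOpen_source : IsOpen U
  isOpen_image : IsOpen (T '' U)
  contMDiffOn : ContMDiffOn 𝓘(ℝ, W) (𝓡 n) ∞ T U
  contMDiffOn_symm : ContMDiffOn (𝓡 n) 𝓘(ℝ, W) ∞ S (T '' U)
  left_inv : ∀ w ∈ U, S (T w) = w

lemma isSmoothParam_extChartAt_symm [IsManifold (𝓡 n) ∞ M] (x₀ : M) :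
    IsSmoothParam (n := n) (extChartAt (𝓡 n) x₀).symm (extChartAt (𝓡 n) x₀)
      (extChartAt (𝓡 n) x₀).target where
  isOpen_source := isOpen_extChartAt_target x₀
  isOpen_image := by
    rw [(extChartAt (𝓡 n) x₀).symm_image_target_eq_source]
    exact isOpen_extChartAt_source x₀
  contMDiffOn := contMDiffOn_extChartAt_symm x₀
  contMDiffOn_symm := by
    rw [(extChartAt (𝓡 n) x₀).symm_image_target_eq_source, extChartAt_source]
    exact contMDiffOn_extChartAt
  left_inv _ hw := (extChartAt (𝓡 n) x₀).right_inv hw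

open Classical in
/-- The self-map `g` of the source of `T`, transported to `M` and extended by the identity. -/
def transportFun (T : W → M) (S : M → W) (U : Set W) (g : W → W) (x : M) : M :=
  if x ∈ T '' U then T (g (S x)) else x

variable {T : W → M} {S : M → W} {U K : Set W}

lemma transportFun_apply (hT : IsSmoothParam (n := n) T S U) {g : W → W} {w : W} (hw : w ∈ U) :
    transportFun T S U g (T w) = T (g w) := by
  rw [transportFun, if_pos ⟨w, hw, rfl⟩, hT.left_inv w hw]

lemma transportFun_of_notMem {g : W → W} {x : M} (hx : x ∉ T '' U) :
    transportFun T S U g x = x := if_neg hx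

lemma transportFun_of_notMem_image (hT : IsSmoothParam (n := n) T S U) {g : W → W}
    (hg : ∀ w ∈ U, w ∉ K → g w = w) {x : M} (hx : x ∉ T '' K) :
    transportFun T S U g x = x := by
  by_cases h : x ∈ T '' U
  · obtain ⟨w, hw, rfl⟩ := h
    rw [transportFun_apply hT hw, hg w hw fun hK => hx ⟨w, hK, rfl⟩]
  · exact transportFun_of_notMem h

/-- The open sets `T '' U`, where the map is a composite of smooth maps, and the complement of `T ''
K`, where it is the identity, cover `M`. Only closedness of `T '' K` matters: for thick paths `K` is
not compact. -/
lemma contMDiff_transportFun (hT : IsSmoothParam (n := n) T S U) (hK : K ⊆ U)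
    (hKc : IsClosed (T '' K)) {g : P → W → W} (hg : ContDiffOn ℝ ∞ (fun q : P × W => g q.1 q.2)
      (univ ×ˢ U)) (hmaps : ∀ p, MapsTo (g p) U U) (hid : ∀ p, ∀ w ∈ U, w ∉ K → g p w = w) :
    ContMDiff (𝓘(ℝ, P).prod (𝓡 n)) (𝓡 n) ∞
      (fun q : P × M => transportFun T S U (g q.1) q.2) := by
  rintro ⟨p, x⟩
  by_cases hx : x ∈ T '' U
  · have h1 : ContMDiffAt (𝓘(ℝ, P).prod (𝓡 n)) 𝓘(ℝ, P × W) ∞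
        (fun q : P × M => (q.1, S q.2)) (p, x) :=
      contMDiffAt_fst.prodMk_space ((hT.contMDiffOn_symm.contMDiffAt
        (hT.isOpen_image.mem_nhds hx)).comp (p, x) contMDiffAt_snd)
    have hSx : S x ∈ U := by
      obtain ⟨w, hw, rfl⟩ := hx
      rwa [hT.left_inv w hw]
    have h2 : ContMDiffAt 𝓘(ℝ, P × W) 𝓘(ℝ, W) ∞ (fun q : P × W => g q.1 q.2) (p, S x) :=
      (hg.contDiffAt ((isOpen_univ.prod hT.isOpen_source).mem_nhds ⟨mem_univ _, hSx⟩)).contMDiffAt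
    have h3 : ContMDiffAt 𝓘(ℝ, W) (𝓡 n) ∞ T (g p (S x)) :=
      hT.contMDiffOn.contMDiffAt (hT.isOpen_source.mem_nhds (hmaps p hSx))
    refine (ContMDiffAt.comp (p, x) h3 (h2.comp (p, x) h1)).congr_of_eventuallyEq ?_
    filter_upwards [continuousAt_snd.preimage_mem_nhds (hT.isOpen_image.mem_nhds hx)] with q hq
    exact if_pos hq
  · have hx' : x ∉ T '' K := fun h => hx (image_mono hK h)
    refine contMDiffAt_snd.congr_of_eventuallyEq ?_
    filter_upwards [continuousAt_snd.preimage_mem_nhds (hKc.isOpen_compl.mem_nhds hx')] with q hq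
    exact transportFun_of_notMem_image hT (hid q.1) hq

/-- A smooth family of diffeomorphisms of the source of `T`, which are the identity outside `K`,
induces a smooth family of diffeomorphisms of `M`. -/
theorem exists_transport (hT : IsSmoothParam (n := n) T S U) (hK : K ⊆ U)
    (hKc : IsClosed (T '' K)) {g g' : P → W → W}
    (hg : ContDiffOn ℝ ∞ (fun q : P × W => g q.1 q.2) (univ ×ˢ U))
    (hg' : ∀ p, ContDiffOn ℝ ∞ (g' p) U)
    (hmaps : ∀ p, MapsTo (g p) U U) (hmaps' : ∀ p, MapsTo (g' p) U U)
    (hid : ∀ p, ∀ w ∈ U, w ∉ K → g p w = w)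
    (hl : ∀ p, ∀ w ∈ U, g' p (g p w) = w) (hr : ∀ p, ∀ w ∈ U, g p (g' p w) = w) :
    ∃ a : P → Diff (𝓡 n) M, SmoothFam a ∧ (∀ p, ∀ w ∈ U, a p (T w) = T (g p w)) ∧
      ∀ p, ∀ x ∉ T '' K, a p x = x := by
  have hid' : ∀ p, ∀ w ∈ U, w ∉ K → g' p w = w := fun p w hw hwK => by
    have := hl p w hw
    rwa [hid p w hw hwK] at this
  have hs := contMDiff_transportFun hT hK hKc hg hmaps hid
  have hs' : ∀ p, ContMDiff (𝓡 n) (𝓡 n) ∞ (transportFun T S U (g' p)) := fun p => by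
    have h1 : ContDiffOn ℝ ∞ (fun q : P × W => g' p q.2) (univ ×ˢ U) :=
      (hg' p).comp contDiffOn_snd fun q hq => hq.2
    have h2 := contMDiff_transportFun (P := P) hT hK hKc (g := fun _ => g' p) h1
      (fun _ => hmaps' p) (fun _ => hid' p)
    exact h2.comp (contMDiff_const (c := p).prodMk contMDiff_id)
  have hcomp : ∀ f f' : W → W, MapsTo f U U → (∀ w ∈ U, f' (f w) = w) →
      ∀ x, transportFun T S U f' (transportFun T S U f x) = x := by
    intro f f' hm hf x
    by_cases hx : x ∈ T '' U
    · obtain ⟨w, hw, rfl⟩ := hx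
      rw [transportFun_apply hT hw, transportFun_apply hT (hm hw), hf w hw]
    · rw [transportFun_of_notMem hx, transportFun_of_notMem hx]
  refine ⟨fun p =>
    { toFun := transportFun T S U (g p)
      invFun := transportFun T S U (g' p)
      left_inv := hcomp _ _ (hmaps p) (hl p)
      right_inv := hcomp _ _ (hmaps' p) (hr p)
      contMDiff_toFun := hs.comp (contMDiff_const (c := p).prodMk contMDiff_id)
      contMDiff_invFun := hs' p }, hs, fun p w hw => transportFun_apply hT hw,
    fun p x hx => transportFun_of_notMem_image hT (hid p) hx⟩

end Transport

/-! ### Small perturbations of the identity -/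

section Perturbation

variable {E : Type*} [NormedAddCommGroup E] [NormedSpace ℝ E] [FiniteDimensional ℝ E]

/-- A smooth perturbation of the identity with derivative at most `1/2` is a diffeomorphism. -/
theorem exists_inverse_id_add {u : E → E} (hu : ContDiff ℝ ∞ u)
    (hle : ∀ y, ‖fderiv ℝ u y‖ ≤ 1 / 2) :
    ∃ g' : E → E, ContDiff ℝ ∞ g' ∧ (∀ y, g' (y + u y) = y) ∧ ∀ y, g' y + u (g' y) = y := by
  have hlip : LipschitzWith (1 / 2) u := by
    refine lipschitzWith_of_nnnorm_fderiv_le (hu.differentiable (by simp)) fun y => ?_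
    rw [← NNReal.coe_le_coe]
    simpa using hle y
  -- A map differing from the identity by a 1/2-Lipschitz map is a homeomorphism. Its derivative `id
  -- + Du` is injective, hence invertible in finite dimension, so the inverse is smooth.
  have happ : ApproximatesLinearOn (fun y => y + u y) ((ContinuousLinearEquiv.refl ℝ E) : E →L[ℝ] E)
      univ (1 / 2) := by
    rw [ApproximatesLinearOn.approximatesLinearOn_iff_lipschitzOnWith, lipschitzOnWith_univ]
    convert! hlip using 1
    ext y
    simp
  have hc : Subsingleton E ∨ (1 / 2 : NNReal) <
      ‖((ContinuousLinearEquiv.refl ℝ E).symm : E →L[ℝ] E)‖₊⁻¹ := by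
    rcases subsingleton_or_nontrivial E with h | h
    · exact Or.inl h
    · right
      have : ((ContinuousLinearEquiv.refl ℝ E).symm : E →L[ℝ] E) = ContinuousLinearMap.id ℝ E := rfl
      rw [this, ContinuousLinearMap.nnnorm_id]
      norm_num
  let g : E ≃ₜ E := happ.toHomeomorph _ hc
  have hgc : ContDiff ℝ ∞ g := contDiff_id.add hu
  have hinj : ∀ y, Function.Injective (ContinuousLinearMap.id ℝ E + fderiv ℝ u y) := by
    intro y
    rw [injective_iff_map_eq_zero]
    intro v hv
    have h1 : v = -(fderiv ℝ u y v) := eq_neg_of_add_eq_zero_left (by simpa using hv)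
    have h2 : ‖v‖ ≤ 1 / 2 * ‖v‖ := by
      calc ‖v‖ = ‖fderiv ℝ u y v‖ := by rw [← norm_neg (fderiv ℝ u y v), ← h1]
        _ ≤ ‖fderiv ℝ u y‖ * ‖v‖ := ContinuousLinearMap.le_opNorm _ _
        _ ≤ 1 / 2 * ‖v‖ := by gcongr; exact hle y
    have : ‖v‖ = 0 := le_antisymm (by linarith) (norm_nonneg v)
    exact norm_eq_zero.1 this
  let L : ∀ y, E ≃L[ℝ] E := fun y =>
    (LinearEquiv.ofInjectiveEndo (ContinuousLinearMap.id ℝ E + fderiv ℝ u y).toLinearMap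
      (hinj y)).toContinuousLinearEquiv
  have hL : ∀ y, HasFDerivAt g (L y : E →L[ℝ] E) y := by
    intro y
    have h1 : HasFDerivAt (fun y => y + u y) (ContinuousLinearMap.id ℝ E + fderiv ℝ u y) y :=
      (hasFDerivAt_id y).add (hu.differentiable (by simp) y).hasFDerivAt
    exact h1
  exact ⟨g.symm, g.contDiff_symm hL hgc, g.symm_apply_apply, g.apply_symm_apply⟩

variable {n : ℕ} {M : Type u} [TopologicalSpace M] [T2Space M]
  [ChartedSpace (EuclideanSpace ℝ (Fin n)) M] [IsManifold (𝓡 n) ∞ M]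
  {P : Type*} [NormedAddCommGroup P] [NormedSpace ℝ P]

/-- A smooth family of small perturbations of the identity, supported in a compact subset of the
target of a chart, induces a smooth family of diffeomorphisms. -/
theorem exists_chart_perturbation (x₀ : M) {K : Set (EuclideanSpace ℝ (Fin n))} (hK : IsCompact K)
    (hKt : K ⊆ (extChartAt (𝓡 n) x₀).target)
    {u : P → EuclideanSpace ℝ (Fin n) → EuclideanSpace ℝ (Fin n)}
    (hu : ContDiff ℝ ∞ (fun q : P × EuclideanSpace ℝ (Fin n) => u q.1 q.2))
    (hsupp : ∀ p, ∀ y ∉ K, u p y = 0) (hle : ∀ p y, ‖fderiv ℝ (u p) y‖ ≤ 1 / 2) :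
    ∃ a : P → Diff (𝓡 n) M, SmoothFam a ∧
      (∀ p, ∀ y ∈ (extChartAt (𝓡 n) x₀).target, a p ((extChartAt (𝓡 n) x₀).symm y) =
        (extChartAt (𝓡 n) x₀).symm (y + u p y)) ∧
      ∀ p, ∀ x ∉ (extChartAt (𝓡 n) x₀).symm '' K, a p x = x := by
  set e := extChartAt (𝓡 n) x₀
  have hup : ∀ p, ContDiff ℝ ∞ (u p) := fun p => hu.comp (contDiff_const.prodMk contDiff_id)
  choose g' hg' hl hr using fun p => exists_inverse_id_add (hup p) (hle p)
  refine exists_transport (isSmoothParam_extChartAt_symm x₀) hKt ?_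
    (g := fun p y => y + u p y) (g' := g') ?_ (fun p => (hg' p).contDiffOn) ?_ ?_ ?_ ?_ ?_
  · exact (hK.image_of_continuousOn
      ((continuousOn_extChartAt_symm x₀).mono hKt)).isClosed
  · exact (contDiff_snd.add hu).contDiffOn
  · intro p y hy
    -- If `y + u y` left the chart target, `u` would vanish there, so it would be a fixed point of
    -- `id + u`. Injectivity then gives `y = y + u y`, which does lie in the target.
    by_contra h
    have h1 : (y + u p y) + u p (y + u p y) = y + u p y := by
      rw [hsupp p _ fun hK => h (hKt hK), add_zero]
    have h2 := hl p (y + u p y)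
    rw [h1, hl] at h2
    exact h (Eq.subst (motive := fun z => z ∈ e.target) h2 hy)
  · intro p y hy
    by_contra h
    have h1 := hr p y
    rw [hsupp p _ fun hK => h (hKt hK), add_zero] at h1
    exact h (Eq.subst (motive := fun z => z ∈ e.target) h1.symm hy)
  · intro p y _ hy
    simp [hsupp p y hy]
  · exact fun p y _ => hl p y
  · exact fun p y _ => hr p y

end Perturbation

/-! ### Hadamard's lemma -/

section Hadamard

open MeasureTheory Convolution

variable {P : Type*} [NormedAddCommGroup P] [NormedSpace ℝ P]
  {F : Type*} [NormedAddCommGroup F] [NormedSpace ℝ F] [CompleteSpace F]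

/-- Smooth dependence of an integral on parameters. -/
theorem contDiff_integral_Icc {k : P × ℝ → F} (hk : ContDiff ℝ ∞ k) :
    ContDiff ℝ ∞ (fun p => ∫ σ in Icc (0 : ℝ) 1, k (p, σ)) := by
  -- The integral is the convolution at `0` of the indicator `f` of `[0, 1]` with `x ↦ k (p, -x)`.
  -- The bump makes the second factor compactly supported and is `1` on `[-1, 0]`, the only values
  -- that count.
  let b : ContDiffBump (0 : ℝ) := ⟨1, 2, by norm_num, by norm_num⟩
  let f : ℝ → ℝ := (Icc (0 : ℝ) 1).indicator 1
  have hf : LocallyIntegrable f volume :=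
    ((integrable_indicator_iff measurableSet_Icc).2
      (integrableOn_const (by simp))).locallyIntegrable
  have h := contDiffOn_convolution_right_with_param_comp (n := ⊤) (μ := volume) (s := univ)
    (f := f) (v := fun _ : P => (0 : ℝ)) (g := fun p x => b x • k (p, -x))
    (k := Metric.closedBall 0 2) (ContinuousLinearMap.lsmul ℝ ℝ) contDiffOn_const
    isOpen_univ (isCompact_closedBall _ _) ?_ hf ?_
  · rw [contDiffOn_univ] at h
    convert h using 2 with p
    rw [convolution_def, ← integral_indicator measurableSet_Icc]
    congr 1
    ext t
    by_cases ht : t ∈ Icc (0 : ℝ) 1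
    · have : b (-t) = 1 := b.one_of_mem_closedBall (by
        simp only [Metric.mem_closedBall, dist_zero_right, norm_neg, Real.norm_eq_abs, b]
        rw [abs_of_nonneg ht.1]; exact ht.2)
      simp [f, ht, this]
    · simp [f, ht]
  · intro p x _ hx
    have : b x = 0 := b.zero_of_le_dist (by
      simp only [Metric.mem_closedBall, not_le] at hx
      exact hx.le)
    simp [this]
  · exact (((b.contDiff.comp contDiff_snd).smul
      (hk.comp (contDiff_fst.prodMk contDiff_snd.neg)))).contDiffOn

/-- Hadamard's lemma: a smooth map vanishing at time `0` is divisible by the time. -/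
theorem exists_eq_smul_of_zero {f : ℝ × P → F} (hf : ContDiff ℝ ∞ f) (h0 : ∀ y, f (0, y) = 0) :
    ∃ w : ℝ × P → F, ContDiff ℝ ∞ w ∧ ∀ t y, f (t, y) = t • w (t, y) := by
  let D : ℝ × P → F := fun q => fderiv ℝ f q (1, 0)
  have hD : ContDiff ℝ ∞ D := (hf.fderiv_right (m := ∞) (by simp)).clm_apply contDiff_const
  refine ⟨fun q => ∫ σ in Icc (0 : ℝ) 1, D (σ * q.1, q.2), contDiff_integral_Icc
    (k := fun z : (ℝ × P) × ℝ => D (z.2 * z.1.1, z.1.2)) (hD.comp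
      ((contDiff_snd.mul (contDiff_fst.comp contDiff_fst)).prodMk
        (contDiff_snd.comp contDiff_fst))), fun t y => ?_⟩
  -- Integrating this derivative over `σ` from `0` to `1` gives `f (t, y) - f (0, y)`, and the
  -- factor `t` comes out of the integral.
  have hder : ∀ σ : ℝ, HasDerivAt (fun σ : ℝ => f (σ * t, y)) (t • D (σ * t, y)) σ := by
    intro σ
    have h1 := (hf.differentiable (by simp) (σ * t, y)).hasFDerivAt
    have h2 : HasDerivAt (fun σ : ℝ => (σ * t, y)) ((t, 0) : ℝ × P) σ := by
      simpa using ((hasDerivAt_id σ).mul_const t).prodMk (hasDerivAt_const σ y)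
    have h3 := h1.comp_hasDerivAt σ h2
    convert! h3 using 1
    simp only [D]
    rw [← map_smul]
    simp
  have hint : IntervalIntegrable (fun σ : ℝ => t • D (σ * t, y)) volume 0 1 := by
    apply Continuous.intervalIntegrable
    exact continuous_const.smul (hD.continuous.comp (by fun_prop))
  have := intervalIntegral.integral_eq_sub_of_hasDerivAt (fun σ _ => hder σ) hint
  simp only [one_mul, zero_mul, h0, sub_zero] at this
  rw [← this, intervalIntegral.integral_smul, intervalIntegral.integral_of_le zero_le_one,
    ← integral_Icc_eq_integral_Ioc]

end Hadamard

/-! ### Locally finite infinite products of diffeomorphisms -/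

section InfiniteProduct

variable {n : ℕ} {M : Type u} [TopologicalSpace M] [ChartedSpace (EuclideanSpace ℝ (Fin n)) M]
  {P : Type*} [NormedAddCommGroup P] [NormedSpace ℝ P]

/-- The product `a₀ a₁ ⋯ a_{N-1}`. -/
def partialProd {G : Type*} [Monoid G] (a : ℕ → G) (N : ℕ) : G := ((List.range N).map a).prod

@[simp] lemma partialProd_zero {G : Type*} [Monoid G] (a : ℕ → G) : partialProd a 0 = 1 := rfl

lemma partialProd_succ {G : Type*} [Monoid G] (a : ℕ → G) (N : ℕ) :
    partialProd a (N + 1) = partialProd a N * a N := List.prod_range_succ a N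

/-- The last factor acts first, so factors from `J` on which fix `x` never move the point and can be
dropped one at a time. -/
lemma partialProd_apply_eq {a : ℕ → Diff (𝓡 n) M} {x : M} {J m : ℕ} (hm : J ≤ m)
    (h : ∀ i ≥ J, a i x = x) : partialProd a m x = partialProd a J x := by
  induction m, hm using Nat.le_induction with
  | base => rfl
  | succ m hm ih => rw [partialProd_succ, diff_mul_apply, h m hm, ih]

lemma smoothFam_partialProd {a : ℕ → P → Diff (𝓡 n) M} (ha : ∀ i, SmoothFam (a i)) (N : ℕ) :
    SmoothFam (fun p => partialProd (fun i => a i p) N) := by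
  induction N with
  | zero => exact SmoothFam.one
  | succ N ih => simpa only [partialProd_succ] using ih.mul (ha N)

/-- The infinite product of a sequence of smooth families, for each parameter only finitely many
factors of which are nontrivial, and which are locally finite near each point. -/
theorem exists_infinite_product {a : ℕ → P → Diff (𝓡 n) M} (ha : ∀ i, SmoothFam (a i))
    (hloc : ∀ p x, ∃ J, ∀ᶠ q : P × M in 𝓝 (p, x), ∀ i ≥ J, a i q.1 q.2 = q.2)
    (hfin : ∀ p, ∃ N, ∀ i ≥ N, a i p = 1) :
    ∃ A : P → Diff (𝓡 n) M, SmoothFam A ∧ ∀ p J x, (∀ i ≥ J, a i p x = x) →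
      A p x = partialProd (fun i => a i p) J x := by
  -- Finiteness for each parameter makes the product an element of the group, with an inverse. The
  -- bound `N p` need not be locally constant: near a point `hloc` lets the product be replaced by
  -- one of fixed length, which yields smoothness.
  choose N hN using hfin
  have key : ∀ p J x, (∀ i ≥ J, a i p x = x) →
      partialProd (fun i => a i p) (N p) x = partialProd (fun i => a i p) J x := by
    intro p J x h
    rw [← partialProd_apply_eq (le_max_left J (N p)) h, ← partialProd_apply_eq
      (le_max_right J (N p)) fun i hi => by rw [hN p i hi, diff_one_apply]]
  refine ⟨fun p => partialProd (fun i => a i p) (N p), ?_, key⟩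
  rintro ⟨p, x⟩
  obtain ⟨J, hJ⟩ := hloc p x
  refine ((smoothFam_partialProd ha J) (p, x)).congr_of_eventuallyEq ?_
  filter_upwards [hJ] with q hq
  exact key _ _ _ hq

end InfiniteProduct

/-! ### Time cutoffs and derivatives along the diagonal -/

section TimeCutoff

/-- A smooth truncation of the identity of `ℝ`. -/
lemma exists_time_cutoff {ε : ℝ} (hε : 0 < ε) : ∃ τ : ℝ → ℝ, ContDiff ℝ ∞ τ ∧ τ 0 = 0 ∧
    (∀ᶠ t in 𝓝 0, τ t = t) ∧ (∀ t, |τ t| < ε) ∧ ∀ t, ε ≤ |t| → τ t = 0 := by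
  let b : ContDiffBump (0 : ℝ) := ⟨ε / 2, ε, by positivity, by linarith⟩
  have hz : ∀ t, ε ≤ |t| → b t = 0 := fun t ht => b.zero_of_le_dist (by simpa [b] using ht)
  refine ⟨fun t => b t * t, b.contDiff.mul contDiff_id, by simp, ?_, fun t => ?_, fun t ht => ?_⟩
  · filter_upwards [b.eventuallyEq_one] with t ht
    simp [ht]
  · rcases lt_or_ge |t| ε with h | h
    · rw [abs_mul, abs_of_nonneg b.nonneg]
      calc b t * |t| ≤ 1 * |t| := by gcongr; exact b.le_one
        _ < ε := by simpa using h
    · simp [hz t h, hε]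
  · simp [hz t ht]

lemma hasDerivAt_of_eventuallyEq_id {τ : ℝ → ℝ} (h : ∀ᶠ t in 𝓝 0, τ t = t) :
    HasDerivAt τ 1 0 :=
  (hasDerivAt_id (0 : ℝ)).congr_of_eventuallyEq h

/-- A smooth function of two variables which is constant on the axes has vanishing derivative
along the diagonal. -/
lemma deriv_diag_eq_zero {G : ℝ × ℝ → ℝ} (hG : ContDiff ℝ ∞ G) (h1 : ∀ s, G (s, 0) = G (0, 0))
    (h2 : ∀ t, G (0, t) = G (0, 0)) : deriv (fun t => G (t, t)) 0 = 0 := by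
  have hL := (hG.differentiable (by simp) (0, 0)).hasFDerivAt
  set L := fderiv ℝ G (0, 0)
  have h3 : HasDerivAt (fun t : ℝ => G (t, t)) (L (1, 1)) 0 :=
    hL.comp_hasDerivAt (f := fun t : ℝ => (t, t)) 0 ((hasDerivAt_id 0).prodMk (hasDerivAt_id 0))
  have h4 : HasDerivAt (fun t : ℝ => G (t, 0)) (L (1, 0)) 0 :=
    hL.comp_hasDerivAt (f := fun t : ℝ => (t, (0 : ℝ))) 0
      ((hasDerivAt_id 0).prodMk (hasDerivAt_const 0 0))
  have h5 : HasDerivAt (fun t : ℝ => G (0, t)) (L (0, 1)) 0 :=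
    hL.comp_hasDerivAt (f := fun t : ℝ => ((0 : ℝ), t)) 0
      ((hasDerivAt_const 0 0).prodMk (hasDerivAt_id 0))
  have e4 : L (1, 0) = 0 := by
    rw [← h4.deriv, funext h1, deriv_const]
  have e5 : L (0, 1) = 0 := by
    rw [← h5.deriv, funext h2, deriv_const]
  rw [h3.deriv, show ((1 : ℝ), (1 : ℝ)) = (1, 0) + (0, 1) by simp, map_add, e4, e5, add_zero]

end TimeCutoff

/-! ### Smooth functions on the group see only velocity fields -/

section ZeroVelocity

variable {n : ℕ} {M : Type u} [TopologicalSpace M] [T2Space M]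
  [ChartedSpace (EuclideanSpace ℝ (Fin n)) M] [IsManifold (𝓡 n) ∞ M]

/-- A map which is smooth near `x` agrees near `x` with a global smooth map. -/
lemma exists_contMDiff_eventuallyEq {F : Type*} [NormedAddCommGroup F] [NormedSpace ℝ F]
    {g : M → F} {x : M} (hg : ∀ᶠ y in 𝓝 x, ContMDiffAt (𝓡 n) 𝓘(ℝ, F) ∞ g y) :
    ∃ h : M → F, ContMDiff (𝓡 n) 𝓘(ℝ, F) ∞ h ∧ h =ᶠ[𝓝 x] g := by
  obtain ⟨f, -, hf⟩ := (SmoothBumpFunction.nhds_basis_tsupport (I := 𝓡 n) x).mem_iff.1 hg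
  refine ⟨fun y => f y • g y, ?_, ?_⟩
  · refine contMDiff_of_tsupport fun y hy => ?_
    exact f.contMDiff.contMDiffAt.smul (hf (tsupport_smul_subset_left _ _ hy))
  · filter_upwards [f.eventuallyEq_one] with y hy
    simp [hy]

/-- If all smooth functions have vanishing derivative along `γ`, so have smooth maps defined near
`γ(0)`. -/
lemma deriv_comp_eq_zero {F : Type*} [NormedAddCommGroup F] [NormedSpace ℝ F]
    {γ : ℝ → M} (hγ : ContMDiffAt 𝓘(ℝ, ℝ) (𝓡 n) ∞ γ 0)
    (h0 : ∀ h : M → ℝ, ContMDiff (𝓡 n) 𝓘(ℝ, ℝ) ∞ h → deriv (fun t => h (γ t)) 0 = 0)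
    {g : M → F} (hg : ∀ᶠ y in 𝓝 (γ 0), ContMDiffAt (𝓡 n) 𝓘(ℝ, F) ∞ g y) :
    HasDerivAt (fun t => g (γ t)) 0 0 := by
  obtain ⟨h, hh, heq⟩ := exists_contMDiff_eventuallyEq hg
  have hd : DifferentiableAt ℝ (fun t => h (γ t)) 0 :=
    (contMDiffAt_iff_contDiffAt.1 ((hh (γ 0)).comp 0 hγ)).differentiableAt (by simp)
  have hz : deriv (fun t => h (γ t)) 0 = 0 := by
    refine SeparatingDual.eq_zero_of_forall_dual_eq_zero (R := ℝ) fun L => ?_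
    have h1 := h0 (fun y => L (h y)) (L.contMDiff.comp hh)
    exact (L.hasFDerivAt.comp_hasDerivAt 0 hd.hasDerivAt).deriv.symm.trans h1
  have h2 := hd.hasDerivAt
  rw [hz] at h2
  refine h2.congr_of_eventuallyEq ?_
  filter_upwards [hγ.continuousAt.eventually heq] with t ht
  exact ht.symm

/-- The curve has zero velocity at time `0`. -/
def ZeroVel (c : ℝ → Diff (𝓡 n) M) : Prop :=
  ∀ h : M → ℝ, ContMDiff (𝓡 n) 𝓘(ℝ, ℝ) ∞ h → ∀ x, deriv (fun t => h (c t x)) 0 = 0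

/-- The curve is the identity near `x` for small times. -/
def TrivialGerm (c : ℝ → Diff (𝓡 n) M) (x : M) : Prop :=
  ∀ᶠ q : ℝ × M in 𝓝 (0, x), c q.1 q.2 = q.2

/-- Locally, a curve of vanishing velocity agrees for small times with a curve along which all
smooth functions on `Diff(M)` have vanishing derivative. -/
lemma exists_local_factor (x₀ : M) : ∃ S ∈ 𝓝 x₀, ∀ c : ℝ → Diff (𝓡 n) M, SmoothFam c → c 0 = 1 →
    ZeroVel c → ∃ a : ℝ → Diff (𝓡 n) M, SmoothFam a ∧ a 0 = 1 ∧
      (∀ f : SmoothMap (Diff (𝓡 n) M) ℝ, deriv (fun t => f (a t)) 0 = 0) ∧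
      (∀ᶠ t in 𝓝 (0 : ℝ), ∀ x ∈ S, a t x = c t x) ∧ ∀ x, TrivialGerm c x → TrivialGerm a x := by
  set e := extChartAt (𝓡 n) x₀
  set y₀ := e x₀
  obtain ⟨R, hR, hRt⟩ := Metric.nhds_basis_closedBall.mem_iff.1
    (extChartAt_target_mem_nhds (I := 𝓡 n) x₀)
  set K := Metric.closedBall y₀ R
  have hKc : IsCompact K := isCompact_closedBall _ _
  let b : ContDiffBump y₀ := ⟨R / 2, R, by positivity, by linarith⟩
  have hbK : ∀ y ∉ K, b y = 0 := fun y hy => b.zero_of_le_dist (by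
    simp only [K, Metric.mem_closedBall, not_le] at hy; exact hy.le)
  have htop : IsOpen e.target := isOpen_extChartAt_target x₀
  have hsop : IsOpen e.source := isOpen_extChartAt_source x₀
  have hes : ContMDiffOn 𝓘(ℝ, EuclideanSpace ℝ (Fin n)) (𝓡 n) ∞ e.symm e.target :=
    contMDiffOn_extChartAt_symm x₀
  have hes' : ContMDiffOn (𝓡 n) 𝓘(ℝ, EuclideanSpace ℝ (Fin n)) ∞ e e.source := by
    have := contMDiffOn_extChartAt (I := 𝓡 n) (n := ∞) (x := x₀)
    rwa [← extChartAt_source (I := 𝓡 n)] at this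
  refine ⟨e.source ∩ e ⁻¹' Metric.ball y₀ (R / 2), Filter.inter_mem
    (extChartAt_source_mem_nhds x₀) ((continuousAt_extChartAt x₀).preimage_mem_nhds
      (Metric.ball_mem_nhds _ (by positivity))), fun c hc hc0 hv => ?_⟩
  -- the domain on which the chart representation of `c` is defined
  set O : Set (ℝ × EuclideanSpace ℝ (Fin n)) := {q | q.2 ∈ e.target ∧ c q.1 (e.symm q.2) ∈ e.source}
  have hφ : ContMDiffOn 𝓘(ℝ, ℝ × EuclideanSpace ℝ (Fin n)) (𝓡 n) ∞ (fun q : ℝ × EuclideanSpace ℝ (Fin n) => c q.1 (e.symm q.2))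
      {q | q.2 ∈ e.target} := by
    intro q hq
    have h1 : ContMDiffAt 𝓘(ℝ, ℝ × EuclideanSpace ℝ (Fin n)) (𝓡 n) ∞ (fun q : ℝ × EuclideanSpace ℝ (Fin n) => e.symm q.2) q :=
      (hes.contMDiffAt (htop.mem_nhds hq)).comp q contDiff_snd.contMDiff.contMDiffAt
    exact ((hc (q.1, e.symm q.2)).comp q
      (contDiff_fst.contMDiff.contMDiffAt.prodMk h1)).contMDiffWithinAt
  have hOop : IsOpen O :=
    hφ.continuousOn.isOpen_inter_preimage (htop.preimage continuous_snd) hsop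
  have hOK : ({0} : Set ℝ) ×ˢ K ⊆ O := by
    rintro ⟨t, y⟩ ⟨ht, hy⟩
    obtain rfl : t = 0 := ht
    refine ⟨hRt hy, ?_⟩
    simp only [hc0, diff_one_apply]
    exact e.map_target (hRt hy)
  obtain ⟨u', v', hu', -, h0u', hKv', huv⟩ :=
    generalized_tube_lemma isCompact_singleton hKc hOop hOK
  obtain ⟨ε, hε, hεu⟩ := Metric.isOpen_iff.1 hu' 0 (h0u' rfl)
  have hεO : ∀ t, |t| < ε → ∀ y ∈ K, (t, y) ∈ O := fun t ht y hy =>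
    huv ⟨hεu (by simpa using ht), hKv' hy⟩
  obtain ⟨τ, hτ, hτ0, hτid, hτlt, -⟩ := exists_time_cutoff hε
  -- The displacement of `c` in the chart, localized by `b`. Truncating time by `τ` keeps `c` inside
  -- the chart over `K`, so `u` is globally smooth.
  let u : ℝ × EuclideanSpace ℝ (Fin n) → EuclideanSpace ℝ (Fin n) := fun q => b q.2 • (e (c (τ q.1) (e.symm q.2)) - q.2)
  have hu : ContDiff ℝ ∞ u := by
    rw [contDiff_iff_contDiffAt]
    rintro ⟨t, y⟩
    by_cases hy : y ∈ K
    · have hO := hεO (τ t) (hτlt t) y hy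
      have h1 : ContMDiffAt 𝓘(ℝ, ℝ × EuclideanSpace ℝ (Fin n)) 𝓘(ℝ, EuclideanSpace ℝ (Fin n)) ∞
          (fun q : ℝ × EuclideanSpace ℝ (Fin n) => e (c q.1 (e.symm q.2))) (τ t, y) :=
        ContMDiffAt.comp (τ t, y) (g := e) (hes'.contMDiffAt (hsop.mem_nhds hO.2))
          (hφ.contMDiffAt ((htop.preimage continuous_snd).mem_nhds hO.1))
      have h2 : ContDiffAt ℝ ∞ (fun q : ℝ × EuclideanSpace ℝ (Fin n) => e (c (τ q.1) (e.symm q.2))) (t, y) :=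
        (contMDiffAt_iff_contDiffAt.1 h1).comp (t, y)
          (f := fun q : ℝ × EuclideanSpace ℝ (Fin n) => (τ q.1, q.2)) ((hτ.comp contDiff_fst).prodMk contDiff_snd).contDiffAt
      exact (b.contDiff.comp contDiff_snd).contDiffAt.smul (h2.sub contDiffAt_snd)
    · refine (contDiffAt_const (c := (0 : EuclideanSpace ℝ (Fin n)))).congr_of_eventuallyEq ?_
      filter_upwards [continuousAt_snd.preimage_mem_nhds
        (Metric.isClosed_closedBall.isOpen_compl.mem_nhds hy)] with q hq
      simp [u, hbK q.2 hq]
  have hu0 : ∀ y, u (0, y) = 0 := by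
    intro y
    by_cases hy : y ∈ K
    · simp [u, hτ0, hc0, e.right_inv (hRt hy)]
    · simp [u, hbK y hy]
  obtain ⟨w, hw, huw⟩ := exists_eq_smul_of_zero hu hu0
  -- `w (0, y)` is the time derivative of `u` at `0`, which vanishes by the hypothesis on the
  -- velocity.
  have hw0 : ∀ y, w (0, y) = 0 := by
    intro y
    have h1 : HasDerivAt (fun t : ℝ => u (t, y)) (w (0, y)) 0 := by
      have h2 : HasDerivAt (fun t : ℝ => w (t, y)) (fderiv ℝ w (0, y) (1, 0)) 0 :=
        ((hw.differentiable (by simp) (0, y)).hasFDerivAt).comp_hasDerivAt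
          (f := fun t : ℝ => (t, y)) 0 ((hasDerivAt_id 0).prodMk (hasDerivAt_const 0 y))
      have h3 := (hasDerivAt_id (0 : ℝ)).smul h2
      simp only [id, one_smul, zero_smul, zero_add] at h3
      refine h3.congr_of_eventuallyEq (Filter.Eventually.of_forall fun t => huw t y)
    by_cases hy : y ∈ K
    · have h2 : HasDerivAt (fun t => e (c t (e.symm y))) 0 0 := by
        have hcy : ContMDiff 𝓘(ℝ, ℝ) (𝓡 n) ∞ (fun t => c t (e.symm y)) :=
          hc.apply contMDiff_id contMDiff_const
        refine deriv_comp_eq_zero hcy.contMDiffAt (fun h hh => hv h hh _) ?_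
        have hmem : c 0 (e.symm y) ∈ e.source := by
          rw [hc0]; exact e.map_target (hRt hy)
        filter_upwards [hsop.mem_nhds hmem] with z hz
        exact hes'.contMDiffAt (hsop.mem_nhds hz)
      have h3 : HasDerivAt (fun t => u (t, y)) (b y • (0 : EuclideanSpace ℝ (Fin n))) 0 := by
        refine HasDerivAt.const_smul (b y) (f := fun t => e (c (τ t) (e.symm y)) - y) ?_
        have h4 : HasDerivAt (fun t => e (c t (e.symm y)) - y) 0 0 := by
          simpa using h2.sub_const y
        refine h4.congr_of_eventuallyEq ?_
        filter_upwards [hτid] with t ht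
        rw [ht]
      rw [h1.unique h3, smul_zero]
    · have h3 : HasDerivAt (fun t => u (t, y)) (0 : EuclideanSpace ℝ (Fin n)) 0 := by
        have : (fun t => u (t, y)) = fun _ => 0 := funext fun t => by simp [u, hbK y hy]
        rw [this]
        exact hasDerivAt_const _ _
      exact h1.unique h3
  have hwK : ∀ t, ∀ y ∉ K, w (t, y) = 0 := by
    intro t y hy
    rcases eq_or_ne t 0 with rfl | ht
    · exact hw0 y
    · have h1 := huw t y
      simp only [u, hbK y hy, zero_smul] at h1
      exact (smul_eq_zero.1 h1.symm).resolve_left ht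
  let D : ℝ × EuclideanSpace ℝ (Fin n) → EuclideanSpace ℝ (Fin n) →L[ℝ] EuclideanSpace ℝ (Fin n) := fun q => fderiv ℝ (fun y => w (q.1, y)) q.2
  have hD : Continuous D :=
    (ContDiff.fderiv (m := ∞) (n := ∞) (f := fun (q : ℝ × EuclideanSpace ℝ (Fin n)) y => w (q.1, y)) (g := Prod.snd)
      (hw.comp ((contDiff_fst.comp contDiff_fst).prodMk contDiff_snd)) contDiff_snd
      (by simp)).continuous
  obtain ⟨B, hB⟩ := ((isCompact_Icc (a := (-1 : ℝ)) (b := 1)).prod hKc).exists_bound_of_continuousOn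
    hD.continuousOn
  have hB' : ∀ q ∈ Icc (-1 : ℝ) 1 ×ˢ K, ‖D q‖ ≤ |B| := fun q hq => (hB q hq).trans (le_abs_self B)
  -- The bound `1` keeps the time argument of `w` in the compact set on which `B` was found. The
  -- other bound makes the perturbation `κ(s) w(κ(t), ·)` have derivative at most `1/2`.
  set δ := min 1 (1 / (2 * (|B| + 1)))
  have hδ : 0 < δ := by positivity
  obtain ⟨κ, hκ, hκ0, hκid, hκlt, -⟩ := exists_time_cutoff hδ
  -- The factor `t` of `u = t w` is made an independent parameter `s`. The family is the identity
  -- for `s = 0`, and also for `t = 0` because `w (0, ·) = 0`. On the diagonal, for small times, it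
  -- is `id + u`, that is, `c` wherever `b = 1`.
  obtain ⟨A, hA, hAe, hAK⟩ := exists_chart_perturbation (P := ℝ × ℝ) x₀ hKc hRt
    (u := fun p y => κ p.1 • w (κ p.2, y))
    (((hκ.comp (contDiff_fst.comp contDiff_fst))).smul
      (hw.comp ((hκ.comp (contDiff_snd.comp contDiff_fst)).prodMk contDiff_snd)))
    (fun p y hy => by simp [hwK _ y hy])
    (by
      intro p y
      by_cases hy : y ∈ K
      · have h1 : fderiv ℝ (fun y => κ p.1 • w (κ p.2, y)) y = κ p.1 • D (κ p.2, y) :=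
          fderiv_fun_const_smul ((hw.comp (contDiff_const.prodMk contDiff_id)).differentiable
            (by simp) y) _
        rw [h1, norm_smul, Real.norm_eq_abs]
        have h2 := (hκlt p.2).trans_le (min_le_left _ _)
        have h3 := (hκlt p.1).trans_le (min_le_right _ _)
        calc |κ p.1| * ‖D (κ p.2, y)‖ ≤ 1 / (2 * (|B| + 1)) * |B| := by
              gcongr
              exact hB' _ ⟨⟨(abs_lt.1 h2).1.le, (abs_lt.1 h2).2.le⟩, hy⟩
          _ ≤ 1 / 2 := by
              have := abs_nonneg B
              rw [div_mul_eq_mul_div, div_le_div_iff₀ (by positivity) (by positivity)]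
              linarith
      · have : (fun y => κ p.1 • w (κ p.2, y)) =ᶠ[𝓝 y] fun _ => 0 := by
          filter_upwards [Metric.isClosed_closedBall.isOpen_compl.mem_nhds hy] with z hz
          rw [hwK _ z hz, smul_zero]
        rw [this.fderiv_eq]
        simp)
  have hA1 : ∀ p : ℝ × ℝ, (∀ y, κ p.1 • w (κ p.2, y) = 0) → A p = 1 := by
    intro p hp
    refine Diffeomorph.ext fun x => ?_
    by_cases hx : x ∈ e.source
    · have := hAe p (e x) (e.map_source hx)
      rw [hp, add_zero, e.left_inv hx] at this
      exact this
    · exact hAK p x fun ⟨y, hy, hyx⟩ => hx (hyx ▸ e.map_target (hRt hy))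
  have hAs : ∀ s, A (s, 0) = 1 := fun s => hA1 _ fun y => by simp [hκ0, hw0]
  have hAt : ∀ t, A (0, t) = 1 := fun t => hA1 _ fun y => by simp [hκ0]
  have ha : ∀ t, κ t = t → τ t = t → ∀ x ∈ e.source,
      A (t, t) x = e.symm (e x + b (e x) • (e (c t x) - e x)) := by
    intro t h1 h2 x hx
    have h3 := hAe (t, t) (e x) (e.map_source hx)
    rw [e.left_inv hx] at h3
    simp only [h1, ← huw] at h3
    rw [h3]
    simp only [u, h2, e.left_inv hx]
    rfl
  refine ⟨fun t => A (t, t), hA.comp (contDiff_id.prodMk contDiff_id), hAs 0, fun f => ?_, ?_,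
    fun x hx => ?_⟩
  · refine deriv_diag_eq_zero (hA.contDiff_comp f) (fun s => ?_) fun t => ?_
    · rw [hAs, hAs]
    · rw [hAt, hAs]
  · filter_upwards [hκid, hτid, Metric.ball_mem_nhds (0 : ℝ) hε] with t h1 h2 h3 x hx
    have hxb : b (e x) = 1 := b.one_of_mem_closedBall (Metric.ball_subset_closedBall hx.2)
    have hxK : e x ∈ K :=
      Metric.closedBall_subset_closedBall (by linarith) (Metric.ball_subset_closedBall hx.2)
    rw [ha t h1 h2 x hx.1, hxb, one_smul, add_sub_cancel]
    refine e.left_inv ?_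
    have := (hεO t (by simpa using h3) (e x) hxK).2
    rwa [e.left_inv hx.1] at this
  · by_cases hxs : x ∈ e.source
    · have h4 : ∀ᶠ q : ℝ × M in 𝓝 (0, x), κ q.1 = q.1 ∧ τ q.1 = q.1 :=
        (continuousAt_fst (p := ((0 : ℝ), x))).eventually (hκid.and hτid)
      filter_upwards [hx, h4, continuousAt_snd.preimage_mem_nhds (hsop.mem_nhds hxs)]
        with q h1 h2 h3
      rw [ha q.1 h2.1 h2.2 q.2 h3, h1, sub_self, smul_zero, add_zero, e.left_inv h3]
    · have hcl : IsClosed (e.symm '' K) := (hKc.image_of_continuousOn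
        ((continuousOn_extChartAt_symm x₀).mono hRt)).isClosed
      have hxK : x ∉ e.symm '' K := fun ⟨y, hy, hyx⟩ => hxs (hyx ▸ e.map_target (hRt hy))
      filter_upwards [continuousAt_snd.preimage_mem_nhds (hcl.isOpen_compl.mem_nhds hxK)]
        with q hq
      exact hAK _ _ hq

/-- A curve of vanishing velocity may be made trivial near a compact set, without changing the
derivatives of smooth functions along it. -/
lemma exists_trivialGerm_on_compact {K : Set M} (hK : IsCompact K) (c : ℝ → Diff (𝓡 n) M)
    (hc : SmoothFam c) (hc0 : c 0 = 1) (hv : ZeroVel c) :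
    ∃ r : ℝ → Diff (𝓡 n) M, SmoothFam r ∧ r 0 = 1 ∧
      (∀ f : SmoothMap (Diff (𝓡 n) M) ℝ, deriv (fun t => f (r t)) 0 = deriv (fun t => f (c t)) 0) ∧
      ∀ x ∈ K, TrivialGerm r x := by
  suffices h : ∀ c : ℝ → Diff (𝓡 n) M, SmoothFam c → c 0 = 1 → ZeroVel c →
      ∃ r : ℝ → Diff (𝓡 n) M, SmoothFam r ∧ r 0 = 1 ∧ (∀ f : SmoothMap (Diff (𝓡 n) M) ℝ,
        deriv (fun t => f (r t)) 0 = deriv (fun t => f (c t)) 0) ∧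
        (∀ x ∈ K, TrivialGerm r x) ∧ ∀ x, TrivialGerm c x → TrivialGerm r x by
    obtain ⟨r, h1, h2, h3, h4, -⟩ := h c hc hc0 hv
    exact ⟨r, h1, h2, h3, h4⟩
  have hzero : ∀ c r : ℝ → Diff (𝓡 n) M, (∀ f : SmoothMap (Diff (𝓡 n) M) ℝ,
      deriv (fun t => f (r t)) 0 = deriv (fun t => f (c t)) 0) → ZeroVel c → ZeroVel r :=
    fun c r h hc g hg x => (h (evalMap g hg x)).trans (hc g hg x)
  clear hv hc0 hc c
  refine IsCompact.induction_on hK ?_ ?_ ?_ ?_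
  · exact fun c hc hc0 hv => ⟨c, hc, hc0, fun _ => rfl, by simp, fun _ h => h⟩
  · intro S T hST hT c hc hc0 hv
    obtain ⟨r, h1, h2, h3, h4, h5⟩ := hT c hc hc0 hv
    exact ⟨r, h1, h2, h3, fun x hx => h4 x (hST hx), h5⟩
  · intro S T hS hT c hc hc0 hv
    obtain ⟨r, h1, h2, h3, h4, h5⟩ := hS c hc hc0 hv
    obtain ⟨r', h1', h2', h3', h4', h5'⟩ := hT r h1 h2 (hzero c r h3 hv)
    exact ⟨r', h1', h2', fun f => (h3' f).trans (h3 f),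
      fun x hx => hx.elim (fun h => h5' x (h4 x h)) (h4' x), fun x hx => h5' x (h5 x hx)⟩
  · intro x₀ _
    obtain ⟨S, hS, h⟩ := exists_local_factor (n := n) x₀
    refine ⟨interior S, mem_nhdsWithin_of_mem_nhds (interior_mem_nhds.2 hS),
      fun c hc hc0 hv => ?_⟩
    obtain ⟨a, ha, ha0, haf, hac, hat⟩ := h c hc hc0 hv
    -- Derivatives at the identity are additive on products and vanish along `a`, so `c = a (a⁻¹ c)`
    -- shows that dividing by `a` does not change them. On the neighbourhood where `a = c` the
    -- quotient is trivial, and germs which were already trivial remain so.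
    refine ⟨fun t => (a t)⁻¹ * c t, ha.inv.mul hc, by simp [ha0, hc0], fun f => ?_,
      fun x hx => ?_, fun x hx => ?_⟩
    · have h1 := deriv_curveMul f (ha.curve ha0) ((ha.inv.mul hc).curve (by simp [ha0, hc0]))
      have h2 := haf f
      simp only [SmoothFam.curve, mul_inv_cancel_left] at h1
      rw [h2, zero_add] at h1
      exact h1.symm
    · have h1 := (continuousAt_fst (p := ((0 : ℝ), x))).eventually hac
      filter_upwards [h1, continuousAt_snd.preimage_mem_nhds (isOpen_interior.mem_nhds hx)]
        with q hq hq2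
      rw [diff_mul_apply, ← hq q.2 (interior_subset hq2), diff_inv_apply_self]
    · filter_upwards [hx, hat x hx] with q h1 h2
      rw [diff_mul_apply, h1]
      nth_rewrite 1 [← h2]
      exact diff_inv_apply_self _ _

variable [SecondCountableTopology M]

/-- If all evaluations have vanishing derivative along a curve in `Diff(M)`, so have all smooth
functions on `Diff(M)`. -/
theorem deriv_eq_zero_of_zeroVel (c : ℝ → Diff (𝓡 n) M) (hc : SmoothFam c) (hc0 : c 0 = 1)
    (hv : ZeroVel c) (f : SmoothMap (Diff (𝓡 n) M) ℝ) : deriv (fun t => f (c t)) 0 = 0 := by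
  have hLC : LocallyCompactSpace M := ChartedSpace.locallyCompactSpace (EuclideanSpace ℝ (Fin n)) M
  set lam := deriv (fun t => f (c t)) 0
  let Kx : CompactExhaustion M := default
  choose r hr hr0 hrf hrK using fun i => exists_trivialGerm_on_compact (Kx.isCompact i) c hc hc0 hv
  have hε : ∀ i, ∃ ε > 0, ∀ t, |t| < ε → ∀ x ∈ Kx i, r i t x = x := by
    intro i
    have h1 := (Kx.isCompact i).eventually_forall_of_forall_eventually (x₀ := (0 : ℝ))
      (P := fun t x => r i t x = x) (hrK i)
    obtain ⟨ε, hε, h⟩ := Metric.eventually_nhds_iff.1 h1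
    exact ⟨ε, hε, fun t ht => h (by simpa using ht)⟩
  choose ε hε hεr using hε
  -- The intervals `|t - s i| < s i / 4` are disjoint. The factor `i` acts only on the interval of
  -- index `i`, so at each time at most one factor is nontrivial.
  let s : ℕ → ℝ := fun i => (1 / 2) ^ i
  have hs : ∀ i, 0 < s i := fun i => by positivity
  have hsucc : ∀ i, s (i + 1) = s i / 2 := fun i => by simp only [s, pow_succ]; ring
  have hanti : Antitone s := antitone_nat_of_succ_le fun i => by rw [hsucc]; linarith [hs i]
  have hδ : ∀ i, 0 < min (ε i) (s i / 4) := fun i => lt_min (hε i) (by linarith [hs i])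
  choose τ hτ hτ0 hτid hτlt hτz using fun i => exists_time_cutoff (hδ i)
  -- The factor `i` is run at speed `i + 1` through time `s i`. Its truncation below `ε i` keeps it
  -- trivial on `Kx i`, and this gives local finiteness in `M` even at `t = 0`, where the intervals
  -- accumulate.
  let θ : ℕ → ℝ → ℝ := fun i t => τ i ((i + 1) * (t - s i))
  have hθ : ∀ i, ContDiff ℝ ∞ (θ i) := fun i =>
    (hτ i).comp (contDiff_const.mul (contDiff_id.sub contDiff_const))
  have hθz : ∀ i t, s i / 4 ≤ |t - s i| → θ i t = 0 := by
    intro i t ht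
    refine hτz i _ ((min_le_right _ _).trans (ht.trans ?_))
    rw [abs_mul, abs_of_nonneg (by positivity : (0 : ℝ) ≤ i + 1)]
    have : (1 : ℝ) ≤ i + 1 := by simp
    nlinarith [abs_nonneg (t - s i)]
  have hone : ∀ i t, s i / 4 ≤ |t - s i| → r i (θ i t) = 1 := fun i t ht => by
    rw [hθz i t ht, hr0]
  obtain ⟨A, hA, hAp⟩ := exists_infinite_product (a := fun i t => r i (θ i t))
    (fun i => (hr i).comp (hθ i))
    (fun t x => by
      obtain ⟨J, hJ⟩ := Kx.exists_mem_nhds x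
      refine ⟨J, ?_⟩
      filter_upwards [continuousAt_snd.preimage_mem_nhds hJ] with q hq i hi
      exact hεr i _ ((hτlt i _).trans_le (min_le_left _ _)) _ (Kx.subset hi hq))
    (fun t => by
      rcases le_or_gt t 0 with ht | ht
      · refine ⟨0, fun i _ => hone i t ?_⟩
        rw [abs_sub_comm, abs_of_nonneg (by linarith [hs i])]
        linarith [hs i]
      · obtain ⟨N, hN⟩ := exists_pow_lt_of_lt_one (half_pos ht) (by norm_num : (1 / 2 : ℝ) < 1)
        refine ⟨N, fun i hi => hone i t ?_⟩
        have : s i ≤ s N := hanti hi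
        have h2 : s N < t / 2 := hN
        rw [abs_of_nonneg (by linarith)]
        linarith [hs i])
  have hAloc : ∀ i, ∀ᶠ t in 𝓝 (s i), A t = r i (θ i t) := by
    intro i
    filter_upwards [Metric.ball_mem_nhds (s i) (by linarith [hs i] : 0 < s i / 4)] with t ht
    rw [Metric.mem_ball, Real.dist_eq, abs_lt] at ht
    have hne : ∀ j, j ≠ i → r j (θ j t) = 1 := by
      intro j hj
      refine hone j t ?_
      rcases lt_or_gt_of_ne hj with h | h
      · have h1 : s i ≤ s (j + 1) := hanti h
        rw [hsucc] at h1
        rw [abs_sub_comm, abs_of_nonneg (by linarith)]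
        linarith [hs j]
      · have h1 : s j ≤ s (i + 1) := hanti h
        rw [hsucc] at h1
        rw [abs_of_nonneg (by linarith [hs i])]
        linarith [hs j]
    refine Diffeomorph.ext fun x => ?_
    rw [hAp t (i + 1) x fun j hj => by rw [hne j (by omega), diff_one_apply], partialProd_succ]
    have : partialProd (fun j => r j (θ j t)) i = 1 := by
      refine List.prod_eq_one fun g hg => ?_
      obtain ⟨j, hj, rfl⟩ := List.mem_map.1 hg
      exact hne j (List.mem_range.1 hj).ne
    rw [this, one_mul]
  have hder : ∀ i, deriv (fun t => f (A t)) (s i) = (i + 1) * lam := by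
    intro i
    have h1 : (fun t => f (A t)) =ᶠ[𝓝 (s i)] fun t => f (r i (θ i t)) := by
      filter_upwards [hAloc i] with t ht
      rw [ht]
    have h2 : HasDerivAt (fun t => f (r i t)) lam 0 := by
      have := (((hr i).contDiff_comp f).differentiable (by simp) 0).hasDerivAt
      rwa [hrf i f] at this
    have h3 : HasDerivAt (fun t : ℝ => ((i : ℝ) + 1) * (t - s i)) (i + 1) (s i) := by
      simpa using ((hasDerivAt_id (s i)).sub_const (s i)).const_mul ((i : ℝ) + 1)
    have h4 : HasDerivAt (θ i) (1 * (i + 1)) (s i) := by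
      refine HasDerivAt.comp (s i) (h₂ := τ i) ?_ h3
      rw [sub_self, mul_zero]
      exact hasDerivAt_of_eventuallyEq_id (hτid i)
    have h5 : HasDerivAt (fun t => f (r i (θ i t))) (lam * (1 * (i + 1))) (s i) := by
      refine HasDerivAt.comp (s i) (h₂ := fun t => f (r i t)) ?_ h4
      have : θ i (s i) = 0 := by simp [θ, hτ0]
      rwa [this]
    rw [h1.deriv_eq, h5.deriv]
    ring
  -- `f ∘ A` is smooth at `0` too, so the values `(i + 1) lam` of its derivative at `s i` converge.
  -- Their successive differences, all equal to `lam`, then tend to `0`.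
  have hcont : Continuous (deriv (fun t => f (A t))) :=
    (hA.contDiff_comp f).continuous_deriv (by simp)
  have hs0 : Filter.Tendsto s Filter.atTop (𝓝 0) :=
    tendsto_pow_atTop_nhds_zero_of_lt_one (by norm_num) (by norm_num)
  have h1 := (hcont.tendsto 0).comp hs0
  have h2 := ((Filter.tendsto_add_atTop_iff_nat 1).2 h1).sub h1
  rw [sub_self] at h2
  have h3 : ∀ i, ((deriv fun t => f (A t)) ∘ s) (i + 1) - ((deriv fun t => f (A t)) ∘ s) i = lam := by
    intro i
    simp only [Function.comp_apply, hder]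
    push_cast
    ring
  simp only [h3] at h2
  exact tendsto_nhds_unique tendsto_const_nhds h2

/-- Tangent vectors of `Diff(M)` at the identity are determined by the derivatives of the
evaluation maps. -/
theorem tangent_diff_ext {V W : LieAlg (Diff (𝓡 n) M)}
    (h : ∀ (g : M → ℝ) (hg : ContMDiff (𝓡 n) 𝓘(ℝ, ℝ) ∞ g) (x : M),
      dirDeriv (evalMap g hg x) V = dirDeriv (evalMap g hg x) W) : V = W := by
  have hsub : ∀ f, dirDeriv f (V + (-1 : ℝ) • W) = dirDeriv f V - dirDeriv f W := fun f => by
    rw [dirDeriv_add, dirDeriv_smul]; ring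
  obtain ⟨c, hcV⟩ := tangent_surjective (V + (-1 : ℝ) • W)
  refine tangentCone_ext fun f => sub_eq_zero.1 ?_
  rw [← hsub, ← hcV, dirDeriv_tangent]
  refine deriv_eq_zero_of_zeroVel c.1.toFun (SmoothFam.of_curve c) c.2 (fun g hg x => ?_) f
  have := hsub (evalMap g hg x)
  rw [h g hg x, sub_self, ← hcV, dirDeriv_tangent] at this
  exact this

end ZeroVelocity

/-! ### Derivatives of functions and velocities of curves -/

section DerivativeMaps

variable {n : ℕ} {M : Type u} [TopologicalSpace M] [ChartedSpace (EuclideanSpace ℝ (Fin n)) M]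
  {F : Type*} [NormedAddCommGroup F] [NormedSpace ℝ F]

/-- The derivative at `x` of a map from `M` to a normed space, in the direction `v`. -/
def dmap (g : M → F) (x : M) (v : EuclideanSpace ℝ (Fin n)) : F :=
  (mfderiv (𝓡 n) 𝓘(ℝ, F) g x : EuclideanSpace ℝ (Fin n) →L[ℝ] F) v

lemma dmap_congr {g g' : M → F} {x : M} (h : g =ᶠ[𝓝 x] g') (v : EuclideanSpace ℝ (Fin n)) :
    dmap g x v = dmap g' x v := by
  have := h.mfderiv_eq (I := 𝓡 n) (I' := 𝓘(ℝ, F))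
  exact congrArg (fun L : EuclideanSpace ℝ (Fin n) →L[ℝ] F => L v) this

lemma dmap_comp {F' : Type*} [NormedAddCommGroup F'] [NormedSpace ℝ F'] {g : M → F} {x : M}
    {k : F → F'} (hk : DifferentiableAt ℝ k (g x)) (hg : MDifferentiableAt (𝓡 n) 𝓘(ℝ, F) g x)
    (v : EuclideanSpace ℝ (Fin n)) : dmap (fun y => k (g y)) x v = fderiv ℝ k (g x) (dmap g x v) := by
  have h := mfderiv_comp x hk.mdifferentiableAt hg
  have h2 := congrArg (fun L : EuclideanSpace ℝ (Fin n) →L[ℝ] F' => L v) h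
  refine h2.trans ?_
  exact congrArg (fun L : F →L[ℝ] F' => L (dmap g x v)) (mfderiv_eq_fderiv (f := k) (x := g x))

lemma dmap_clm {F' : Type*} [NormedAddCommGroup F'] [NormedSpace ℝ F'] {g : M → F} {x : M}
    (L : F →L[ℝ] F') (hg : MDifferentiableAt (𝓡 n) 𝓘(ℝ, F) g x)
    (v : EuclideanSpace ℝ (Fin n)) : dmap (fun y => L (g y)) x v = L (dmap g x v) := by
  rw [dmap_comp L.differentiableAt hg, L.fderiv]

lemma dmap_smul (g : M → F) (x : M) (a : ℝ) (v : EuclideanSpace ℝ (Fin n)) :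
    dmap g x (a • v) = a • dmap g x v :=
  (mfderiv (𝓡 n) 𝓘(ℝ, F) g x : EuclideanSpace ℝ (Fin n) →L[ℝ] F).map_smul a v

/-- The velocity of a curve in `M`. -/
def velocity (γ : ℝ → M) (t : ℝ) : EuclideanSpace ℝ (Fin n) :=
  (mfderiv 𝓘(ℝ, ℝ) (𝓡 n) γ t : ℝ →L[ℝ] EuclideanSpace ℝ (Fin n)) 1

lemma hasDerivAt_comp_curve {γ : ℝ → M} {t : ℝ} (hγ : MDifferentiableAt 𝓘(ℝ, ℝ) (𝓡 n) γ t)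
    {g : M → F} (hg : MDifferentiableAt (𝓡 n) 𝓘(ℝ, F) g (γ t)) :
    HasDerivAt (fun s => g (γ s)) (dmap g (γ t) (velocity (n := n) γ t)) t := by
  let A : EuclideanSpace ℝ (Fin n) →L[ℝ] F := mfderiv (𝓡 n) 𝓘(ℝ, F) g (γ t)
  let B : ℝ →L[ℝ] EuclideanSpace ℝ (Fin n) := mfderiv 𝓘(ℝ, ℝ) (𝓡 n) γ t
  have h : HasFDerivAt (fun s => g (γ s)) (A.comp B) t :=
    (hg.hasMFDerivAt.comp t hγ.hasMFDerivAt).hasFDerivAt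
  exact h.hasDerivAt

/-- A straight line in a chart is a curve through `x` with velocity `v`. This identifies the
velocity of a perturbation of the identity written in a chart. -/
lemma hasDerivAt_along_chart [IsManifold (𝓡 n) ∞ M] (x₀ : M) {x : M}
    (hx : x ∈ (extChartAt (𝓡 n) x₀).source) {g : M → F}
    (hg : ContMDiffAt (𝓡 n) 𝓘(ℝ, F) ∞ g x) (v : EuclideanSpace ℝ (Fin n)) :
    HasDerivAt (fun t : ℝ => g ((extChartAt (𝓡 n) x₀).symm
      (extChartAt (𝓡 n) x₀ x + t • dmap (extChartAt (𝓡 n) x₀) x v))) (dmap g x v) 0 := by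
  set e := extChartAt (𝓡 n) x₀
  have hes : ContMDiffAt 𝓘(ℝ, EuclideanSpace ℝ (Fin n)) (𝓡 n) ∞ e.symm (e x) :=
    (contMDiffOn_extChartAt_symm x₀).contMDiffAt
      ((isOpen_extChartAt_target x₀).mem_nhds (e.map_source hx))
  have hex : ContMDiffAt (𝓡 n) 𝓘(ℝ, EuclideanSpace ℝ (Fin n)) ∞ e x :=
    contMDiffAt_extChartAt' (by rwa [extChartAt_source] at hx)
  have hge : ContDiffAt ℝ ∞ (fun y => g (e.symm y)) (e x) := by
    refine contMDiffAt_iff_contDiffAt.1 (ContMDiffAt.comp (e x) (g := g) ?_ hes)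
    rwa [e.left_inv hx]
  have hgd := hge.differentiableAt (by simp)
  have h1 : dmap g x v = fderiv ℝ (fun y => g (e.symm y)) (e x) (dmap e x v) := by
    rw [← dmap_comp (g := e) hgd (hex.mdifferentiableAt (by simp))]
    refine dmap_congr ?_ v
    filter_upwards [(isOpen_extChartAt_source (I := 𝓡 n) x₀).mem_nhds hx] with y hy
    rw [e.left_inv hy]
  have h2 : HasDerivAt (fun t : ℝ => e x + t • dmap e x v) (dmap e x v) 0 := by
    simpa using ((hasDerivAt_id (0 : ℝ)).smul_const (dmap e x v)).const_add (e x)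
  rw [h1]
  refine HasFDerivAt.comp_hasDerivAt (l := fun y => g (e.symm y)) 0 ?_ h2
  simpa using hgd.hasFDerivAt

end DerivativeMaps

/-! ### Realizing vector fields by curves of diffeomorphisms -/

section Realization

variable {n : ℕ} {M : Type u} [TopologicalSpace M] [T2Space M]
  [ChartedSpace (EuclideanSpace ℝ (Fin n)) M] [IsManifold (𝓡 n) ∞ M]
  {P : Type*} [NormedAddCommGroup P] [NormedSpace ℝ P]

/-- A family of vector fields is smooth if it maps smooth functions to smooth functions. -/
def SmoothField (ξ : P → M → EuclideanSpace ℝ (Fin n)) : Prop :=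
  ∀ h : M → ℝ, ContMDiff (𝓡 n) 𝓘(ℝ, ℝ) ∞ h →
    ContMDiff (𝓘(ℝ, P).prod (𝓡 n)) 𝓘(ℝ, ℝ) ∞ (fun q : P × M => dmap h q.2 (ξ q.1 q.2))

/-- Smoothness is tested only on global real functions. A local vector-valued map, such as a chart,
is replaced by a global one with the same germ and then treated component by component. -/
lemma SmoothField.contMDiffAt_dmap {ξ : P → M → EuclideanSpace ℝ (Fin n)} (hξ : SmoothField ξ)
    {g : M → EuclideanSpace ℝ (Fin n)} {x : M}
    (hg : ∀ᶠ y in 𝓝 x, ContMDiffAt (𝓡 n) 𝓘(ℝ, EuclideanSpace ℝ (Fin n)) ∞ g y) (p : P) :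
    ContMDiffAt (𝓘(ℝ, P).prod (𝓡 n)) 𝓘(ℝ, EuclideanSpace ℝ (Fin n)) ∞
      (fun q : P × M => dmap g q.2 (ξ q.1 q.2)) (p, x) := by
  obtain ⟨h, hh, heq⟩ := exists_contMDiff_eventuallyEq hg
  have h1 : ContMDiffAt (𝓘(ℝ, P).prod (𝓡 n)) 𝓘(ℝ, Fin n → ℝ) ∞
      (fun q : P × M => EuclideanSpace.equiv (Fin n) ℝ (dmap h q.2 (ξ q.1 q.2))) (p, x) := by
    rw [contMDiffAt_pi_space]
    intro i
    have h2 := hξ (fun y => EuclideanSpace.proj (𝕜 := ℝ) i (h y))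
      ((EuclideanSpace.proj (𝕜 := ℝ) i).contMDiff.comp hh)
    refine (h2 (p, x)).congr_of_eventuallyEq (Filter.Eventually.of_forall fun q => ?_)
    exact (dmap_clm (EuclideanSpace.proj (𝕜 := ℝ) i : EuclideanSpace ℝ (Fin n) →L[ℝ] ℝ)
      ((hh q.2).mdifferentiableAt (by simp)) (ξ q.1 q.2)).symm
  have h0 : ContMDiff 𝓘(ℝ, Fin n → ℝ) 𝓘(ℝ, EuclideanSpace ℝ (Fin n)) ∞
      (EuclideanSpace.equiv (Fin n) ℝ).symm :=
    ContDiff.contMDiff ((EuclideanSpace.equiv (Fin n) ℝ).symm :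
      (Fin n → ℝ) →L[ℝ] EuclideanSpace ℝ (Fin n)).contDiff
  have h3 := ContMDiffAt.comp (p, x) h0.contMDiffAt h1
  refine h3.congr_of_eventuallyEq ?_
  filter_upwards [continuousAt_snd.eventually (eventually_eventually_nhds.2 heq)] with q hq
  simp only [Function.comp_apply, ContinuousLinearEquiv.symm_apply_apply]
  exact dmap_congr (Filter.EventuallyEq.symm hq) _

/-- A partition of unity indexed by `ℕ`, whose members have compact support in a chart. -/
lemma exists_nat_partition [SecondCountableTopology M] [Nonempty M] :
    ∃ (c : ℕ → M) (ρ : ℕ → M → ℝ), (∀ i, ContMDiff (𝓡 n) 𝓘(ℝ, ℝ) ∞ (ρ i)) ∧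
      (∀ i, IsCompact (tsupport (ρ i))) ∧ (∀ i, tsupport (ρ i) ⊆ (extChartAt (𝓡 n) (c i)).source) ∧
      LocallyFinite (fun i => tsupport (ρ i)) ∧ ∀ x, ∑ᶠ i, ρ i x = 1 := by
  have hLC : LocallyCompactSpace M := ChartedSpace.locallyCompactSpace (EuclideanSpace ℝ (Fin n)) M
  have hV : ∀ x : M, ∃ K : Set M, IsCompact K ∧ x ∈ interior K ∧
      K ⊆ (extChartAt (𝓡 n) x).source := fun x =>
    exists_compact_subset (isOpen_extChartAt_source x) (mem_extChartAt_source x)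
  choose K hKc hxK hKs using hV
  obtain ⟨s, hs, hsU⟩ := TopologicalSpace.countable_cover_nhds
    (f := fun x => interior (K x)) fun x => isOpen_interior.mem_nhds (hxK x)
  have hne : s.Nonempty := by
    obtain ⟨x⟩ := ‹Nonempty M›
    have : x ∈ ⋃ y ∈ s, interior (K y) := hsU ▸ mem_univ x
    obtain ⟨y, hy, -⟩ := mem_iUnion₂.1 this
    exact ⟨y, hy⟩
  obtain ⟨c, rfl⟩ := hs.exists_eq_range hne
  obtain ⟨ρ, hρ⟩ := SmoothPartitionOfUnity.exists_isSubordinate (𝓡 n) isClosed_univ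
    (fun i : ℕ => interior (K (c i))) (fun _ => isOpen_interior) (by
      rw [← hsU]
      simp)
  refine ⟨c, fun i => ρ i, fun i => (ρ i).contMDiff, fun i => ?_, fun i => ?_, ?_,
    fun x => ρ.sum_eq_one (mem_univ x)⟩
  · exact (hKc (c i)).of_isClosed_subset (isClosed_tsupport _) ((hρ i).trans interior_subset)
  · exact ((hρ i).trans interior_subset).trans (hKs _)
  · exact ρ.locallyFinite.closure

/-- A smooth retraction of a finite-dimensional space to a ball, which is the identity near the
centre. -/
lemma exists_bounded_retract [FiniteDimensional ℝ P] (p₀ : P) : ∃ κ : P → P, ContDiff ℝ ∞ κ ∧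
    (∀ p, κ p ∈ Metric.closedBall p₀ 2) ∧ ∀ᶠ p in 𝓝 p₀, κ p = p := by
  let b : ContDiffBump p₀ := ⟨1, 2, by norm_num, by norm_num⟩
  refine ⟨fun p => p₀ + b p • (p - p₀),
    contDiff_const.add (b.contDiff.smul (contDiff_id.sub contDiff_const)), fun p => ?_, ?_⟩
  · rw [mem_closedBall_iff_norm, add_sub_cancel_left, norm_smul, Real.norm_eq_abs,
      abs_of_nonneg b.nonneg]
    by_cases hp : dist p p₀ < 2
    · calc b p * ‖p - p₀‖ ≤ 1 * 2 := by
            gcongr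
            · exact b.le_one
            · rw [← dist_eq_norm]; exact hp.le
        _ = 2 := one_mul 2
    · rw [b.zero_of_le_dist (not_lt.1 hp)]
      simp
  · filter_upwards [b.eventuallyEq_one] with p hp
    simp [hp]

/-- Velocities at the identity add under products, by `deriv_curveMul` applied to an evaluation. -/
lemma hasDerivAt_partialProd {a : ℕ → ℝ → Diff (𝓡 n) M} (ha : ∀ i, SmoothFam (a i))
    (h0 : ∀ i, a i 0 = 1) {h : M → ℝ} (hh : ContMDiff (𝓡 n) 𝓘(ℝ, ℝ) ∞ h) (x : M) {d : ℕ → ℝ}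
    (hd : ∀ i, HasDerivAt (fun t => h (a i t x)) (d i) 0) (N : ℕ) :
    HasDerivAt (fun t => h (partialProd (fun i => a i t) N x)) (∑ i ∈ Finset.range N, d i) 0 := by
  have hP0 : ∀ N, partialProd (fun i => a i 0) N = 1 := fun N =>
    List.prod_eq_one fun g hg => by
      obtain ⟨j, -, rfl⟩ := List.mem_map.1 hg
      exact h0 j
  induction N with
  | zero => simpa using hasDerivAt_const (0 : ℝ) (h x)
  | succ N ih =>
    have hP := smoothFam_partialProd ha N
    have h1 := deriv_curveMul (evalMap h hh x) (hP.curve (hP0 N)) ((ha N).curve (h0 N))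
    have h2 := ((((hP.mul (ha N)).contDiff_comp (evalMap h hh x))).differentiable
      (by simp) 0).hasDerivAt
    have h3 : deriv (fun t => h (a N t x)) 0 = d N := (hd N).deriv
    have h4 : deriv (fun t => h (partialProd (fun i => a i t) N x)) 0 = _ := ih.deriv
    have h5 : deriv (fun t => evalMap h hh x (partialProd (fun i => a i t) N * a N t)) 0 =
        ∑ i ∈ Finset.range (N + 1), d i := by
      rw [Finset.sum_range_succ, ← h3, ← h4]
      exact h1
    rw [h5] at h2
    simp only [partialProd_succ]
    exact h2

variable [SecondCountableTopology M] [FiniteDimensional ℝ P]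

/-- Smooth families of vector fields are locally velocity fields of smooth families of curves in
`Diff(M)`. -/
theorem SmoothField.exists_curves {ξ : P → M → EuclideanSpace ℝ (Fin n)} (hξ : SmoothField ξ)
    (p₀ : P) : ∃ c : P × ℝ → Diff (𝓡 n) M, SmoothFam c ∧ (∀ p, c (p, 0) = 1) ∧
      ∀ᶠ p in 𝓝 p₀, ∀ h : M → ℝ, ContMDiff (𝓡 n) 𝓘(ℝ, ℝ) ∞ h → ∀ x,
        HasDerivAt (fun t => h (c (p, t) x)) (dmap h x (ξ p x)) 0 := by
  rcases isEmpty_or_nonempty M with hM | hM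
  · exact ⟨fun _ => 1, SmoothFam.one, fun _ => rfl,
      Filter.Eventually.of_forall fun p h hh x => (hM.false x).elim⟩
  obtain ⟨m, ρ, hρ, hρc, hρs, hlf, hsum⟩ := exists_nat_partition (n := n) (M := M)
  -- Replacing `p` by `κ p` confines the parameters to a compact ball, so that each piece of the
  -- field has a uniformly bounded derivative. The price is that the velocity is right only for `p`
  -- near `p₀`.
  obtain ⟨κ, hκ, hκb, hκid⟩ := exists_bounded_retract p₀
  let e := fun i => extChartAt (𝓡 n) (m i)
  have htop : ∀ i, IsOpen (e i).target := fun i => isOpen_extChartAt_target (m i)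
  have hsop : ∀ i, IsOpen (e i).source := fun i => isOpen_extChartAt_source (m i)
  let K : ℕ → Set (EuclideanSpace ℝ (Fin n)) := fun i => e i '' tsupport (ρ i)
  have hKc : ∀ i, IsCompact (K i) := fun i =>
    (hρc i).image_of_continuousOn ((continuousOn_extChartAt (m i)).mono (hρs i))
  have hKt : ∀ i, K i ⊆ (e i).target := by
    rintro i _ ⟨x, hx, rfl⟩
    exact (e i).map_source (hρs i hx)
  have hKsymm : ∀ i x, x ∉ tsupport (ρ i) → x ∉ (e i).symm '' K i := by
    rintro i x hx ⟨_, ⟨z, hz, rfl⟩, rfl⟩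
    rw [(e i).left_inv (hρs i hz)] at hx
    exact hx hz
  -- The chart expression of `ρ i • ξ`, extended by `0`; its support lies over the compact set `K
  -- i`.
  let v : ℕ → P × EuclideanSpace ℝ (Fin n) → EuclideanSpace ℝ (Fin n) := fun i =>
    (univ ×ˢ (e i).target).indicator
      fun q => ρ i ((e i).symm q.2) • dmap (e i) ((e i).symm q.2) (ξ q.1 ((e i).symm q.2))
  have hvt : ∀ i p y, y ∈ (e i).target → v i (p, y) =
      ρ i ((e i).symm y) • dmap (e i) ((e i).symm y) (ξ p ((e i).symm y)) := fun i p y hy =>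
    indicator_of_mem (mk_mem_prod (mem_univ _) hy) _
  have hvK : ∀ i p, ∀ y ∉ K i, v i (p, y) = 0 := by
    intro i p y hy
    by_cases hyt : y ∈ (e i).target
    · have : ρ i ((e i).symm y) = 0 :=
        image_eq_zero_of_notMem_tsupport fun h => hy ⟨_, h, (e i).right_inv hyt⟩
      rw [hvt i p y hyt, this, zero_smul]
    · exact indicator_of_notMem (fun h => hyt h.2) _
  have hv : ∀ i, ContDiff ℝ ∞ (v i) := by
    intro i
    rw [contDiff_iff_contDiffAt]
    rintro ⟨p, y⟩
    by_cases hy : y ∈ (e i).target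
    · have hx : (e i).symm y ∈ (e i).source := (e i).map_target hy
      have h1 : ContMDiffAt 𝓘(ℝ, P × EuclideanSpace ℝ (Fin n)) (𝓡 n) ∞
          (fun q : P × EuclideanSpace ℝ (Fin n) => (e i).symm q.2) (p, y) :=
        ((contMDiffOn_extChartAt_symm (m i)).contMDiffAt ((htop i).mem_nhds hy)).comp (p, y)
          contDiff_snd.contMDiff.contMDiffAt
      have h2 := hξ.contMDiffAt_dmap (g := e i) (x := (e i).symm y) (by
        filter_upwards [(hsop i).mem_nhds hx] with z hz
        exact contMDiffAt_extChartAt' (by rwa [← extChartAt_source (I := 𝓡 n)])) p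
      have h3 := (((hρ i) _).comp (p, y) h1).smul
        (ContMDiffAt.comp (p, y) h2 (contDiff_fst.contMDiff.contMDiffAt.prodMk h1))
      refine (contMDiffAt_iff_contDiffAt.1 h3).congr_of_eventuallyEq ?_
      filter_upwards [continuousAt_snd.preimage_mem_nhds ((htop i).mem_nhds hy)] with q hq
      exact hvt i q.1 q.2 hq
    · refine (contDiffAt_const (c := (0 : EuclideanSpace ℝ (Fin n)))).congr_of_eventuallyEq ?_
      filter_upwards [continuousAt_snd.preimage_mem_nhds
        ((hKc i).isClosed.isOpen_compl.mem_nhds fun h => hy (hKt i h))] with q hq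
      exact hvK i q.1 q.2 hq
  let D : ℕ → P × EuclideanSpace ℝ (Fin n) → EuclideanSpace ℝ (Fin n) →L[ℝ] EuclideanSpace ℝ (Fin n) :=
    fun i q => fderiv ℝ (fun y => v i (q.1, y)) q.2
  have hD : ∀ i, Continuous (D i) := fun i =>
    (ContDiff.fderiv (m := ∞) (n := ∞)
      (f := fun (q : P × EuclideanSpace ℝ (Fin n)) y => v i (q.1, y)) (g := Prod.snd)
      ((hv i).comp ((contDiff_fst.comp contDiff_fst).prodMk contDiff_snd)) contDiff_snd
      (by simp)).continuous
  have hB : ∀ i, ∃ B : ℝ, 0 ≤ B ∧ ∀ p y, ‖D i (κ p, y)‖ ≤ B := by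
    intro i
    obtain ⟨B, hB⟩ := ((isCompact_closedBall p₀ 2).prod (hKc i)).exists_bound_of_continuousOn
      (hD i).continuousOn
    refine ⟨|B|, abs_nonneg B, fun p y => ?_⟩
    by_cases hy : y ∈ K i
    · exact (hB _ ⟨hκb p, hy⟩).trans (le_abs_self B)
    · have : (fun y => v i (κ p, y)) =ᶠ[𝓝 y] fun _ => 0 := by
        filter_upwards [(hKc i).isClosed.isOpen_compl.mem_nhds hy] with z hz
        exact hvK i _ z hz
      simp only [D, this.fderiv_eq]
      simp
  choose B hB0 hB using hB
  -- The bound `1 / (i + 1)` makes all but finitely many factors trivial at each time `t ≠ 0`; at `t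
  -- = 0` all are trivial. The second bound makes each factor a perturbation with derivative at most
  -- `1/2`.
  have hδ : ∀ i : ℕ, 0 < min (1 / ((i : ℝ) + 1)) (1 / (2 * (B i + 1))) := fun i => by
    have := hB0 i
    positivity
  choose τ hτ hτ0 hτid hτlt hτz using fun i => exists_time_cutoff (hδ i)
  have hpert := fun i => exists_chart_perturbation (P := P × ℝ) (m i) (hKc i) (hKt i)
    (u := fun p y => τ i p.2 • v i (κ p.1, y))
    (((hτ i).comp (contDiff_snd.comp contDiff_fst)).smul
      ((hv i).comp ((hκ.comp (contDiff_fst.comp contDiff_fst)).prodMk contDiff_snd)))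
    (fun p y hy => by simp [hvK i _ y hy])
    (by
      intro p y
      have h1 : fderiv ℝ (fun y => τ i p.2 • v i (κ p.1, y)) y = τ i p.2 • D i (κ p.1, y) :=
        fderiv_fun_const_smul (((hv i).comp (contDiff_const.prodMk contDiff_id)).differentiable
          (by simp) y) _
      have h3 := (hτlt i p.2).trans_le (min_le_right _ _)
      have := hB0 i
      rw [h1, norm_smul, Real.norm_eq_abs]
      calc |τ i p.2| * ‖D i (κ p.1, y)‖ ≤ 1 / (2 * (B i + 1)) * B i := by
            gcongr
            exact hB i _ _
        _ ≤ 1 / 2 := by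
            rw [div_mul_eq_mul_div, div_le_div_iff₀ (by positivity) (by positivity)]
            linarith)
  choose a ha hae haK using hpert
  have ha1 : ∀ i p, τ i p.2 = 0 → a i p = 1 := by
    intro i p hp
    refine Diffeomorph.ext fun x => ?_
    by_cases hx : x ∈ (e i).source
    · have := hae i p (e i x) ((e i).map_source hx)
      rw [hp, zero_smul, add_zero] at this
      simpa only [e, (e i).left_inv hx, diff_one_apply] using this
    · exact haK i p x (hKsymm i x fun h => hx (hρs i h))
  have hatr : ∀ i p x, x ∉ tsupport (ρ i) → a i p x = x := fun i p x hx =>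
    haK i p x (hKsymm i x hx)
  have hfinite : ∀ x, ∃ J, ∀ᶠ y in 𝓝 x, ∀ i ≥ J, y ∉ tsupport (ρ i) := by
    intro x
    obtain ⟨t, ht, hfin⟩ := hlf x
    obtain ⟨J, hJ⟩ := hfin.bddAbove
    refine ⟨J + 1, ?_⟩
    filter_upwards [ht] with y hy i hi hyi
    have : i ≤ J := hJ ⟨y, hyi, hy⟩
    omega
  obtain ⟨A, hA, hAp⟩ := exists_infinite_product ha
    (fun p x => by
      obtain ⟨J, hJ⟩ := hfinite x
      refine ⟨J, ?_⟩
      filter_upwards [continuousAt_snd.eventually hJ] with q hq i hi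
      exact hatr i _ _ (hq i hi))
    (fun p => by
      by_cases hp : p.2 = 0
      · exact ⟨0, fun i _ => ha1 i p (by rw [hp, hτ0])⟩
      · obtain ⟨N, hN⟩ := exists_nat_one_div_lt (abs_pos.2 hp)
        refine ⟨N, fun i hi => ha1 i p (hτz i _ ((min_le_left _ _).trans (le_trans ?_ hN.le)))⟩
        gcongr)
  refine ⟨A, hA, fun p => ?_, ?_⟩
  · refine Diffeomorph.ext fun x => ?_
    rw [hAp (p, 0) 0 x fun i _ => by rw [ha1 i (p, 0) (hτ0 i), diff_one_apply]]
    rfl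
  · filter_upwards [hκid] with p hp h hh x
    obtain ⟨J, hJ⟩ := hfinite x
    have hJx := hJ.self_of_nhds
    have h1 : ∀ t, A (p, t) x = partialProd (fun i => a i (p, t)) J x := fun t =>
      hAp (p, t) J x fun i hi => hatr i _ _ (hJx i hi)
    have h2 : ∀ i, HasDerivAt (fun t => h (a i (p, t) x)) (ρ i x * dmap h x (ξ p x)) 0 := by
      intro i
      by_cases hx : x ∈ (e i).source
      · have h3 := hasDerivAt_along_chart (m i) hx (hh x) (ρ i x • ξ p x)
        have h3' : dmap h x (ρ i x • ξ p x) = ρ i x * dmap h x (ξ p x) := dmap_smul h x _ _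
        rw [h3'] at h3
        refine h3.congr_of_eventuallyEq ?_
        filter_upwards [hτid i] with t ht
        have h4 := hae i (p, t) (e i x) ((e i).map_source hx)
        rw [hp, ht, hvt i _ _ ((e i).map_source hx), (e i).left_inv hx] at h4
        simp only [e] at h4
        rw [h4, dmap_smul]
      · have hxρ : x ∉ tsupport (ρ i) := fun h => hx (hρs i h)
        rw [image_eq_zero_of_notMem_tsupport hxρ, zero_mul]
        simp only [hatr i _ x hxρ]
        exact hasDerivAt_const _ _
    have h5 := hasDerivAt_partialProd (fun i => (ha i).comp (contDiff_const.prodMk contDiff_id))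
      (fun i => ha1 i (p, 0) (hτ0 i)) hh x h2 J
    rw [← Finset.sum_mul] at h5
    have h6 : ∑ i ∈ Finset.range J, ρ i x = 1 := by
      rw [← hsum x, finsum_eq_sum_of_support_subset]
      intro i hi
      rw [Finset.coe_range, mem_Iio]
      by_contra hiJ
      exact hi (image_eq_zero_of_notMem_tsupport (hJx i (not_lt.1 hiJ)))
    rw [h6, one_mul] at h5
    simpa only [h1, id] using h5

end Realization

/-! ### The Lie algebra as the space of smooth vector fields -/

section Fields

variable {n : ℕ} {M : Type u} [TopologicalSpace M]
  [ChartedSpace (EuclideanSpace ℝ (Fin n)) M] [IsManifold (𝓡 n) ∞ M]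
  {P : Type*} [NormedAddCommGroup P] [NormedSpace ℝ P]

/-- The velocity field of a tangent vector of `Diff(M)` at the identity. -/
def vfield (V : LieAlg (Diff (𝓡 n) M)) (x : M) : EuclideanSpace ℝ (Fin n) :=
  velocity (n := n) (fun t => (tangent_surjective V).choose.1 t x) 0

lemma SmoothFam.contMDiff_orbit {a : P → Diff (𝓡 n) M} (ha : SmoothFam a) (x : M) :
    ContMDiff 𝓘(ℝ, P) (𝓡 n) ∞ (fun p => a p x) :=
  ha.apply contMDiff_id contMDiff_const

/-- The curve used to define `vfield` is chosen arbitrarily. This chain rule shows that the action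
of the field on smooth functions depends only on `V`. -/
lemma dirDeriv_evalMap (V : LieAlg (Diff (𝓡 n) M)) {h : M → ℝ}
    (hh : ContMDiff (𝓡 n) 𝓘(ℝ, ℝ) ∞ h) (x : M) :
    dirDeriv (evalMap h hh x) V = dmap h x (vfield V x) := by
  have hc := (tangent_surjective V).choose_spec
  set c := (tangent_surjective V).choose with hcdef
  have h0 : c.1 0 x = x := by rw [c.2, diff_one_apply]
  have h1 := hasDerivAt_comp_curve (t := 0)
    (((SmoothFam.of_curve c).contMDiff_orbit x 0).mdifferentiableAt (by simp))
    ((hh (c.1 0 x)).mdifferentiableAt (by simp))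
  rw [h0] at h1
  rw [← congrArg (dirDeriv (evalMap h hh x)) hc]
  exact h1.deriv

/-- The derivative of a parametrized smooth function in one of the parameters is smooth. -/
lemma contMDiff_deriv_param {k : P × ℝ → M → ℝ}
    (hk : ContMDiff (𝓘(ℝ, P × ℝ).prod (𝓡 n)) 𝓘(ℝ, ℝ) ∞ (fun q : (P × ℝ) × M => k q.1 q.2)) :
    ContMDiff (𝓘(ℝ, P).prod (𝓡 n)) 𝓘(ℝ, ℝ) ∞
      (fun q : P × M => deriv (fun t => k (q.1, t) q.2) 0) := by
  rintro ⟨p₀, x₀⟩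
  set e := extChartAt (𝓡 n) x₀
  let K : P × EuclideanSpace ℝ (Fin n) → ℝ → ℝ := fun q t => k (q.1, t) (e.symm q.2)
  have hK : ContDiffAt ℝ ∞ (Function.uncurry K) ((p₀, e x₀), 0) := by
    rw [← contMDiffAt_iff_contDiffAt]
    have h1 : ContMDiffAt 𝓘(ℝ, (P × EuclideanSpace ℝ (Fin n)) × ℝ) (𝓡 n) ∞
        (fun q : (P × EuclideanSpace ℝ (Fin n)) × ℝ => e.symm q.1.2) ((p₀, e x₀), 0) :=
      ContMDiffAt.comp (g := e.symm) _ ((contMDiffOn_extChartAt_symm x₀).contMDiffAt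
        ((isOpen_extChartAt_target x₀).mem_nhds (mem_extChartAt_target x₀)))
        (contDiff_snd.comp contDiff_fst).contMDiff.contMDiffAt
    have h2 : ContMDiffAt 𝓘(ℝ, (P × EuclideanSpace ℝ (Fin n)) × ℝ) 𝓘(ℝ, P × ℝ) ∞
        (fun q : (P × EuclideanSpace ℝ (Fin n)) × ℝ => (q.1.1, q.2)) ((p₀, e x₀), 0) :=
      ((contDiff_fst.comp contDiff_fst).prodMk contDiff_snd).contMDiff.contMDiffAt
    exact ContMDiffAt.comp (g := fun q : (P × ℝ) × M => k q.1 q.2) _ (hk _) (h2.prodMk h1)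
  have hd : ContDiffAt ℝ ∞ (fun q : P × EuclideanSpace ℝ (Fin n) => deriv (K q) 0) (p₀, e x₀) :=
    (ContDiffAt.fderiv (m := ∞) (n := ∞) (g := fun _ => (0 : ℝ)) hK contDiffAt_const
      (by simp)).clm_apply contDiffAt_const
  have h3 : ContMDiffAt (𝓘(ℝ, P).prod (𝓡 n)) 𝓘(ℝ, P × EuclideanSpace ℝ (Fin n)) ∞
      (fun q : P × M => (q.1, e q.2)) (p₀, x₀) :=
    contMDiffAt_fst.prodMk_space (contMDiffAt_extChartAt.comp (p₀, x₀) contMDiffAt_snd)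
  refine (ContMDiffAt.comp (p₀, x₀) (contMDiffAt_iff_contDiffAt.2 hd) h3).congr_of_eventuallyEq ?_
  filter_upwards [continuousAt_snd.preimage_mem_nhds (extChartAt_source_mem_nhds (I := 𝓡 n) x₀)]
    with q hq
  simp only [Function.comp_apply, K, e, (extChartAt (𝓡 n) x₀).left_inv hq]

/-- A smooth family of tangent vectors of `Diff(M)` at the identity. -/
def SmoothLie (γ : P → LieAlg (Diff (𝓡 n) M)) : Prop := SmoothField fun p => vfield (γ p)

lemma dmap_vfield_add (V W : LieAlg (Diff (𝓡 n) M)) {h : M → ℝ}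
    (hh : ContMDiff (𝓡 n) 𝓘(ℝ, ℝ) ∞ h) (x : M) :
    dmap h x (vfield (V + W) x) = dmap h x (vfield V x) + dmap h x (vfield W x) := by
  simp only [← dirDeriv_evalMap _ hh, dirDeriv_add]

lemma dmap_vfield_smul (a : ℝ) (V : LieAlg (Diff (𝓡 n) M)) {h : M → ℝ}
    (hh : ContMDiff (𝓡 n) 𝓘(ℝ, ℝ) ∞ h) (x : M) :
    dmap h x (vfield (a • V) x) = a * dmap h x (vfield V x) := by
  simp only [← dirDeriv_evalMap _ hh, dirDeriv_smul]

lemma SmoothLie.add {γ δ : P → LieAlg (Diff (𝓡 n) M)} (hγ : SmoothLie γ) (hδ : SmoothLie δ) :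
    SmoothLie (fun p => γ p + δ p) := fun h hh => by
  simp only [dmap_vfield_add _ _ hh]
  exact (hγ h hh).add (hδ h hh)

lemma SmoothLie.smul {γ : P → LieAlg (Diff (𝓡 n) M)} (hγ : SmoothLie γ) {f : P → ℝ}
    (hf : ContDiff ℝ ∞ f) : SmoothLie (fun p => f p • γ p) := fun h hh => by
  simp only [dmap_vfield_smul _ _ hh]
  exact (hf.contMDiff.comp contMDiff_fst).mul (hγ h hh)

lemma SmoothLie.comp {Q : Type*} [NormedAddCommGroup Q] [NormedSpace ℝ Q]
    {γ : P → LieAlg (Diff (𝓡 n) M)} (hγ : SmoothLie γ) {f : Q → P} (hf : ContDiff ℝ ∞ f) :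
    SmoothLie (fun q => γ (f q)) := fun h hh =>
  (hγ h hh).comp ((hf.contMDiff.comp contMDiff_fst).prodMk contMDiff_snd)

lemma SmoothFam.smoothLie {a : P × ℝ → Diff (𝓡 n) M} (ha : SmoothFam a) (h0 : ∀ p, a (p, 0) = 1) :
    SmoothLie (fun p => tangent
      ((ha.comp (contDiff_const.prodMk contDiff_id) : SmoothFam fun t => a (p, t)).curve (h0 p))) := by
  intro h hh
  simp only [← dirDeriv_evalMap _ hh]
  exact contMDiff_deriv_param (k := fun q x => h (a q x)) (hh.comp ha)

lemma SmoothLie.const (V : LieAlg (Diff (𝓡 n) M)) : SmoothLie (fun _ : P => V) := by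
  obtain ⟨c, rfl⟩ := tangent_surjective V
  exact SmoothFam.smoothLie (a := fun q : P × ℝ => c.1 q.2)
    ((SmoothFam.of_curve c).comp contDiff_snd) fun _ => c.2

variable [T2Space M]

/-- The coordinates of a chart extend, as germs at `x`, to global smooth functions, and the
derivative of a chart is invertible. -/
lemma eq_of_dmap_eq {x : M} {v w : EuclideanSpace ℝ (Fin n)}
    (hvw : ∀ h : M → ℝ, ContMDiff (𝓡 n) 𝓘(ℝ, ℝ) ∞ h → dmap h x v = dmap h x w) : v = w := by
  set e := extChartAt (𝓡 n) x
  have hsrc := (isOpen_extChartAt_source (I := 𝓡 n) x).mem_nhds (mem_extChartAt_source x)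
  have hev : ∀ᶠ y in 𝓝 x, ContMDiffAt (𝓡 n) 𝓘(ℝ, EuclideanSpace ℝ (Fin n)) ∞ e y := by
    filter_upwards [hsrc] with y hy
    exact contMDiffAt_extChartAt' (by rwa [← extChartAt_source (I := 𝓡 n)])
  obtain ⟨g, hg, hge⟩ := exists_contMDiff_eventuallyEq hev
  have h1 : dmap e x v = dmap e x w := by
    rw [← dmap_congr hge, ← dmap_congr hge]
    ext i
    have h2 := hvw (fun y => EuclideanSpace.proj (𝕜 := ℝ) i (g y))
      ((EuclideanSpace.proj (𝕜 := ℝ) i).contMDiff.comp hg)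
    have h3 := fun v => dmap_clm (EuclideanSpace.proj (𝕜 := ℝ) i : EuclideanSpace ℝ (Fin n) →L[ℝ] ℝ)
      ((hg x).mdifferentiableAt (by simp)) v
    rw [h3, h3] at h2
    exact h2
  obtain ⟨A, hA⟩ := isInvertible_mfderiv_extChartAt (I := 𝓡 n) (mem_extChartAt_source x)
  have h4 : ∀ v : EuclideanSpace ℝ (Fin n), dmap e x v = A v := fun v =>
    congrArg (fun L : EuclideanSpace ℝ (Fin n) →L[ℝ] EuclideanSpace ℝ (Fin n) => L v) hA.symm
  rw [h4, h4] at h1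
  exact A.injective h1

/-- A curve in a tangent space of `M` is differentiable if it is so when applied to all smooth
functions. -/
lemma hasDerivAt_of_dmap {x : M} {v : ℝ → EuclideanSpace ℝ (Fin n)}
    (hv : ∀ h : M → ℝ, ContMDiff (𝓡 n) 𝓘(ℝ, ℝ) ∞ h → ContDiff ℝ ∞ fun t => dmap h x (v t))
    {h : M → ℝ} (t : ℝ) :
    HasDerivAt (fun t => dmap h x (v t)) (dmap h x (deriv v t)) t := by
  set e := extChartAt (𝓡 n) x
  have hsrc := (isOpen_extChartAt_source (I := 𝓡 n) x).mem_nhds (mem_extChartAt_source x)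
  have hev : ∀ᶠ y in 𝓝 x, ContMDiffAt (𝓡 n) 𝓘(ℝ, EuclideanSpace ℝ (Fin n)) ∞ e y := by
    filter_upwards [hsrc] with y hy
    exact contMDiffAt_extChartAt' (by rwa [← extChartAt_source (I := 𝓡 n)])
  obtain ⟨g, hg, hge⟩ := exists_contMDiff_eventuallyEq hev
  have h1 : ContDiff ℝ ∞ fun t => dmap e x (v t) := by
    simp only [← dmap_congr hge]
    rw [contDiff_euclidean]
    intro i
    have h2 := hv (fun y => EuclideanSpace.proj (𝕜 := ℝ) i (g y))
      ((EuclideanSpace.proj (𝕜 := ℝ) i).contMDiff.comp hg)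
    have h3 := fun v => dmap_clm (EuclideanSpace.proj (𝕜 := ℝ) i : EuclideanSpace ℝ (Fin n) →L[ℝ] ℝ)
      ((hg x).mdifferentiableAt (by simp)) v
    simp only [h3] at h2
    exact h2
  obtain ⟨A, hA⟩ := isInvertible_mfderiv_extChartAt (I := 𝓡 n) (mem_extChartAt_source x)
  have h4 : ∀ v : EuclideanSpace ℝ (Fin n), dmap e x v = A v := fun v =>
    congrArg (fun L : EuclideanSpace ℝ (Fin n) →L[ℝ] EuclideanSpace ℝ (Fin n) => L v) hA.symm
  have h5 : Differentiable ℝ v := by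
    let A' : EuclideanSpace ℝ (Fin n) ≃L[ℝ] EuclideanSpace ℝ (Fin n) := A
    have h6 : v = fun t => A'.symm (dmap e x (v t)) := by
      ext1 t
      rw [h4]
      exact (A'.symm_apply_apply _).symm
    rw [h6]
    exact (A'.symm.contDiff.comp h1).differentiable (by simp)
  let B : EuclideanSpace ℝ (Fin n) →L[ℝ] ℝ := mfderiv (𝓡 n) 𝓘(ℝ, ℝ) h x
  exact B.hasFDerivAt.comp_hasDerivAt t (h5 t).hasDerivAt

variable [SecondCountableTopology M] [FiniteDimensional ℝ P]

lemma lie_ext {V W : LieAlg (Diff (𝓡 n) M)}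
    (h : ∀ g : M → ℝ, ContMDiff (𝓡 n) 𝓘(ℝ, ℝ) ∞ g → ∀ x,
      dmap g x (vfield V x) = dmap g x (vfield W x)) : V = W :=
  tangent_diff_ext fun g hg x => by simpa only [dirDeriv_evalMap _ hg] using h g hg x

/-- Smooth families of vector fields on `M` are locally represented by smooth families of curves
in `Diff(M)`. -/
lemma SmoothField.exists_lift {ξ : P → M → EuclideanSpace ℝ (Fin n)} (hξ : SmoothField ξ) (p₀ : P) :
    ∃ (c : P × ℝ → Diff (𝓡 n) M) (hc : SmoothFam c) (h0 : ∀ p, c (p, 0) = 1),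
      ∀ᶠ p in 𝓝 p₀, ∀ h : M → ℝ, ContMDiff (𝓡 n) 𝓘(ℝ, ℝ) ∞ h → ∀ x,
        dmap h x (vfield (tangent ((hc.comp (contDiff_const.prodMk contDiff_id) :
          SmoothFam fun t => c (p, t)).curve (h0 p))) x) = dmap h x (ξ p x) := by
  obtain ⟨c, hc, h0, hev⟩ := hξ.exists_curves p₀
  refine ⟨c, hc, h0, hev.mono fun p hp h hh x => ?_⟩
  rw [← dirDeriv_evalMap _ hh]
  exact (hp h hh x).deriv

/-- The field is regarded as a constant family over `ℝ`, and the realizing curve is taken at the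
parameter `0`. -/
lemma exists_vfield_eq {ξ : M → EuclideanSpace ℝ (Fin n)}
    (hξ : ∀ h : M → ℝ, ContMDiff (𝓡 n) 𝓘(ℝ, ℝ) ∞ h →
      ContMDiff (𝓡 n) 𝓘(ℝ, ℝ) ∞ fun x => dmap h x (ξ x)) :
    ∃ V : LieAlg (Diff (𝓡 n) M), vfield V = ξ := by
  have h1 : SmoothField (fun _ : ℝ => ξ) := fun h hh => (hξ h hh).comp contMDiff_snd
  obtain ⟨c, hc, h0, hev⟩ := h1.exists_lift 0
  exact ⟨_, funext fun x => eq_of_dmap_eq fun h hh => hev.self_of_nhds h hh x⟩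

lemma SmoothLie.exists_lift {γ : P → LieAlg (Diff (𝓡 n) M)} (hγ : SmoothLie γ) (p₀ : P) :
    ∃ (c : P × ℝ → Diff (𝓡 n) M) (hc : SmoothFam c) (h0 : ∀ p, c (p, 0) = 1),
      ∀ᶠ p in 𝓝 p₀, γ p = tangent ((hc.comp (contDiff_const.prodMk contDiff_id) :
          SmoothFam fun t => c (p, t)).curve (h0 p)) := by
  obtain ⟨c, hc, h0, hev⟩ := SmoothField.exists_lift hγ p₀
  exact ⟨c, hc, h0, hev.mono fun p hp => (lie_ext hp).symm⟩

/-- The function differentiated may vary with the parameter, as it does for iterated derivatives in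
the bracket. After lifting `γ` locally to curves `c`, the expression is the `t`-derivative at `0` of
the smooth function `k p (c (p, t) x)`. -/
lemma SmoothLie.contMDiff_apply {γ : P → LieAlg (Diff (𝓡 n) M)} (hγ : SmoothLie γ)
    {k : P → M → ℝ} (hk : ContMDiff (𝓘(ℝ, P).prod (𝓡 n)) 𝓘(ℝ, ℝ) ∞ (fun q : P × M => k q.1 q.2)) :
    ContMDiff (𝓘(ℝ, P).prod (𝓡 n)) 𝓘(ℝ, ℝ) ∞
      (fun q : P × M => dmap (k q.1) q.2 (vfield (γ q.1) q.2)) := by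
  rintro ⟨p₀, x₀⟩
  obtain ⟨c, hc, h0, hev⟩ := hγ.exists_lift p₀
  have h1 := contMDiff_deriv_param (k := fun q x => k q.1 (c q x))
    (hk.comp ((contDiff_fst.contMDiff.comp contMDiff_fst).prodMk (id hc : ContMDiff _ _ _ _)))
  refine (h1 (p₀, x₀)).congr_of_eventuallyEq ?_
  filter_upwards [continuousAt_fst.eventually hev] with q hq
  have hkq : ContMDiff (𝓡 n) 𝓘(ℝ, ℝ) ∞ (k q.1) := hk.comp (contMDiff_const.prodMk contMDiff_id)
  rw [← dirDeriv_evalMap _ hkq, hq]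
  rfl

lemma isPlot_curves_iff {k : ℕ} {ρ : EuclideanSpace ℝ (Fin k) → CurvesAt (1 : Diff (𝓡 n) M)} :
    IsPlot ρ ↔ SmoothFam (fun q : EuclideanSpace ℝ (Fin k) × ℝ => (ρ q.1).1 q.2) := by
  constructor
  · intro h
    let e := toEuclidean (E := EuclideanSpace ℝ (Fin k) × ℝ)
    have h1 := h _ (fun z => (e.symm z).1) (fun z => (e.symm z).2) (contDiff_fst.comp e.symm.contDiff)
      (contDiff_snd.comp e.symm.contDiff).isPlot
    have h2 := (isPlot_diff_iff.1 h1).comp e.contDiff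
    simpa using h2
  · intro h m q p hq hp
    exact isPlot_diff_iff.2 (h.comp (hq.prodMk hp.contDiff))

/-- Plots of a quotient lift locally to smooth families of curves, whose velocities vary smoothly.
Conversely, a smooth family of fields has such lifts by `SmoothLie.exists_lift`. -/
lemma isPlot_lie_iff {k : ℕ} {γ : EuclideanSpace ℝ (Fin k) → LieAlg (Diff (𝓡 n) M)} :
    IsPlot γ ↔ SmoothLie γ := by
  constructor
  · rintro hγ h hh ⟨z₀, x₀⟩
    obtain ⟨u, hu, hzu, q, hq, hqu⟩ := hγ z₀
    have h1 := (isPlot_curves_iff.1 hq).smoothLie fun z => (q z).2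
    refine (h1 h hh (z₀, x₀)).congr_of_eventuallyEq ?_
    filter_upwards [continuousAt_fst.preimage_mem_nhds (hu.mem_nhds hzu)] with y hy
    have h2 : γ y.1 = tangent (q y.1) := hqu y.1 hy
    rw [h2]
    rfl
  · intro hγ z₀
    obtain ⟨c, hc, h0, hev⟩ := hγ.exists_lift z₀
    obtain ⟨u, hu, huo, hzu⟩ := eventually_nhds_iff.1 hev
    exact ⟨u, huo, hzu, fun p => (hc.comp (contDiff_const.prodMk contDiff_id) :
      SmoothFam fun t => c (p, t)).curve (h0 p), isPlot_curves_iff.2 hc, fun z hz => hu z hz⟩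

lemma SmoothLie.dSmooth {γ : ℝ → LieAlg (Diff (𝓡 n) M)} (hγ : SmoothLie γ) : DSmooth γ :=
  fun _ _ hp => isPlot_lie_iff.2 (hγ.comp hp.contDiff)

lemma SmoothLie.contDiff_comp {γ : P → LieAlg (Diff (𝓡 n) M)} (hγ : SmoothLie γ)
    (F : SmoothMap (LieAlg (Diff (𝓡 n) M)) ℝ) : ContDiff ℝ ∞ (fun p => F (γ p)) := by
  have h1 := (F.smooth _ _ (isPlot_lie_iff.2 (hγ.comp
    (toEuclidean (E := P)).symm.contDiff))).contDiff
  simpa [Function.comp_def] using h1.comp (toEuclidean (E := P)).contDiff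

end Fields

/-! ### The derivative of the adjoint action as a commutator -/

/-- Symmetry of the mixed partial derivatives at the origin. -/
lemma deriv_deriv_comm {Φ : ℝ → ℝ → ℝ} (hΦ : ContDiff ℝ ∞ fun q : ℝ × ℝ => Φ q.1 q.2) :
    deriv (fun t => deriv (fun s => Φ t s) 0) 0 = deriv (fun s => deriv (fun t => Φ t s) 0) 0 := by
  set f := fun q : ℝ × ℝ => Φ q.1 q.2
  have h1 : ∀ t s, HasDerivAt (fun s => Φ t s) (fderiv ℝ f (t, s) (0, 1)) s := fun t s =>
    ((hΦ.differentiable (by simp) (t, s)).hasFDerivAt).comp_hasDerivAt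
      (f := fun s : ℝ => (t, s)) s ((hasDerivAt_const s t).prodMk (hasDerivAt_id s))
  have h2 : ∀ t s, HasDerivAt (fun t => Φ t s) (fderiv ℝ f (t, s) (1, 0)) t := fun t s =>
    ((hΦ.differentiable (by simp) (t, s)).hasFDerivAt).comp_hasDerivAt
      (f := fun t : ℝ => (t, s)) t ((hasDerivAt_id t).prodMk (hasDerivAt_const t s))
  have h3 : HasFDerivAt (fderiv ℝ f) (fderiv ℝ (fderiv ℝ f) (0, 0)) (0, 0) :=
    ((hΦ.fderiv_right (m := ∞) (by simp)).differentiable (by simp) (0, 0)).hasFDerivAt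
  have h4 : HasDerivAt (fun t => fderiv ℝ f (t, (0 : ℝ)) (0, 1))
      (fderiv ℝ (fderiv ℝ f) (0, 0) (1, 0) (0, 1)) 0 :=
    (ContinuousLinearMap.apply ℝ ℝ ((0, 1) : ℝ × ℝ)).hasFDerivAt.comp_hasDerivAt 0
      (h3.comp_hasDerivAt (f := fun t : ℝ => (t, (0 : ℝ))) 0
        ((hasDerivAt_id 0).prodMk (hasDerivAt_const 0 0)))
  have h5 : HasDerivAt (fun s => fderiv ℝ f ((0 : ℝ), s) (1, 0))
      (fderiv ℝ (fderiv ℝ f) (0, 0) (0, 1) (1, 0)) 0 :=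
    (ContinuousLinearMap.apply ℝ ℝ ((1, 0) : ℝ × ℝ)).hasFDerivAt.comp_hasDerivAt 0
      (h3.comp_hasDerivAt (f := fun s : ℝ => ((0 : ℝ), s)) 0
        ((hasDerivAt_const 0 0).prodMk (hasDerivAt_id 0)))
  simp only [(h1 _ _).deriv, (h2 _ _).deriv, h4.deriv, h5.deriv]
  exact (hΦ.contDiffAt.isSymmSndFDerivAt (by
    simpa using WithTop.coe_le_coe.2 (le_top (a := (2 : ℕ∞))))).eq _ _

section Bracket

variable {n : ℕ} {M : Type u} [TopologicalSpace M]
  [ChartedSpace (EuclideanSpace ℝ (Fin n)) M] [IsManifold (𝓡 n) ∞ M]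

/-- The derivative of a function on `M` along the velocity field of `V`. -/
def lieD (V : LieAlg (Diff (𝓡 n) M)) (h : M → ℝ) (x : M) : ℝ := dmap h x (vfield V x)

variable {h : M → ℝ} (hh : ContMDiff (𝓡 n) 𝓘(ℝ, ℝ) ∞ h)
include hh

lemma dirDeriv_eq_lieD (V : LieAlg (Diff (𝓡 n) M)) (x : M) :
    dirDeriv (evalMap h hh x) V = lieD V h x := dirDeriv_evalMap V hh x

lemma lieD_tangent (c : CurvesAt (1 : Diff (𝓡 n) M)) (x : M) :
    lieD (tangent c) h x = deriv (fun t => h (c.1 t x)) 0 := (dirDeriv_eq_lieD hh _ x).symm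

lemma contMDiff_lieD (V : LieAlg (Diff (𝓡 n) M)) : ContMDiff (𝓡 n) 𝓘(ℝ, ℝ) ∞ (lieD V h) :=
  (SmoothLie.const (P := ℝ) V h hh).comp
    ((contMDiff_const (c := (0 : ℝ))).prodMk contMDiff_id)

lemma lieD_add_left (V W : LieAlg (Diff (𝓡 n) M)) (x : M) :
    lieD (V + W) h x = lieD V h x + lieD W h x := dmap_vfield_add V W hh x

lemma lieD_smul_left (a : ℝ) (V : LieAlg (Diff (𝓡 n) M)) (x : M) :
    lieD (a • V) h x = a * lieD V h x := dmap_vfield_smul a V hh x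

lemma lieD_zero_left (x : M) : lieD (0 : LieAlg (Diff (𝓡 n) M)) h x = 0 := by
  rw [← dirDeriv_eq_lieD hh]
  exact dirDeriv_zero _

lemma lieD_add_right (V : LieAlg (Diff (𝓡 n) M)) {h' : M → ℝ}
    (hh' : ContMDiff (𝓡 n) 𝓘(ℝ, ℝ) ∞ h') (x : M) :
    lieD V (fun y => h y + h' y) x = lieD V h x + lieD V h' x := by
  obtain ⟨c, rfl⟩ := tangent_surjective V
  have hs : ContMDiff (𝓡 n) 𝓘(ℝ, ℝ) ∞ fun y => h y + h' y := hh.add hh'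
  rw [lieD_tangent hs, lieD_tangent hh, lieD_tangent hh']
  exact deriv_fun_add
    (((SmoothFam.of_curve c).contDiff_comp (evalMap h hh x)).differentiable (by simp) 0)
    (((SmoothFam.of_curve c).contDiff_comp (evalMap h' hh' x)).differentiable (by simp) 0)

lemma lieD_smul_right (V : LieAlg (Diff (𝓡 n) M)) (a : ℝ) (x : M) :
    lieD V (fun y => a * h y) x = a * lieD V h x := by
  obtain ⟨c, rfl⟩ := tangent_surjective V
  have hha : ContMDiff (𝓡 n) 𝓘(ℝ, ℝ) ∞ fun y => a * h y := contMDiff_const.mul hh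
  rw [lieD_tangent hha, lieD_tangent hh]
  exact deriv_const_mul _
    (((SmoothFam.of_curve c).contDiff_comp (evalMap h hh x)).differentiable (by simp) 0)

lemma lieD_sub_right (V : LieAlg (Diff (𝓡 n) M)) {h' : M → ℝ}
    (hh' : ContMDiff (𝓡 n) 𝓘(ℝ, ℝ) ∞ h') (x : M) :
    lieD V (fun y => h y - h' y) x = lieD V h x - lieD V h' x := by
  obtain ⟨c, rfl⟩ := tangent_surjective V
  have hs : ContMDiff (𝓡 n) 𝓘(ℝ, ℝ) ∞ fun y => h y - h' y := hh.sub hh'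
  rw [lieD_tangent hs, lieD_tangent hh, lieD_tangent hh']
  exact deriv_fun_sub
    (((SmoothFam.of_curve c).contDiff_comp (evalMap h hh x)).differentiable (by simp) 0)
    (((SmoothFam.of_curve c).contDiff_comp (evalMap h' hh' x)).differentiable (by simp) 0)

lemma lieD_Ad (c d : CurvesAt (1 : Diff (𝓡 n) M)) (t : ℝ) (x : M) :
    lieD (Ad (c.1 t) (tangent d)) h x =
      deriv (fun s => h (c.1 t (d.1 s ((c.1 t)⁻¹ x)))) 0 := by
  rw [← dirDeriv_eq_lieD hh]
  rfl

/-- The derivative of the adjoint action is the commutator of derivations. -/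
lemma hasDerivAt_lieD_Ad (c : CurvesAt (1 : Diff (𝓡 n) M)) (Y : LieAlg (Diff (𝓡 n) M)) (x : M) :
    HasDerivAt (fun t => lieD (Ad (c.1 t) Y) h x)
      (lieD Y (lieD (tangent c) h) x - lieD (tangent c) (lieD Y h) x) 0 := by
  obtain ⟨d, rfl⟩ := tangent_surjective Y
  have hc := SmoothFam.of_curve c
  have hd := SmoothFam.of_curve d
  have hci : SmoothFam fun t => (c.1 t)⁻¹ := hc.inv
  have hΨ : SmoothFam fun q : (ℝ × ℝ) × ℝ => c.1 q.1.1 * d.1 q.2 * (c.1 q.1.2)⁻¹ :=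
    ((hc.comp (contDiff_fst.comp contDiff_fst)).mul (hd.comp contDiff_snd)).mul
      (hci.comp (contDiff_snd.comp contDiff_fst))
  -- The two occurrences of `t` in `c_t d_s c_t⁻¹` become independent, so the derivative along the
  -- diagonal is the sum of the two partial derivatives of `G`.
  let Φ : (ℝ × ℝ) → ℝ → ℝ := fun q s => h (c.1 q.1 (d.1 s ((c.1 q.2)⁻¹ x)))
  have hΦ : ContDiff ℝ ∞ fun q : (ℝ × ℝ) × ℝ => Φ q.1 q.2 := hΨ.contDiff_comp (evalMap h hh x)
  let G : ℝ × ℝ → ℝ := fun q => deriv (Φ q) 0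
  have hG : ContDiff ℝ ∞ G := by
    have : ∀ q, G q = fderiv ℝ (fun q : (ℝ × ℝ) × ℝ => Φ q.1 q.2) (q, 0) (0, 1) := fun q =>
      (((hΦ.differentiable (by simp) (q, 0)).hasFDerivAt).comp_hasDerivAt
        (f := fun s : ℝ => (q, s)) 0 ((hasDerivAt_const 0 q).prodMk (hasDerivAt_id 0))).deriv
    rw [funext this]
    exact ((hΦ.fderiv_right (m := ∞) (by simp)).comp (contDiff_id.prodMk contDiff_const)).clm_apply
      contDiff_const
  have hL := (hG.differentiable (by simp) (0, 0)).hasFDerivAt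
  set L := fderiv ℝ G (0, 0)
  have h1 : HasDerivAt (fun t : ℝ => G (t, t)) (L (1, 1)) 0 :=
    hL.comp_hasDerivAt (f := fun t : ℝ => (t, t)) 0 ((hasDerivAt_id 0).prodMk (hasDerivAt_id 0))
  have h2 : HasDerivAt (fun t : ℝ => G (t, 0)) (L (1, 0)) 0 :=
    hL.comp_hasDerivAt (f := fun t : ℝ => (t, (0 : ℝ))) 0
      ((hasDerivAt_id 0).prodMk (hasDerivAt_const 0 0))
  have h3 : HasDerivAt (fun t : ℝ => G (0, t)) (L (0, 1)) 0 :=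
    hL.comp_hasDerivAt (f := fun t : ℝ => ((0 : ℝ), t)) 0
      ((hasDerivAt_const 0 0).prodMk (hasDerivAt_id 0))
  have h4 : L (1, 1) = L (1, 0) + L (0, 1) := by rw [← map_add]; simp
  -- Exchanging the derivatives in `t` and `s` makes `c` act on `h` first and `d` on the result.
  have h5 : L (1, 0) = lieD (tangent d) (lieD (tangent c) h) x := by
    rw [← h2.deriv, lieD_tangent (contMDiff_lieD hh _)]
    simp only [lieD_tangent hh]
    have h6 : ContDiff ℝ ∞ fun q : ℝ × ℝ => h (c.1 q.1 (d.1 q.2 x)) :=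
      ((hc.comp contDiff_fst).mul (hd.comp contDiff_snd)).contDiff_comp (evalMap h hh x)
    rw [← deriv_deriv_comm (Φ := fun t s => h (c.1 t (d.1 s x))) h6]
    simp only [G, Φ, c.2, inv_one, diff_one_apply]
  have h7 : L (0, 1) = - lieD (tangent c) (lieD (tangent d) h) x := by
    rw [← h3.deriv]
    have h8 : (fun t => G (0, t)) = fun t => lieD (tangent d) h ((c.1 t)⁻¹ x) := by
      ext1 t
      rw [lieD_tangent hh]
      simp only [G, Φ, c.2, diff_one_apply]
    have h9 := lieD_add_left (contMDiff_lieD hh (tangent d)) (tangent c)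
      (tangent (hci.curve (by rw [c.2, inv_one]))) x
    -- The inverse curve represents the negative tangent vector, whence the sign of the second term.
    have h10 : tangent c + tangent (hci.curve (by rw [c.2, inv_one])) = 0 := by
      refine congrArg tangent (Subtype.ext ?_)
      have : ∀ t, c.1 t * (c.1 t)⁻¹ = 1 := fun t => mul_inv_cancel _
      change (⟨fun t => c.1 t * (c.1 t)⁻¹, _⟩ : SmoothMap ℝ (Diff (𝓡 n) M)) = ⟨fun t => 1, _⟩
      simp only [this]
    rw [h10, lieD_zero_left (contMDiff_lieD hh _), lieD_tangent (contMDiff_lieD hh _)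
      (hci.curve _)] at h9
    rw [h8]
    exact eq_neg_of_add_eq_zero_right h9.symm
  have h11 : (fun t => lieD (Ad (c.1 t) (tangent d)) h x) = fun t => G (t, t) := by
    ext1 t
    exact lieD_Ad hh c d t x
  rw [h11, sub_eq_add_neg, ← h5, ← h7, ← h4]
  exact h1

end Bracket

/-! ### The diffeological Lie group structure -/

section LieGroup

variable {n : ℕ} {M : Type u} [TopologicalSpace M]
  [ChartedSpace (EuclideanSpace ℝ (Fin n)) M] [IsManifold (𝓡 n) ∞ M]

lemma smoothLie_Ad (c : CurvesAt (1 : Diff (𝓡 n) M)) (Y : LieAlg (Diff (𝓡 n) M)) :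
    SmoothLie (fun t => Ad (c.1 t) Y) := by
  obtain ⟨d, rfl⟩ := tangent_surjective Y
  have hc := SmoothFam.of_curve c
  have hci : SmoothFam fun t => (c.1 t)⁻¹ := hc.inv
  have hΨ : SmoothFam fun q : ℝ × ℝ => c.1 q.1 * d.1 q.2 * (c.1 q.1)⁻¹ :=
    ((hc.comp contDiff_fst).mul ((SmoothFam.of_curve d).comp contDiff_snd)).mul
      (hci.comp contDiff_fst)
  exact hΨ.smoothLie fun t => by rw [d.2, mul_one, mul_inv_cancel]

variable [T2Space M] [SecondCountableTopology M]

lemma lie_ext' {V W : LieAlg (Diff (𝓡 n) M)}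
    (h : ∀ g : M → ℝ, ContMDiff (𝓡 n) 𝓘(ℝ, ℝ) ∞ g → ∀ x, lieD V g x = lieD W g x) : V = W :=
  lie_ext h

/-- The candidate is differentiated point by point: at `x` it is the derivative in the fixed space
`T_x M` of the value of `Ad_{c(t)} W`. On functions it acts as a commutator, so it is a smooth
field, and every smooth field is realized. -/
lemma exists_bracket (V W : LieAlg (Diff (𝓡 n) M)) : ∃ U : LieAlg (Diff (𝓡 n) M),
    ∀ g : M → ℝ, ContMDiff (𝓡 n) 𝓘(ℝ, ℝ) ∞ g → ∀ x,
      lieD U g x = lieD W (lieD V g) x - lieD V (lieD W g) x := by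
  obtain ⟨c, rfl⟩ := tangent_surjective V
  have hsm : ∀ x (h : M → ℝ), ContMDiff (𝓡 n) 𝓘(ℝ, ℝ) ∞ h →
      ContDiff ℝ ∞ fun t => dmap h x (vfield (Ad (c.1 t) W) x) := fun x h hh =>
    contMDiff_iff_contDiff.1 ((smoothLie_Ad c W h hh).comp (contMDiff_id.prodMk contMDiff_const))
  let ξ : M → EuclideanSpace ℝ (Fin n) := fun x => deriv (fun t => vfield (Ad (c.1 t) W) x) 0
  have hξ : ∀ g : M → ℝ, ContMDiff (𝓡 n) 𝓘(ℝ, ℝ) ∞ g → ∀ x,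
      dmap g x (ξ x) = lieD W (lieD (tangent c) g) x - lieD (tangent c) (lieD W g) x :=
    fun g hg x => (hasDerivAt_of_dmap (hsm x) 0).unique (hasDerivAt_lieD_Ad hg c W x)
  obtain ⟨U, hU⟩ := exists_vfield_eq (ξ := ξ) fun h hh => by
    simp only [hξ h hh]
    exact (contMDiff_lieD (contMDiff_lieD hh _) _).sub (contMDiff_lieD (contMDiff_lieD hh _) _)
  refine ⟨U, fun g hg x => ?_⟩
  rw [← hξ g hg x, ← hU]
  rfl

/-- The Lie bracket on the tangent space of `Diff(M)` at the identity. -/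
def bracket (V W : LieAlg (Diff (𝓡 n) M)) : LieAlg (Diff (𝓡 n) M) := (exists_bracket V W).choose

lemma lieD_bracket (V W : LieAlg (Diff (𝓡 n) M)) {g : M → ℝ} (hg : ContMDiff (𝓡 n) 𝓘(ℝ, ℝ) ∞ g)
    (x : M) : lieD (bracket V W) g x = lieD W (lieD V g) x - lieD V (lieD W g) x :=
  (exists_bracket V W).choose_spec g hg x

/-- A smooth path in the Lie algebra whose derivative at `0` on functions of `M` is given by `Z`
has velocity `Z`. -/
lemma SmoothLie.hasVelocity {γ : ℝ → LieAlg (Diff (𝓡 n) M)} (hγ : SmoothLie γ)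
    {Z : LieAlg (Diff (𝓡 n) M)} (hZ : ∀ g : M → ℝ, ContMDiff (𝓡 n) 𝓘(ℝ, ℝ) ∞ g → ∀ x,
      HasDerivAt (fun t => lieD (γ t) g x) (lieD Z g x) 0) : HasVelocity γ Z := by
  refine ⟨hγ.dSmooth, fun F => ?_⟩
  -- The deviation of `γ` from the affine path. On functions of `M` it vanishes at `t = 0` together
  -- with its first derivative.
  let δ : ℝ → LieAlg (Diff (𝓡 n) M) := fun t => γ t + ((-1 : ℝ) • γ 0 + (-t) • Z)
  have hδ : SmoothLie δ := hγ.add ((SmoothLie.const _).add ((SmoothLie.const Z).smul contDiff_neg))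
  have hδg : ∀ g : M → ℝ, ContMDiff (𝓡 n) 𝓘(ℝ, ℝ) ∞ g → ∀ t x,
      lieD (δ t) g x = lieD (γ t) g x - lieD (γ 0) g x - t * lieD Z g x := fun g hg t x => by
    simp only [δ, lieD_add_left hg, lieD_smul_left hg]
    ring
  have hδ0 : ∀ g : M → ℝ, ContMDiff (𝓡 n) 𝓘(ℝ, ℝ) ∞ g → ∀ x,
      HasDerivAt (fun t => lieD (δ t) g x) 0 0 := fun g hg x => by
    simp only [hδg g hg]
    refine (((hZ g hg x).sub_const (lieD (γ 0) g x)).fun_sub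
      ((hasDerivAt_id' (0 : ℝ)).mul_const (lieD Z g x))).congr_deriv ?_
    ring
  -- The convention `0⁻¹ = 0` gives `w 0 = 0`, which is the limit of `δ t / t`. Hadamard's lemma in
  -- a chart shows that `w` is smooth across `0`.
  let w : ℝ → LieAlg (Diff (𝓡 n) M) := fun t => t⁻¹ • δ t
  have hw0 : w 0 = 0 := by
    simp only [w, inv_zero]
    exact zero_smul ℝ _
  have hw : SmoothLie w := by
    rintro g hg ⟨t₀, x₀⟩
    set e := extChartAt (𝓡 n) x₀
    obtain ⟨r, hr, hrt, v, hv, hxv, hrv⟩ :=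
      exists_smooth_retract (isOpen_extChartAt_target (I := 𝓡 n) x₀) (mem_extChartAt_target x₀)
    have hr' : ContMDiff 𝓘(ℝ, EuclideanSpace ℝ (Fin n)) (𝓡 n) ∞ fun y => e.symm (r y) :=
      (contMDiffOn_extChartAt_symm x₀).comp_contMDiff hr.contMDiff hrt
    have hf : ContDiff ℝ ∞ fun q : ℝ × EuclideanSpace ℝ (Fin n) =>
        lieD (δ q.1) g (e.symm (r q.2)) :=
      contMDiff_iff_contDiff.1 ((hδ g hg).comp
        (contDiff_fst.contMDiff.prodMk (hr'.comp contDiff_snd.contMDiff)))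
    obtain ⟨κ, hκ, hκ_eq⟩ := exists_eq_smul_of_zero hf fun y => by
      simp only [hδg g hg]
      ring
    have hκ0 : ∀ y, κ (0, y) = 0 := fun y => by
      have h1 : HasDerivAt (fun t : ℝ => t • κ (t, y)) (κ (0, y)) 0 := by
        have h2 : DifferentiableAt ℝ (fun t : ℝ => κ (t, y)) 0 :=
          (hκ.comp (contDiff_id.prodMk contDiff_const)).differentiable (by simp) 0
        refine ((hasDerivAt_id' (0 : ℝ)).smul h2.hasDerivAt).congr_deriv ?_
        simp
      simp only [← hκ_eq] at h1
      exact h1.unique (hδ0 g hg _)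
    have hκ_w : ∀ t y, lieD (w t) g (e.symm (r y)) = κ (t, y) := fun t y => by
      rcases eq_or_ne t 0 with rfl | ht
      · rw [hw0, lieD_zero_left hg, hκ0]
      · rw [lieD_smul_left hg, hκ_eq t y, smul_eq_mul, inv_mul_cancel_left₀ ht]
    have h3 : ContMDiffAt (𝓘(ℝ, ℝ).prod (𝓡 n)) 𝓘(ℝ, ℝ × EuclideanSpace ℝ (Fin n)) ∞
        (fun q : ℝ × M => (q.1, e q.2)) (t₀, x₀) :=
      contMDiffAt_fst.prodMk_space (contMDiffAt_extChartAt.comp (t₀, x₀) contMDiffAt_snd)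
    refine (ContMDiffAt.comp (t₀, x₀) (hκ.contMDiff _) h3).congr_of_eventuallyEq ?_
    filter_upwards [continuousAt_snd.preimage_mem_nhds
      (Filter.inter_mem (extChartAt_source_mem_nhds (I := 𝓡 n) x₀)
        ((continuousAt_extChartAt x₀).preimage_mem_nhds (hv.mem_nhds hxv)))] with q hq
    rw [Function.comp_apply, ← hκ_w, hrv _ hq.2, e.left_inv hq.1]
    rfl
  -- On the diagonal `G` is `F ∘ γ`, and for first argument `0` it is `F` on the affine path. It
  -- does not depend on the first argument when the second is `0`, since `w 0 = 0`. So `G - G₀` is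
  -- constant on both axes and has zero derivative along the diagonal.
  let G : ℝ × ℝ → ℝ := fun q => F (γ 0 + q.2 • Z + q.1 • w q.2)
  let G₀ : ℝ → ℝ := fun t => F (γ 0 + t • Z)
  have hG₀ : ContDiff ℝ ∞ G₀ :=
    ((SmoothLie.const (γ 0)).add ((SmoothLie.const Z).smul contDiff_id)).contDiff_comp F
  have hG : ContDiff ℝ ∞ G :=
    (((SmoothLie.const (γ 0)).add ((SmoothLie.const Z).smul contDiff_snd)).add
      ((hw.comp contDiff_snd).smul contDiff_fst)).contDiff_comp F
  have hdiag : ∀ t, G (t, t) = F (γ t) := fun t => by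
    refine congrArg F (lie_ext' fun g hg x => ?_)
    simp only [w, lieD_add_left hg, lieD_smul_left hg, hδg g hg]
    rcases eq_or_ne t 0 with rfl | ht
    · simp
    · field_simp
      ring
  have h1 := deriv_diag_eq_zero (G := fun q => G q - G₀ q.2) (hG.sub (hG₀.comp contDiff_snd))
    (fun s => by
      have : G (s, 0) = G (0, 0) := congrArg F (lie_ext' fun g hg x => by
        simp only [hw0, lieD_add_left hg, lieD_smul_left hg, lieD_zero_left hg, mul_zero])
      simp only [this])
    (fun t => by
      have : ∀ t, G (0, t) = G₀ t := fun t => congrArg F (lie_ext' fun g hg x => by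
        simp only [lieD_add_left hg, lieD_smul_left hg, zero_mul, add_zero])
      simp only [this, sub_self])
  simp only [hdiag] at h1
  rw [deriv_fun_sub ((hγ.contDiff_comp F).differentiable (by simp) 0)
    (hG₀.differentiable (by simp) 0)] at h1
  exact sub_eq_zero.1 h1

/-- Since smooth functions on `M` separate elements of `𝔤`, each bracket identity reduces to one for
commutators of derivations. -/
theorem isDiffeologicalLieGroup_diff : IsDiffeologicalLieGroup (Diff (𝓡 n) M) where
  smooth_mul := IsDiffeologicalGroup.smooth_mul
  smooth_inv := IsDiffeologicalGroup.smooth_inv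
  smooth_add _ _ hp := isPlot_lie_iff.2 ((isPlot_lie_iff.1 hp.1).add (isPlot_lie_iff.1 hp.2))
  smooth_smul _ _ hp := isPlot_lie_iff.2 ((isPlot_lie_iff.1 hp.2).smul hp.1.contDiff)
  exists_bracket := by
    refine ⟨bracket, ?_⟩
    constructor
    · exact fun c Y => (smoothLie_Ad c Y).hasVelocity fun g hg x => by
        rw [lieD_bracket _ _ hg]
        exact hasDerivAt_lieD_Ad hg c Y x
    · intro X Y Z
      refine lie_ext' fun g hg x => ?_
      rw [lieD_add_left hg]
      simp only [lieD_bracket _ _ hg, lieD_add_left (contMDiff_lieD hg _)]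
      have : lieD (X + Y) g = fun x => lieD X g x + lieD Y g x := funext (lieD_add_left hg X Y)
      rw [this, lieD_add_right (contMDiff_lieD hg _) _ (contMDiff_lieD hg _)]
      ring
    · intro a X Y
      refine lie_ext' fun g hg x => ?_
      rw [lieD_smul_left hg]
      simp only [lieD_bracket _ _ hg, lieD_smul_left (contMDiff_lieD hg _)]
      have : lieD (a • X) g = fun x => a * lieD X g x := funext (lieD_smul_left hg a X)
      rw [this, lieD_smul_right (contMDiff_lieD hg _)]
      ring
    · intro X Y Z
      refine lie_ext' fun g hg x => ?_
      rw [lieD_add_left hg]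
      simp only [lieD_bracket _ _ hg, lieD_add_left (contMDiff_lieD hg _)]
      have : lieD (Y + Z) g = fun x => lieD Y g x + lieD Z g x := funext (lieD_add_left hg Y Z)
      rw [this, lieD_add_right (contMDiff_lieD hg _) _ (contMDiff_lieD hg _)]
      ring
    · intro a X Y
      refine lie_ext' fun g hg x => ?_
      rw [lieD_smul_left hg]
      simp only [lieD_bracket _ _ hg, lieD_smul_left (contMDiff_lieD hg _)]
      have : lieD (a • Y) g = fun x => a * lieD Y g x := funext (lieD_smul_left hg a Y)
      rw [this, lieD_smul_right (contMDiff_lieD hg _)]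
      ring
    · exact fun X => lie_ext' fun g hg x => by
        rw [lieD_bracket _ _ hg, sub_self, lieD_zero_left hg]
    · intro X Y Z
      refine lie_ext' fun g hg x => ?_
      have h1 : ∀ V W : LieAlg (Diff (𝓡 n) M), lieD (bracket V W) g =
          fun x => lieD W (lieD V g) x - lieD V (lieD W g) x :=
        fun V W => funext (lieD_bracket V W hg)
      have h2 : ∀ U V W : LieAlg (Diff (𝓡 n) M), lieD U (lieD (bracket V W) g) x =
          lieD U (lieD W (lieD V g)) x - lieD U (lieD V (lieD W g)) x := fun U V W => by
        rw [h1, lieD_sub_right (contMDiff_lieD (contMDiff_lieD hg _) _) _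
          (contMDiff_lieD (contMDiff_lieD hg _) _)]
      simp only [lieD_add_left hg, lieD_bracket _ _ hg, lieD_bracket _ _ (contMDiff_lieD hg _), h2,
        lieD_zero_left hg]
      ring
    · intro k p hp
      refine isPlot_lie_iff.2 fun g hg => ?_
      have h1 := isPlot_lie_iff.1 hp.1
      have h2 := isPlot_lie_iff.1 hp.2
      have h3 := h2.contMDiff_apply (k := fun z => lieD (p z).1 g) (h1 g hg)
      have h4 := h1.contMDiff_apply (k := fun z => lieD (p z).2 g) (h2 g hg)
      refine (h3.sub h4).congr fun q => ?_
      exact lieD_bracket _ _ hg q.2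

end LieGroup

/-! ### The diffeomorphisms of the unit interval -/

section IntervalDiffeos

lemma exp_div_sq_sub_one {u : ℝ} (hu : |u| < 1) :
    Real.exp (1 / (u ^ 2 - 1)) = expNegInvGlue (1 - u ^ 2) := by
  have h1 : 0 < 1 - u ^ 2 := by
    have := (sq_lt_one_iff_abs_lt_one u).2 hu
    linarith
  rw [expNegInvGlue, if_neg (not_le.2 h1), ← neg_sub, one_div, inv_neg]

/-- The normalizing constant of the mollifier. -/
def mollifierMass : ℝ := ∫ w in (-1 : ℝ)..1, Real.exp (1 / (w ^ 2 - 1))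

lemma contDiff_expNegInvGlue_sq : ContDiff ℝ ∞ fun w : ℝ => expNegInvGlue (1 - w ^ 2) :=
  expNegInvGlue.contDiff.comp (contDiff_const.sub (contDiff_id.pow 2))

lemma mollifierMass_eq : mollifierMass = ∫ w in (-1 : ℝ)..1, expNegInvGlue (1 - w ^ 2) :=
  intervalIntegral.integral_congr_Ioo_of_le (by norm_num) fun _ hw =>
    exp_div_sq_sub_one (abs_lt.2 hw)

/-- The unnormalized bump has maximum `e⁻¹`, so this says that the mollifier is everywhere below
`1`, which makes `c_t` strictly increasing. -/
lemma exp_neg_one_lt_mollifierMass : Real.exp (-1) < mollifierMass := by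
  have hint : ∀ a b : ℝ, IntervalIntegrable (fun w : ℝ => expNegInvGlue (1 - w ^ 2))
      MeasureTheory.volume a b := fun a b => contDiff_expNegInvGlue_sq.continuous.intervalIntegrable a b
  have h1 : ∫ w in (-(7 / 10) : ℝ)..(7 / 10), expNegInvGlue (1 - w ^ 2) ≤ mollifierMass := by
    rw [mollifierMass_eq]
    exact intervalIntegral.integral_mono_interval (by norm_num) (by norm_num) (by norm_num)
      (Filter.Eventually.of_forall fun w => expNegInvGlue.nonneg _) (hint _ _)
  -- With `q = w²` the integrand is `e⁻¹ exp(-q/(1-q))`, at least `e⁻¹ (1 - q/(1-q))`, and `q/(1-q)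
  -- ≤ q + 2q²` as long as `q ≤ 1/2`. The bound `7/10` satisfies this, and the polynomial then
  -- integrates to about `1.037`, just above `1`.
  have h2 : ∫ w in (-(7 / 10) : ℝ)..(7 / 10), Real.exp (-1) * (1 - w ^ 2 - 2 * w ^ 4) ≤
      ∫ w in (-(7 / 10) : ℝ)..(7 / 10), expNegInvGlue (1 - w ^ 2) := by
    refine intervalIntegral.integral_mono_on (by norm_num)
      (Continuous.intervalIntegrable (by fun_prop) _ _) (hint _ _) fun w hw => ?_
    have hw2 : w ^ 2 ≤ 49 / 100 := by nlinarith [hw.1, hw.2]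
    have hpos : 0 < 1 - w ^ 2 := by linarith
    rw [expNegInvGlue, if_neg (not_le.2 hpos)]
    have h3 : -(1 - w ^ 2)⁻¹ = -1 + -(w ^ 2 / (1 - w ^ 2)) := by
      field_simp
      ring
    rw [h3, Real.exp_add]
    refine mul_le_mul_of_nonneg_left ?_ (Real.exp_pos _).le
    have h4 : w ^ 2 / (1 - w ^ 2) ≤ w ^ 2 + 2 * w ^ 4 := by
      rw [div_le_iff₀ hpos]
      nlinarith [mul_nonneg (sq_nonneg (w ^ 2)) (show (0 : ℝ) ≤ 1 - 2 * w ^ 2 by linarith)]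
    have h5 := Real.add_one_le_exp (-(w ^ 2 / (1 - w ^ 2)))
    linarith
  have h6 : ∫ w in (-(7 / 10) : ℝ)..(7 / 10), Real.exp (-1) * (1 - w ^ 2 - 2 * w ^ 4) =
      Real.exp (-1) * (2 * (7 / 10 - (7 / 10) ^ 3 / 3 - 2 * (7 / 10) ^ 5 / 5)) := by
    rw [intervalIntegral.integral_const_mul, intervalIntegral.integral_sub
      (Continuous.intervalIntegrable (by fun_prop) _ _)
      (Continuous.intervalIntegrable (by fun_prop) _ _), intervalIntegral.integral_sub
      (Continuous.intervalIntegrable (by fun_prop) _ _)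
      (Continuous.intervalIntegrable (by fun_prop) _ _), intervalIntegral.integral_const_mul,
      integral_pow, integral_pow, intervalIntegral.integral_const]
    norm_num
  rw [h6] at h2
  have := Real.exp_pos (-1)
  nlinarith

lemma mollifierMass_pos : 0 < mollifierMass := (Real.exp_pos _).trans exp_neg_one_lt_mollifierMass

lemma mollifier_eq (u : ℝ) : mollifier u = expNegInvGlue (1 - u ^ 2) / mollifierMass := by
  rw [mollifier]
  split_ifs with h
  · rw [exp_div_sq_sub_one h, mollifierMass]
  · have : 1 - u ^ 2 ≤ 0 := by
      have := mt (sq_lt_one_iff_abs_lt_one u).1 h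
      linarith
    rw [expNegInvGlue.zero_of_nonpos this, zero_div]

lemma contDiff_mollifier : ContDiff ℝ ∞ mollifier := by
  rw [funext mollifier_eq]
  exact contDiff_expNegInvGlue_sq.div_const _

lemma mollifier_nonneg (u : ℝ) : 0 ≤ mollifier u := by
  rw [mollifier_eq]
  exact div_nonneg (expNegInvGlue.nonneg _) mollifierMass_pos.le

lemma mollifier_lt_one (u : ℝ) : mollifier u < 1 := by
  rw [mollifier_eq, div_lt_one mollifierMass_pos]
  refine lt_of_le_of_lt (expNegInvGlue.monotone (show 1 - u ^ 2 ≤ 1 by nlinarith [sq_nonneg u])) ?_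
  rw [expNegInvGlue, if_neg (by norm_num), inv_one]
  exact exp_neg_one_lt_mollifierMass

lemma mollifier_of_one_le_abs {u : ℝ} (hu : 1 ≤ |u|) : mollifier u = 0 := if_neg (not_lt.2 hu)

/-- The primitive of the mollifier. -/
def mollifierPrim (a : ℝ) : ℝ := ∫ u in (0 : ℝ)..a, mollifier u

lemma hasDerivAt_mollifierPrim (a : ℝ) : HasDerivAt mollifierPrim (mollifier a) a :=
  intervalIntegral.integral_hasDerivAt_right
    (contDiff_mollifier.continuous.intervalIntegrable _ _)
    (contDiff_mollifier.continuous.stronglyMeasurableAtFilter _ _)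
    contDiff_mollifier.continuous.continuousAt

lemma contDiff_mollifierPrim : ContDiff ℝ ∞ mollifierPrim := by
  rw [contDiff_infty_iff_deriv]
  refine ⟨fun a => (hasDerivAt_mollifierPrim a).differentiableAt, ?_⟩
  rw [funext fun a => (hasDerivAt_mollifierPrim a).deriv]
  exact contDiff_mollifier

lemma integral_mollifier (a b : ℝ) :
    ∫ u in a..b, mollifier u = mollifierPrim b - mollifierPrim a :=
  intervalIntegral.integral_eq_sub_of_hasDerivAt (fun x _ => hasDerivAt_mollifierPrim x)
    (contDiff_mollifier.continuous.intervalIntegrable _ _)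

lemma integral_mollifier_eq_zero {a b : ℝ} (h : ∀ u ∈ uIcc a b, 1 ≤ |u|) :
    ∫ u in a..b, mollifier u = 0 := by
  rw [intervalIntegral.integral_congr (g := fun _ => (0 : ℝ))
    fun u hu => mollifier_of_one_le_abs (h u hu)]
  simp

lemma mollifierPrim_of_one_le {a : ℝ} (ha : 1 ≤ a) : mollifierPrim a = mollifierPrim 1 := by
  have := integral_mollifier 1 a
  rw [integral_mollifier_eq_zero fun u hu => by
    rw [uIcc_of_le ha] at hu
    exact hu.1.trans (le_abs_self u)] at this
  linarith

lemma mollifierPrim_of_le_neg_one {a : ℝ} (ha : a ≤ -1) :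
    mollifierPrim a = mollifierPrim (-1) := by
  have := integral_mollifier a (-1)
  rw [integral_mollifier_eq_zero fun u hu => by
    rw [uIcc_of_le ha] at hu
    exact (le_neg.2 hu.2).trans (neg_le_abs u)] at this
  linarith

lemma mollifierPrim_sub : mollifierPrim 1 - mollifierPrim (-1) = 1 := by
  rw [← integral_mollifier, intervalIntegral.integral_congr fun u _ => mollifier_eq u,
    intervalIntegral.integral_div, ← mollifierMass_eq, div_self mollifierMass_pos.ne']

@[simp] lemma intervalPath_zero (x : ℝ) : intervalPath 0 x = x := by simp [intervalPath]

/-- Substitution turns the convolution into an increment of a primitive of the mollifier, constant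
on each side of `[-1, 1]`; the later facts about `c_t` for `t ≠ 0` are read off from this. The bound
on `t` makes `|t| ≤ 1 - |t|`. -/
lemma intervalPath_eq {t : ℝ} (h0 : t ≠ 0) (ht : |t| ≤ 1 / 2) (x : ℝ) :
    intervalPath t x =
      x + t * (mollifierPrim ((x - |t|) / |t|) - mollifierPrim ((x - 1 + |t|) / |t|)) := by
  have hα : |t| ≠ 0 := abs_ne_zero.2 h0
  rw [intervalPath, MeasureTheory.integral_Icc_eq_integral_Ioc,
    ← intervalIntegral.integral_of_le (by linarith)]
  congr 2
  have h1 : ∀ y, mollifierScaled |t| (x - y) = mollifier (x / |t| - y / |t|) / |t| := fun y => by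
    rw [mollifierScaled, sub_div]
  simp only [h1]
  rw [intervalIntegral.integral_div,
    intervalIntegral.integral_comp_sub_div (fun u => mollifier u) hα, integral_mollifier,
    smul_eq_mul, mul_div_cancel_left₀ _ hα]
  congr 2 <;> ring

variable {t x : ℝ}

lemma intervalPath_of_nonpos (ht : |t| < 1 / 2) (hx : x ≤ 0) : intervalPath t x = x := by
  rcases eq_or_ne t 0 with rfl | h0
  · exact intervalPath_zero x
  have hα := abs_pos.2 h0
  rw [intervalPath_eq h0 ht.le, mollifierPrim_of_le_neg_one (a := (x - |t|) / |t|),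
    mollifierPrim_of_le_neg_one (a := (x - 1 + |t|) / |t|), sub_self, mul_zero, add_zero]
  · rw [div_le_iff₀ hα]; linarith
  · rw [div_le_iff₀ hα]; linarith

lemma intervalPath_of_one_le (ht : |t| < 1 / 2) (hx : 1 ≤ x) : intervalPath t x = x := by
  rcases eq_or_ne t 0 with rfl | h0
  · exact intervalPath_zero x
  have hα := abs_pos.2 h0
  rw [intervalPath_eq h0 ht.le, mollifierPrim_of_one_le (a := (x - |t|) / |t|),
    mollifierPrim_of_one_le (a := (x - 1 + |t|) / |t|), sub_self, mul_zero, add_zero]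
  · rw [le_div_iff₀ hα]; linarith
  · rw [le_div_iff₀ hα]; linarith

/-- Here the support of the mollifier centred at `x` lies in the interval of integration, so the
convolution is `1`. This is what makes the path smooth at `t = 0` and gives it velocity `1`. -/
lemma intervalPath_eq_add (ht : |t| < 1 / 2) (h1 : 2 * |t| ≤ x) (h2 : x ≤ 1 - 2 * |t|) :
    intervalPath t x = x + t := by
  rcases eq_or_ne t 0 with rfl | h0
  · simp
  have hα := abs_pos.2 h0
  rw [intervalPath_eq h0 ht.le, mollifierPrim_of_one_le (a := (x - |t|) / |t|),
    mollifierPrim_of_le_neg_one (a := (x - 1 + |t|) / |t|), mollifierPrim_sub, mul_one]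
  · rw [div_le_iff₀ hα]; linarith
  · rw [le_div_iff₀ hα]; linarith

/-- For `t ≠ 0` the derivative is `1 ± (A - B)` with two mollifier values `A`, `B` in `[0, 1)`. -/
lemma exists_hasDerivAt_intervalPath (ht : |t| < 1 / 2) (x : ℝ) :
    ∃ d, 0 < d ∧ HasDerivAt (intervalPath t) d x := by
  rcases eq_or_ne t 0 with rfl | h0
  · exact ⟨1, one_pos, by simpa [funext intervalPath_zero] using hasDerivAt_id' x⟩
  have hα := abs_pos.2 h0
  have h1 : HasDerivAt (fun x => (x - |t|) / |t|) (1 / |t|) x :=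
    ((hasDerivAt_id' x).sub_const _).div_const _
  have h2 : HasDerivAt (fun x => (x - 1 + |t|) / |t|) (1 / |t|) x :=
    (((hasDerivAt_id' x).sub_const _).add_const _).div_const _
  have h3 := (hasDerivAt_id' x).fun_add ((((hasDerivAt_mollifierPrim _).comp x h1).fun_sub
    ((hasDerivAt_mollifierPrim _).comp x h2)).const_mul t)
  set A := mollifier ((x - |t|) / |t|)
  set B := mollifier ((x - 1 + |t|) / |t|)
  refine ⟨1 + t / |t| * (A - B), ?_, ?_⟩
  · have hA := mollifier_lt_one ((x - |t|) / |t|)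
    have hA0 := mollifier_nonneg ((x - |t|) / |t|)
    have hB := mollifier_lt_one ((x - 1 + |t|) / |t|)
    have hB0 := mollifier_nonneg ((x - 1 + |t|) / |t|)
    rcases abs_cases t with ⟨h, -⟩ | ⟨h, -⟩
    · rw [h, div_self h0]; simp only [A, B]; linarith
    · rw [h, div_neg, div_self h0]; simp only [A, B]; linarith
  · rw [funext fun x => intervalPath_eq h0 ht.le x]
    refine h3.congr_deriv ?_
    ring

lemma strictMono_intervalPath (ht : |t| < 1 / 2) : StrictMono (intervalPath t) :=
  strictMono_of_deriv_pos fun x => by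
    obtain ⟨d, hd, h⟩ := exists_hasDerivAt_intervalPath ht x
    rwa [h.deriv]

lemma bijOn_intervalPath (ht : |t| < 1 / 2) : BijOn (intervalPath t) (Ioo 0 1) (Ioo 0 1) := by
  have h0 := intervalPath_of_nonpos ht le_rfl
  have h1 := intervalPath_of_one_le ht le_rfl
  have hmono := strictMono_intervalPath ht
  refine ⟨fun x hx => ⟨?_, ?_⟩, hmono.injective.injOn, ?_⟩
  · simpa only [h0] using hmono hx.1
  · simpa only [h1] using hmono hx.2
  · have hc : Continuous (intervalPath t) := continuous_iff_continuousAt.2 fun x => by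
      obtain ⟨d, -, h⟩ := exists_hasDerivAt_intervalPath ht x
      exact h.continuousAt
    have := intermediate_value_Ioo zero_le_one hc.continuousOn
    rwa [h0, h1] at this

lemma isOpen_paramRect : IsOpen (Ioo (-(1 / 2) : ℝ) (1 / 2) ×ˢ Ioo (0 : ℝ) 1) :=
  isOpen_Ioo.prod isOpen_Ioo

/-- Away from `t = 0` the closed formula is smooth, as `|t|` is. Near `(0, x)` with `0 < x < 1` the
function is just `x + t`; this fails at the end points, which are therefore excluded. -/
lemma contDiffOn_intervalPath : ContDiffOn ℝ ∞ (fun q : ℝ × ℝ => intervalPath q.1 q.2)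
    (Ioo (-(1 / 2)) (1 / 2) ×ˢ Ioo 0 1) := by
  rintro ⟨t, x⟩ ⟨ht, hx⟩
  refine ContDiffAt.contDiffWithinAt ?_
  rcases eq_or_ne t 0 with rfl | h0
  · refine (contDiff_snd.add contDiff_fst).contDiffAt.congr_of_eventuallyEq
      (f := fun q : ℝ × ℝ => q.2 + q.1) ?_
    have hc1 : Continuous fun q : ℝ × ℝ => 2 * |q.1| := by fun_prop
    have h1 : ∀ᶠ q : ℝ × ℝ in 𝓝 ((0 : ℝ), x), 2 * |q.1| < q.2 :=
      (hc1.continuousAt.eventually_lt continuousAt_snd (by simpa using hx.1))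
    have h2 : ∀ᶠ q : ℝ × ℝ in 𝓝 ((0 : ℝ), x), q.2 < 1 - 2 * |q.1| :=
      (continuousAt_snd.eventually_lt (continuous_const.sub hc1).continuousAt (by simpa using hx.2))
    filter_upwards [h1, h2] with q hq1 hq2
    exact intervalPath_eq_add (by linarith) hq1.le hq2.le
  · have habs : ContDiffAt ℝ ∞ (fun q : ℝ × ℝ => |q.1|) (t, x) :=
      (contDiffAt_abs h0).comp (t, x) contDiffAt_fst
    have hα : |t| ≠ 0 := abs_ne_zero.2 h0
    have h1 : ContDiffAt ℝ ∞ (fun q : ℝ × ℝ => q.2 + q.1 * (mollifierPrim ((q.2 - |q.1|) / |q.1|) -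
        mollifierPrim ((q.2 - 1 + |q.1|) / |q.1|))) (t, x) :=
      contDiffAt_snd.add (contDiffAt_fst.mul
        ((contDiff_mollifierPrim.contDiffAt.comp (t, x) ((contDiffAt_snd.sub habs).div habs hα)).sub
        (contDiff_mollifierPrim.contDiffAt.comp (t, x)
          (((contDiffAt_snd.sub contDiffAt_const).add habs).div habs hα))))
    refine h1.congr_of_eventuallyEq ?_
    filter_upwards [continuousAt_fst.preimage_mem_nhds (Filter.inter_mem (isOpen_Ioo.mem_nhds ht)
      (isOpen_ne.mem_nhds h0))] with q hq
    exact intervalPath_eq hq.2 (abs_lt.2 hq.1).le q.2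

/-- The inverse of `intervalPath t` on the unit interval. -/
def intervalPathInv (t : ℝ) : ℝ → ℝ := Function.invFunOn (intervalPath t) (Ioo 0 1)

lemma intervalPathInv_mem (ht : |t| < 1 / 2) (hx : x ∈ Ioo (0 : ℝ) 1) :
    intervalPathInv t x ∈ Ioo (0 : ℝ) 1 :=
  Function.invFunOn_mem ((bijOn_intervalPath ht).surjOn hx)

lemma intervalPath_intervalPathInv (ht : |t| < 1 / 2) (hx : x ∈ Ioo (0 : ℝ) 1) :
    intervalPath t (intervalPathInv t x) = x :=
  Function.invFunOn_eq ((bijOn_intervalPath ht).surjOn hx)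

lemma intervalPathInv_intervalPath (ht : |t| < 1 / 2) (hx : x ∈ Ioo (0 : ℝ) 1) :
    intervalPathInv t (intervalPath t x) = x :=
  (bijOn_intervalPath ht).invOn_invFunOn.1 hx

/-- The inverse function theorem is applied to `(t, x) ↦ (t, c_t(x))`, whose derivative is
triangular with diagonal entries `1` and `d > 0`. -/
lemma contDiffOn_intervalPathInv : ContDiffOn ℝ ∞ (fun q : ℝ × ℝ => intervalPathInv q.1 q.2)
    (Ioo (-(1 / 2)) (1 / 2) ×ˢ Ioo 0 1) := by
  rintro ⟨t, y⟩ ⟨ht, hy⟩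
  refine ContDiffAt.contDiffWithinAt ?_
  set x := intervalPathInv t y
  have hx : x ∈ Ioo (0 : ℝ) 1 := intervalPathInv_mem (abs_lt.2 ht) hy
  have hxy : intervalPath t x = y := intervalPath_intervalPathInv (abs_lt.2 ht) hy
  let f : ℝ × ℝ → ℝ × ℝ := fun q => (q.1, intervalPath q.1 q.2)
  have hp : ContDiffAt ℝ ∞ (fun q : ℝ × ℝ => intervalPath q.1 q.2) (t, x) :=
    contDiffOn_intervalPath.contDiffAt (isOpen_paramRect.mem_nhds ⟨ht, hx⟩)
  have hf : ContDiffAt ℝ ∞ f (t, x) := contDiffAt_fst.prodMk hp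
  obtain ⟨d, hd, hder⟩ := exists_hasDerivAt_intervalPath (abs_lt.2 ht) x
  set L := fderiv ℝ (fun q : ℝ × ℝ => intervalPath q.1 q.2) (t, x)
  have hpL : HasFDerivAt (fun q : ℝ × ℝ => intervalPath q.1 q.2) L (t, x) :=
    (hp.differentiableAt (by simp)).hasFDerivAt
  have hfL : HasFDerivAt f ((ContinuousLinearMap.fst ℝ ℝ ℝ).prod L) (t, x) :=
    hasFDerivAt_fst.prodMk hpL
  have hL : L (0, 1) = d :=
    (hpL.comp_hasDerivAt (f := fun s : ℝ => (t, s)) x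
      ((hasDerivAt_const x t).prodMk (hasDerivAt_id x))).unique hder
  have hL2 : ∀ a b, L (a, b) = a * L (1, 0) + b * d := fun a b => by
    have : ((a, b) : ℝ × ℝ) = a • (1, 0) + b • (0, 1) := by simp
    rw [this, map_add, map_smul, map_smul, hL, smul_eq_mul, smul_eq_mul]
  have hbij : Function.Bijective (mfderiv 𝓘(ℝ, ℝ × ℝ) 𝓘(ℝ, ℝ × ℝ) f (t, x)) := by
    rw [mfderiv_eq_fderiv, hfL.fderiv]
    constructor
    · rintro ⟨a, b⟩ ⟨a', b'⟩ h
      have h1 : a = a' := congrArg Prod.fst h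
      have h2 : L (a, b) = L (a', b') := congrArg Prod.snd h
      rw [h1, hL2 a' b, hL2 a' b'] at h2
      have h3 : b = b' := by
        have := add_left_cancel h2
        exact mul_right_cancel₀ hd.ne' this
      rw [h1, h3]
    · rintro ⟨a, b⟩
      refine ⟨(a, (b - a * L (1, 0)) / d), Prod.ext rfl ?_⟩
      change L (a, (b - a * L (1, 0)) / d) = b
      rw [hL2, div_mul_cancel₀ _ hd.ne']
      ring
  obtain ⟨g, hg, hgx, hfg, -⟩ := exists_localInverse_of_bijective_mfderiv
    (contMDiffAt_iff_contDiffAt.2 hf) hbij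
  have hfx : f (t, x) = (t, y) := by simp only [f, hxy]
  rw [hfx] at hg hgx hfg
  have hgc : ContinuousAt g (t, y) := hg.continuousAt
  have hmem : ∀ᶠ q in 𝓝 (t, y), g q ∈ Ioo (-(1 / 2) : ℝ) (1 / 2) ×ˢ Ioo (0 : ℝ) 1 :=
    hgc.preimage_mem_nhds (by rw [hgx]; exact isOpen_paramRect.mem_nhds ⟨ht, hx⟩)
  refine (contDiffAt_snd.comp (t, y) (contMDiffAt_iff_contDiffAt.1 hg)).congr_of_eventuallyEq ?_
  filter_upwards [hfg, hmem] with q hq hqm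
  have h1 : (f (g q)).1 = q.1 := congrArg Prod.fst hq
  have h2 : (f (g q)).2 = q.2 := congrArg Prod.snd hq
  simp only [f] at h1 h2
  rw [← h2, ← h1, intervalPathInv_intervalPath (abs_lt.2 hqm.1) hqm.2]
  rfl

end IntervalDiffeos

/-! ### Transporting the interval path along a thick path -/

section ThickPaths

variable {n k : ℕ} {M : Type u} [TopologicalSpace M]
  [ChartedSpace (EuclideanSpace ℝ (Fin n)) M]

/-- Injectivity on `U` gives one global inverse, and near each image point it coincides with the
smooth local inverse. -/
lemma isSmoothParam_of_injOn {W : Type*} [NormedAddCommGroup W] [NormedSpace ℝ W]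
    [CompleteSpace W] {T : W → M} {U : Set W} (hU : IsOpen U)
    (hT : ContMDiffOn 𝓘(ℝ, W) (𝓡 n) ∞ T U) (hinj : InjOn T U)
    (hbij : ∀ w ∈ U, Function.Bijective (mfderiv 𝓘(ℝ, W) (𝓡 n) T w)) [IsManifold (𝓡 n) ∞ M] :
    ∃ S, IsSmoothParam (n := n) T S U := by
  classical
  let S : M → W := Function.invFunOn T U
  have hS : ∀ w ∈ U, S (T w) = w := fun w hw => hinj.leftInvOn_invFunOn hw
  have key : ∀ w ∈ U, (∀ᶠ y in 𝓝 (T w), y ∈ T '' U) ∧ ContMDiffAt (𝓡 n) 𝓘(ℝ, W) ∞ S (T w) := by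
    intro w hw
    obtain ⟨g, hg, hgw, hTg, -⟩ := exists_localInverse_of_bijective_mfderiv
      (hT.contMDiffAt (hU.mem_nhds hw)) (hbij w hw)
    have hgc : ContinuousAt g (T w) := hg.continuousAt
    have hgU : ∀ᶠ y in 𝓝 (T w), g y ∈ U :=
      hgc.preimage_mem_nhds (by rw [hgw]; exact hU.mem_nhds hw)
    refine ⟨?_, hg.congr_of_eventuallyEq ?_⟩
    · filter_upwards [hTg, hgU] with y h1 h2
      exact ⟨g y, h2, h1⟩
    · filter_upwards [hTg, hgU] with y h1 h2
      rw [← hS (g y) h2, h1]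
  refine ⟨S, hU, ?_, hT, ?_, hS⟩
  · rw [isOpen_iff_eventually]
    rintro _ ⟨w, hw, rfl⟩
    exact (key w hw).1
  · rintro _ ⟨w, hw, rfl⟩
    exact (key w hw).2.contMDiffWithinAt

lemma isOpen_tubeDomain : IsOpen (tubeDomain k) := isOpen_Ioo.prod Metric.isOpen_ball

lemma IsThickPath.exists_isSmoothParam [IsManifold (𝓡 n) ∞ M]
    {T : ℝ × EuclideanSpace ℝ (Fin k) → M} (hT : IsThickPath (n := n) T) :
    ∃ S, IsSmoothParam (n := n) T S (tubeDomain k) := by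
  refine isSmoothParam_of_injOn isOpen_tubeDomain hT.smooth
    (injOn_iff_injective.2 hT.embedding.injective) fun w hw => ?_
  have hdim : Module.finrank ℝ (ℝ × EuclideanSpace ℝ (Fin k)) =
      Module.finrank ℝ (EuclideanSpace ℝ (Fin n)) := by
    rw [Module.finrank_prod, Module.finrank_self, finrank_euclideanSpace_fin,
      finrank_euclideanSpace_fin, hT.codim_zero, add_comm]
  let A : (ℝ × EuclideanSpace ℝ (Fin k)) →L[ℝ] EuclideanSpace ℝ (Fin n) :=
    mfderiv 𝓘(ℝ, ℝ × EuclideanSpace ℝ (Fin k)) (𝓡 n) T w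
  have hA : Function.Injective A := hT.immersion w hw
  exact ⟨hA, (LinearMap.injective_iff_surjective_of_finrank_eq_finrank (f := A.toLinearMap) hdim).1 hA⟩

/-- The norm fails to be smooth only at `0`, near which the cutoff is constant. -/
lemma IsCutoff.contDiff_norm {φ : ℝ → ℝ} (hφ : IsCutoff φ) :
    ContDiff ℝ ∞ fun y : EuclideanSpace ℝ (Fin k) => φ ‖y‖ := by
  rw [contDiff_iff_contDiffAt]
  intro y
  rcases eq_or_ne y 0 with rfl | hy
  · refine (contDiffAt_const (c := (1 : ℝ))).congr_of_eventuallyEq ?_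
    exact (continuous_norm.tendsto' (0 : EuclideanSpace ℝ (Fin k)) 0 norm_zero).eventually hφ.eq_one
  · exact hφ.smooth.contDiffAt.comp y (contDiffAt_norm ℝ hy)

/-- A smooth function of values in `]-1/2, 1/2[` which is the identity on `[-1/4, 1/4]`. -/
lemma exists_bounded_time : ∃ θ : ℝ → ℝ, ContDiff ℝ ∞ θ ∧ (∀ t, |t| ≤ 1 / 4 → θ t = t) ∧
    ∀ t, |θ t| < 1 / 2 := by
  let b : ContDiffBump (0 : ℝ) := ⟨1 / 4, 1 / 2, by norm_num, by norm_num⟩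
  refine ⟨fun t => b t * t, b.contDiff.mul contDiff_id, fun t ht => ?_, fun t => ?_⟩
  · have := b.one_of_mem_closedBall (x := t) (by simpa [b] using ht)
    simp only [this, one_mul]
  · rcases lt_or_ge |t| (1 / 2) with ht | ht
    · rw [abs_mul, abs_of_nonneg b.nonneg]
      calc b t * |t| ≤ 1 * |t| := by gcongr; exact b.le_one
        _ < 1 / 2 := by rwa [one_mul]
    · have := b.zero_of_le_dist (x := t) (by simpa [b] using ht)
      simp [this]

lemma velocity_comp_add {f : ℝ → M} {x s : ℝ} (hf : MDifferentiableAt 𝓘(ℝ, ℝ) (𝓡 n) f (x + s)) :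
    velocity (n := n) (fun t => f (x + t)) s = velocity (n := n) f (x + s) := by
  have h1 : HasDerivAt (fun t => x + t) 1 s := (hasDerivAt_id' s).const_add x
  have h2 := hf.hasMFDerivAt.comp s h1.hasFDerivAt.hasMFDerivAt
  have h3 := congrArg (fun L : ℝ →L[ℝ] EuclideanSpace ℝ (Fin n) => L 1) h2.mfderiv
  refine h3.trans ?_
  let B : ℝ →L[ℝ] EuclideanSpace ℝ (Fin n) := mfderiv 𝓘(ℝ, ℝ) (𝓡 n) f (x + s)
  change B ((ContinuousLinearMap.toSpanSingleton ℝ (1 : ℝ)) 1) = B 1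
  simp

lemma velocity_congr {f g : ℝ → M} {t : ℝ} (h : f =ᶠ[𝓝 t] g) :
    velocity (n := n) f t = velocity (n := n) g t := by
  have := h.mfderiv_eq (I := 𝓘(ℝ, ℝ)) (I' := 𝓡 n)
  exact congrArg (fun L : ℝ →L[ℝ] EuclideanSpace ℝ (Fin n) => L 1) this

variable [IsManifold (𝓡 n) ∞ M]

/-- The velocity field of a path in `Diff(M)` is smooth. -/
lemma contMDiff_velocityField (C : CurvesAt (1 : Diff (𝓡 n) M)) :
    ContMDiff (𝓡 n) (𝓡 n).tangent ∞
      (fun x => (⟨x, velocityField (𝓡 n) C x⟩ : TangentBundle (𝓡 n) M)) := by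
  have hC : ContMDiff (𝓘(ℝ, ℝ).prod (𝓡 n)) (𝓡 n) ∞ (fun q : ℝ × M => C.1 q.1 q.2) :=
    SmoothFam.of_curve C
  -- The field is the tangent map of `(t, x) ↦ C_t(x)` applied to the smooth section `x ↦ (∂_t, 0)`
  -- at `t = 0`.
  have h1 := hC.contMDiff_tangentMap (m := ∞) (by simp)
  have h2 : ContMDiff (𝓡 n) (𝓘(ℝ, ℝ).tangent.prod (𝓡 n).tangent) ∞
      (fun x : M => ((⟨0, (1 : ℝ)⟩ : TangentBundle 𝓘(ℝ, ℝ) ℝ),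
        (⟨x, 0⟩ : TangentBundle (𝓡 n) M))) :=
    contMDiff_const.prodMk (Bundle.contMDiff_zeroSection ℝ (TangentSpace (𝓡 n) : M → Type _))
  have h3 := h1.comp (contMDiff_equivTangentBundleProd_symm.comp h2)
  refine h3.congr fun x => ?_
  have h0 : C.1 0 x = x := by rw [C.2, diff_one_apply]
  have h4 : velocity (n := n) (fun t => C.1 t x) 0 =
      (mfderiv (𝓘(ℝ, ℝ).prod (𝓡 n)) (𝓡 n) (fun q : ℝ × M => C.1 q.1 q.2) (0, x) :
        (ℝ × EuclideanSpace ℝ (Fin n)) →L[ℝ] EuclideanSpace ℝ (Fin n)) (1, 0) := by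
    have h5 : HasMFDerivAt 𝓘(ℝ, ℝ) (𝓘(ℝ, ℝ).prod (𝓡 n)) (fun t : ℝ => (t, x)) 0 _ :=
      (hasMFDerivAt_id (I := 𝓘(ℝ, ℝ)) (0 : ℝ)).prodMk
        (hasMFDerivAt_const (I := 𝓘(ℝ, ℝ)) (I' := 𝓡 n) x (0 : ℝ))
    have h6 := ((hC (0, x)).mdifferentiableAt (by simp)).hasMFDerivAt.comp (0 : ℝ) h5
    exact congrArg (fun L : ℝ →L[ℝ] EuclideanSpace ℝ (Fin n) => L 1) h6.mfderiv
  refine Bundle.TotalSpace.ext h0.symm (heq_of_eq ?_)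
  exact h4

/-- The path of diffeomorphisms transported along a thick path. -/
theorem IsThickPath.exists_transported {T : ℝ × EuclideanSpace ℝ (Fin k) → M}
    (hT : IsThickPath (n := n) T) {φ : ℝ → ℝ} (hφ : IsCutoff φ) :
    ∃ C : CurvesAt (1 : Diff (𝓡 n) M), IsTransported T φ C ∧
      ∀ x ∈ Ioo (0 : ℝ) 1, velocityField (𝓡 n) C (T (x, 0)) =
        mfderiv 𝓘(ℝ, ℝ) (𝓡 n) (fun s : ℝ => T (s, 0)) x (1 : ℝ) := by
  obtain ⟨S, hS⟩ := hT.exists_isSmoothParam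
  -- The path must be defined for all real times, while `c_t` is controlled only for `|t| < 1/2`.
  -- The reparametrization `θ` stays in this range and is the identity for `|t| ≤ 1/4`.
  obtain ⟨θ, hθ, hθid, hθlt⟩ := exists_bounded_time
  obtain ⟨a, ha, hφa⟩ := hφ.eq_zero
  have hlt : ∀ t r, |φ r * θ t| < 1 / 2 := fun t r => by
    rw [abs_mul, abs_of_nonneg (hφ.mem_Icc r).1]
    calc φ r * |θ t| ≤ 1 * |θ t| := by gcongr; exact (hφ.mem_Icc r).2
      _ < 1 / 2 := by rw [one_mul]; exact hθlt t
  let g : ℝ → ℝ × EuclideanSpace ℝ (Fin k) → ℝ × EuclideanSpace ℝ (Fin k) := fun t w =>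
    (intervalPath (φ ‖w.2‖ * θ t) w.1, w.2)
  let g' : ℝ → ℝ × EuclideanSpace ℝ (Fin k) → ℝ × EuclideanSpace ℝ (Fin k) := fun t w =>
    (intervalPathInv (φ ‖w.2‖ * θ t) w.1, w.2)
  have hg : ContDiffOn ℝ ∞ (fun q : ℝ × (ℝ × EuclideanSpace ℝ (Fin k)) => g q.1 q.2)
      (univ ×ˢ tubeDomain k) := by
    refine ContDiffOn.prodMk (contDiffOn_intervalPath.comp (g := fun q : ℝ × ℝ => intervalPath q.1 q.2)
      (f := fun q : ℝ × (ℝ × EuclideanSpace ℝ (Fin k)) => (φ ‖q.2.2‖ * θ q.1, q.2.1))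
      ?_ fun q hq => ⟨abs_lt.1 (hlt _ _), hq.2.1⟩) (contDiff_snd.comp contDiff_snd).contDiffOn
    exact (((hφ.contDiff_norm.comp (contDiff_snd.comp contDiff_snd)).mul
      (hθ.comp contDiff_fst)).prodMk (contDiff_fst.comp contDiff_snd)).contDiffOn
  have hg' : ∀ t, ContDiffOn ℝ ∞ (g' t) (tubeDomain k) := by
    intro t
    refine ContDiffOn.prodMk (contDiffOn_intervalPathInv.comp
      (g := fun q : ℝ × ℝ => intervalPathInv q.1 q.2)
      (f := fun q : ℝ × EuclideanSpace ℝ (Fin k) => (φ ‖q.2‖ * θ t, q.1))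
      ?_ fun q hq => ⟨abs_lt.1 (hlt _ _), hq.1⟩) contDiff_snd.contDiffOn
    exact (((hφ.contDiff_norm.comp contDiff_snd).mul contDiff_const).prodMk contDiff_fst).contDiffOn
  obtain ⟨A, hA, hAT, hAid⟩ := exists_transport hS
    (K := Ioo 0 1 ×ˢ Metric.closedBall (0 : EuclideanSpace ℝ (Fin k)) a)
    (prod_mono_right (Metric.closedBall_subset_ball ha)) (hT.closed a ha) hg hg'
    (fun t w hw => ⟨(bijOn_intervalPath (hlt _ _)).mapsTo hw.1, hw.2⟩)
    (fun t w hw => ⟨intervalPathInv_mem (hlt _ _) hw.1, hw.2⟩)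
    (fun t w hw hwK => by
      have : φ ‖w.2‖ = 0 := hφa _ (by
        rw [abs_norm]
        by_contra h
        exact hwK ⟨hw.1, mem_closedBall_zero_iff.2 (not_le.1 h).le⟩)
      simp only [g, this, zero_mul, intervalPath_zero])
    (fun t w hw => Prod.ext (intervalPathInv_intervalPath (hlt _ _) hw.1) rfl)
    (fun t w hw => Prod.ext (intervalPath_intervalPathInv (hlt _ _) hw.1) rfl)
  have hsub : T '' (Ioo 0 1 ×ˢ Metric.closedBall (0 : EuclideanSpace ℝ (Fin k)) a) ⊆
      T '' tubeDomain k := image_mono (prod_mono_right (Metric.closedBall_subset_ball ha))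
  have hA0 : A 0 = 1 := by
    refine Diffeomorph.ext fun x => ?_
    by_cases hx : x ∈ T '' tubeDomain k
    · obtain ⟨w, hw, rfl⟩ := hx
      rw [hAT 0 w hw, diff_one_apply]
      simp only [g, hθid 0 (by norm_num), mul_zero, intervalPath_zero]
    · exact hAid 0 x fun h => hx (hsub h)
  refine ⟨hA.curve hA0, fun t ht => ⟨fun z hz => ?_, fun p hp => hAid t p fun h => hp (hsub h)⟩,
    fun x hx => ?_⟩
  · refine (hAT t z hz).trans ?_
    simp only [g, hθid t ht.le]
  · have hφ0 : φ 0 = 1 := hφ.eq_one.self_of_nhds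
    have hmem : ∀ s ∈ Ioo (0 : ℝ) 1, ((s, 0) : ℝ × EuclideanSpace ℝ (Fin k)) ∈ tubeDomain k :=
      fun s hs => ⟨hs, Metric.mem_ball_self one_pos⟩
    -- On the axis the cutoff is `1`, and for `t` small compared with the distance of `x` to the end
    -- points `c_t` is translation by `t`.
    have hev : (fun t => A t (T (x, 0))) =ᶠ[𝓝 0] fun t => T (x + t, 0) := by
      have h1 : Continuous fun t : ℝ => 2 * |t| := by fun_prop
      have h2 : ∀ᶠ t : ℝ in 𝓝 0, 2 * |t| < x :=
        h1.continuousAt.eventually_lt continuousAt_const (by simpa using hx.1)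
      have h3 : ∀ᶠ t : ℝ in 𝓝 0, 2 * |t| < 1 - x :=
        h1.continuousAt.eventually_lt continuousAt_const (by simpa using hx.2)
      have h4 : ∀ᶠ t : ℝ in 𝓝 0, |t| < 1 / 4 :=
        continuous_abs.continuousAt.eventually_lt continuousAt_const (by simp)
      filter_upwards [h2, h3, h4] with t h2 h3 h4
      rw [hAT t _ (hmem x hx)]
      simp only [g, norm_zero, hφ0, hθid t h4.le, one_mul,
        intervalPath_eq_add (h4.trans (by norm_num)) h2.le (by linarith)]
    have hsm : MDifferentiableAt 𝓘(ℝ, ℝ) (𝓡 n) (fun s : ℝ => T (s, 0)) (x + 0) := by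
      rw [add_zero]
      refine ContMDiffAt.mdifferentiableAt (n := ∞) ?_ (by simp)
      exact ContMDiffAt.comp x (hT.smooth.contMDiffAt (isOpen_tubeDomain.mem_nhds (hmem x hx)))
        (contDiff_id.prodMk contDiff_const).contMDiff.contMDiffAt
    have h5 := (velocity_congr (n := n) hev).trans (velocity_comp_add hsm)
    rw [add_zero] at h5
    exact h5

end ThickPaths

/-! ### Integral curves running off the end of a thick path -/

section Escape

variable {n k : ℕ} {M : Type u} [TopologicalSpace M] [T2Space M]
  [ChartedSpace (EuclideanSpace ℝ (Fin n)) M] [IsManifold (𝓡 n) ∞ M]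

/-- An integral curve of a vector field tangent to a thick path leaves every compact set while
following the thick path. -/
theorem IsThickPath.not_isMIntegralCurveOn {T : ℝ × EuclideanSpace ℝ (Fin k) → M}
    (hT : IsThickPath (n := n) T) {X : (x : M) → TangentSpace (𝓡 n) x}
    (hX : ContMDiff (𝓡 n) (𝓡 n).tangent ∞ (fun x => (⟨x, X x⟩ : TangentBundle (𝓡 n) M)))
    (hXT : ∀ x ∈ Ioo (0 : ℝ) 1,
      X (T (x, 0)) = mfderiv 𝓘(ℝ, ℝ) (𝓡 n) (fun s : ℝ => T (s, 0)) x (1 : ℝ))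
    {γ : ℝ → M} {a b t₀ : ℝ} (ha : a < t₀) (ha' : t₀ - 1 / 2 ≤ a) (hb : t₀ + 1 / 2 < b)
    (hγ : IsMIntegralCurveOn (I := 𝓡 n) γ X (Ioo a b)) (h₀ : γ t₀ = T (1 / 2, 0)) : False := by
  have hmem : ∀ s ∈ Ioo (0 : ℝ) 1, ((s, 0) : ℝ × EuclideanSpace ℝ (Fin k)) ∈ tubeDomain k :=
    fun s hs => ⟨hs, Metric.mem_ball_self one_pos⟩
  have he : IsMIntegralCurveOn (I := 𝓡 n) (fun s : ℝ => T (s, 0)) X (Ioo 0 1) := by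
    intro s hs
    have hd : MDifferentiableAt 𝓘(ℝ, ℝ) (𝓡 n) (fun s : ℝ => T (s, 0)) s := by
      refine ContMDiffAt.mdifferentiableAt (n := ∞) ?_ (by simp)
      exact ContMDiffAt.comp s (hT.smooth.contMDiffAt (isOpen_tubeDomain.mem_nhds (hmem s hs)))
        (contDiff_id.prodMk contDiff_const).contMDiff.contMDiffAt
    have h1 := hd.hasMFDerivAt
    refine HasMFDerivAt.hasMFDerivWithinAt ?_
    let B : ℝ →L[ℝ] EuclideanSpace ℝ (Fin n) := mfderiv 𝓘(ℝ, ℝ) (𝓡 n) (fun s : ℝ => T (s, 0)) s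
    let v : EuclideanSpace ℝ (Fin n) := X (T (s, 0))
    have hv : v = B 1 := hXT s hs
    have h2 : (1 : ℝ →L[ℝ] ℝ).smulRight v = B := by
      ext1
      simp [hv]
    exact (congrArg (fun L : ℝ →L[ℝ] EuclideanSpace ℝ (Fin n) =>
      HasMFDerivAt 𝓘(ℝ, ℝ) (𝓡 n) (fun s : ℝ => T (s, 0)) s L) h2).mpr h1
  have he' : IsMIntegralCurveOn (I := 𝓡 n) (fun s : ℝ => T (s + (1 / 2 - t₀), 0)) X
      (Ioo a (t₀ + 1 / 2)) := by
    refine (he.comp_add (1 / 2 - t₀)).mono fun s hs => ?_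
    constructor
    · linarith [hs.1]
    · linarith [hs.2]
  -- By uniqueness, which needs `M` Hausdorff, `γ` follows the axis with unit speed. Starting from
  -- its midpoint it reaches the end at time `t₀ + 1/2`, still in the domain of `γ`.
  have heq : EqOn γ (fun s : ℝ => T (s + (1 / 2 - t₀), 0)) (Ioo a (t₀ + 1 / 2)) :=
    isMIntegralCurveOn_Ioo_eqOn_of_contMDiff_boundaryless (I := 𝓡 n) (t₀ := t₀)
      ⟨ha, by linarith⟩ (hX.of_le (by simp)) (hγ.mono (Ioo_subset_Ioo_right hb.le)) he'
      (by simp only [h₀]; congr 2; ring)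
  have hγc : ContinuousAt γ (t₀ + 1 / 2) :=
    hγ.continuousOn.continuousAt (Ioo_mem_nhds (by linarith) hb)
  have hlim : Filter.Tendsto (fun s : ℝ => T (s + (1 / 2 - t₀), 0)) (𝓝[<] (t₀ + 1 / 2))
      (𝓝 (γ (t₀ + 1 / 2))) := by
    refine (hγc.tendsto.mono_left nhdsWithin_le_nhds).congr' ?_
    filter_upwards [Ioo_mem_nhdsLT (show a < t₀ + 1 / 2 by linarith)] with s hs
    exact heq hs
  have hIoo : ∀ᶠ s in 𝓝[<] (t₀ + 1 / 2), s + (1 / 2 - t₀) ∈ Ioo (0 : ℝ) 1 := by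
    filter_upwards [Ioo_mem_nhdsLT (show t₀ < t₀ + 1 / 2 by linarith)] with s hs
    constructor <;> linarith [hs.1, hs.2]
  -- The axis is closed, so the limit of `γ` at `t₀ + 1/2` is a point `e(r)` with `r < 1`. By
  -- continuity of the inverse parametrization the axis parameter tends to `r`, whereas it visibly
  -- tends to `1`.
  have hclosed := hT.closed 0 one_pos
  have hlim_mem : γ (t₀ + 1 / 2) ∈ T '' (Ioo 0 1 ×ˢ Metric.closedBall 0 0) :=
    hclosed.mem_of_tendsto hlim (hIoo.mono fun s hs =>
      ⟨(s + (1 / 2 - t₀), 0), ⟨hs, Metric.mem_closedBall_self le_rfl⟩, rfl⟩)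
  obtain ⟨⟨r, y⟩, ⟨hr, hy⟩, hry⟩ := hlim_mem
  rw [Metric.closedBall_zero, mem_singleton_iff] at hy
  dsimp only at hr hy
  subst hy
  obtain ⟨S, hS⟩ := hT.exists_isSmoothParam
  have hSc : ContinuousAt S (T (r, 0)) :=
    (hS.contMDiffOn_symm.contMDiffAt (hS.isOpen_image.mem_nhds ⟨_, hmem r hr, rfl⟩)).continuousAt
  rw [← hry] at hlim
  have h3 := hSc.tendsto.comp hlim
  rw [hS.left_inv _ (hmem r hr)] at h3
  have h4 : Filter.Tendsto (fun s : ℝ => s + (1 / 2 - t₀)) (𝓝[<] (t₀ + 1 / 2)) (𝓝 r) := by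
    refine ((continuous_fst.tendsto _).comp h3).congr' ?_
    filter_upwards [hIoo] with s hs
    simp only [Function.comp_apply, hS.left_inv _ (hmem _ hs)]
  have h5 : Filter.Tendsto (fun s : ℝ => s + (1 / 2 - t₀)) (𝓝[<] (t₀ + 1 / 2)) (𝓝 1) :=
    ((continuous_id.add continuous_const).tendsto' _ _ (by simp; ring)).mono_left nhdsWithin_le_nhds
  exact hr.2.ne (tendsto_nhds_unique h4 h5)

end Escape

/-! ### No global flow and no solution of the equation -/

section NoSolution

variable {n k : ℕ} {M : Type u} [TopologicalSpace M] [T2Space M]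
  [ChartedSpace (EuclideanSpace ℝ (Fin n)) M] [IsManifold (𝓡 n) ∞ M]

/-- Smoothness on `[0, 1]` is tested by smooth maps into the interval. A map `ℝ → ]0, 1[` equal to
the identity near `t` thus produces a genuine smooth family over `ℝ`. -/
lemma smoothMap_Icc_smoothFam (g : SmoothMap (Icc (0 : ℝ) 1) (Diff (𝓡 n) M)) {t : ℝ}
    (ht : t ∈ Ioo (0 : ℝ) 1) : ∃ a : ℝ → Diff (𝓡 n) M, SmoothFam a ∧
      ∀ᶠ s in 𝓝 t, g (projIcc 0 1 zero_le_one s) = a s := by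
  obtain ⟨ε, hε, hεs⟩ := Metric.isOpen_iff.1 isOpen_Ioo t ht
  obtain ⟨τ, hτ, -, hτid, hτlt, -⟩ := exists_time_cutoff hε
  have hmem : ∀ s, t + τ (s - t) ∈ Icc (0 : ℝ) 1 := fun s =>
    Ioo_subset_Icc_self (hεs (by simpa [Real.dist_eq] using hτlt (s - t)))
  have hκ : ContDiff ℝ ∞ fun s => t + τ (s - t) :=
    contDiff_const.add (hτ.comp (contDiff_id.sub contDiff_const))
  let κ : ℝ → Icc (0 : ℝ) 1 := fun s => ⟨t + τ (s - t), hmem s⟩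
  have hκs : DSmooth κ := fun m p hp => hκ.dSmooth m p hp
  refine ⟨fun s => g (κ s), dSmooth_diff_iff.1 (g.smooth.comp hκs), ?_⟩
  have h1 : ∀ᶠ s in 𝓝 t, τ (s - t) = s - t :=
    ((continuous_id.sub continuous_const).tendsto' t 0 (sub_self t)).eventually hτid
  filter_upwards [h1, isOpen_Ioo.mem_nhds ht] with s hs hs'
  congr 1
  refine (projIcc_of_mem zero_le_one (Ioo_subset_Icc_self hs')).trans (Subtype.ext ?_)
  simp [κ, hs]

/-- A solution of the differential equation for a constant path in the Lie algebra gives integral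
curves of the velocity field. -/
lemma IsSolution.isMIntegralCurveOn {C : CurvesAt (1 : Diff (𝓡 n) M)}
    {g : SmoothMap (Icc (0 : ℝ) 1) (Diff (𝓡 n) M)}
    (hg : IsSolution ⟨fun _ => tangent C, dSmooth_const⟩ g) (x : M) :
    IsMIntegralCurveOn (I := 𝓡 n) (fun s : ℝ => g (projIcc 0 1 zero_le_one s) x)
      (velocityField (𝓡 n) C) (Ioo 0 1) := by
  intro t ht
  obtain ⟨a, ha, hga⟩ := smoothMap_Icc_smoothFam g ht
  refine HasMFDerivAt.hasMFDerivWithinAt ?_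
  set γ : ℝ → M := fun s => g (projIcc 0 1 zero_le_one s) x
  have hγa : γ =ᶠ[𝓝 t] fun s => a s x := hga.mono fun s hs => congrArg (fun φ : Diff (𝓡 n) M => φ x) hs
  have hd : MDifferentiableAt 𝓘(ℝ, ℝ) (𝓡 n) γ t :=
    (((ha.contMDiff_orbit x) t).mdifferentiableAt (by simp)).congr_of_eventuallyEq hγa
  have htI : t ∈ Icc (0 : ℝ) 1 := Ioo_subset_Icc_self ht
  have hproj : projIcc 0 1 zero_le_one t = ⟨t, htI⟩ := projIcc_of_mem _ htI
  have h0 : C.1 0 (γ t) = γ t := by rw [C.2, diff_one_apply]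
  have hv : velocity (n := n) γ t = velocity (n := n) (fun s => C.1 s (γ t)) 0 := by
    refine eq_of_dmap_eq (x := γ t) fun h hh => ?_
    have h1 := hasDerivAt_comp_curve hd ((hh (γ t)).mdifferentiableAt (by simp))
    have h2 := hasDerivAt_comp_curve (t := 0)
      (((SmoothFam.of_curve C).contMDiff_orbit (γ t) 0).mdifferentiableAt (by simp))
      ((hh (C.1 0 (γ t))).mdifferentiableAt (by simp))
    rw [h0] at h2
    -- The equation is tested on evaluation at the point `γ t`: since `g(t)⁻¹ (γ t) = x`, the tested
    -- path `g(s) g(t)⁻¹ (γ t)` is `γ s`.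
    have h3 := (hg.2 ⟨t, htI⟩ (evalMap h hh (γ t))).hasDerivAt (Icc_mem_nhds ht.1 ht.2)
    have h4 : (fun s : ℝ => evalMap h hh (γ t) (g (projIcc 0 1 zero_le_one s) * (g ⟨t, htI⟩)⁻¹)) =
        fun s => h (γ s) := by
      ext1 s
      change h (g (projIcc 0 1 zero_le_one s) ((g ⟨t, htI⟩)⁻¹ (γ t))) = h (γ s)
      simp only [γ, hproj, diff_inv_apply_self]
    rw [h4] at h3
    exact (h1.unique h3).trans h2.deriv
  have h5 := hd.hasMFDerivAt
  let B : ℝ →L[ℝ] EuclideanSpace ℝ (Fin n) := mfderiv 𝓘(ℝ, ℝ) (𝓡 n) γ t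
  let w : EuclideanSpace ℝ (Fin n) := velocityField (𝓡 n) C (γ t)
  have hw : w = B 1 := hv.symm
  have h6 : (1 : ℝ →L[ℝ] ℝ).smulRight w = B := by
    ext1
    simp [hw]
  exact (congrArg (fun L : ℝ →L[ℝ] EuclideanSpace ℝ (Fin n) =>
    HasMFDerivAt 𝓘(ℝ, ℝ) (𝓡 n) γ t L) h6).mpr h5

theorem IsThickPath.not_hasGlobalFlow {T : ℝ × EuclideanSpace ℝ (Fin k) → M}
    (hT : IsThickPath (n := n) T) {X : (x : M) → TangentSpace (𝓡 n) x}
    (hX : ContMDiff (𝓡 n) (𝓡 n).tangent ∞ (fun x => (⟨x, X x⟩ : TangentBundle (𝓡 n) M)))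
    (hXT : ∀ x ∈ Ioo (0 : ℝ) 1,
      X (T (x, 0)) = mfderiv 𝓘(ℝ, ℝ) (𝓡 n) (fun s : ℝ => T (s, 0)) x (1 : ℝ)) :
    ¬ HasGlobalFlow (𝓡 n) X := by
  rintro ⟨Φ, hΦ⟩
  obtain ⟨h0, hc⟩ := hΦ (T (1 / 2, 0))
  exact hT.not_isMIntegralCurveOn hX hXT (a := -(1 / 2)) (b := 1) (t₀ := 0) (by norm_num)
    (by norm_num) (by norm_num) (hc.isMIntegralCurveOn _) h0

theorem IsThickPath.not_isSolution {T : ℝ × EuclideanSpace ℝ (Fin k) → M}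
    (hT : IsThickPath (n := n) T) {C : CurvesAt (1 : Diff (𝓡 n) M)}
    (hXT : ∀ x ∈ Ioo (0 : ℝ) 1, velocityField (𝓡 n) C (T (x, 0)) =
      mfderiv 𝓘(ℝ, ℝ) (𝓡 n) (fun s : ℝ => T (s, 0)) x (1 : ℝ))
    {g : SmoothMap (Icc (0 : ℝ) 1) (Diff (𝓡 n) M)} :
    ¬ IsSolution ⟨fun _ => tangent C, dSmooth_const⟩ g := by
  intro hg
  -- The integral curve is known only on the open interval `]0, 1[`. It is made to pass through the
  -- midpoint of the axis at the interior time `1/8`, and `1/8 + 1/2 < 1` leaves time to escape.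
  refine hT.not_isMIntegralCurveOn (contMDiff_velocityField C) hXT (a := 0) (b := 1) (t₀ := 1 / 8)
    (by norm_num) (by norm_num) (by norm_num) (hg.isMIntegralCurveOn
      ((g (projIcc 0 1 zero_le_one (1 / 8)))⁻¹ (T (1 / 2, 0)))) ?_
  simp

lemma exists_isCutoff : ∃ φ : ℝ → ℝ, IsCutoff φ := by
  let b : ContDiffBump (0 : ℝ) := ⟨1 / 4, 1 / 2, by norm_num, by norm_num⟩
  exact ⟨b, b.contDiff, fun r => ⟨b.nonneg, b.le_one⟩, b.eventuallyEq_one, 1 / 2, by norm_num,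
    fun r hr => b.zero_of_le_dist (by simpa [b] using hr)⟩

end NoSolution

/-! ### Rays in locally finite graphs -/

section Ray

variable {V : Type*} {G : SimpleGraph V}

/-- The vertices which are reached from `r` by a shortest path through `v`. -/
def beyond (G : SimpleGraph V) (r v : V) : Set V :=
  {x | G.dist r x = G.dist r v + G.dist v x}

lemma exists_adj_beyond_infinite (hc : G.Connected)
    (hf : ∀ v, (G.neighborSet v).Finite) {r v : V} (hv : (beyond G r v).Infinite) :
    ∃ v', G.Adj v v' ∧ G.dist r v' = G.dist r v + 1 ∧ (beyond G r v').Infinite := by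
  -- The first edge of a shortest path from `v` to `x` leads to a neighbour one step further from
  -- `r`, beyond which `x` still lies. Apart from `v`, the infinite set is thus a finite union, and
  -- one of its members must be infinite (König's argument).
  by_contra! hcon
  have hN : {v' | G.Adj v v' ∧ G.dist r v' = G.dist r v + 1}.Finite :=
    (hf v).subset fun v' h => h.1
  refine hv (((hN.biUnion fun v' h => hcon v' h.1 h.2).union (finite_singleton v)).subset
    fun x hx => ?_)
  obtain ⟨p, hp⟩ := (hc v x).exists_walk_length_eq_dist
  cases p with
  | nil => exact Or.inr rfl
  | @cons _ v' _ h p =>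
    left
    rw [SimpleGraph.Walk.length_cons] at hp
    have hx' : G.dist r x = G.dist r v + G.dist v x := hx
    have h1 : G.dist v' x ≤ p.length := SimpleGraph.dist_le p
    have h2 : G.dist r x ≤ G.dist r v' + G.dist v' x := hc.dist_triangle
    have h3 : G.dist r v' ≤ G.dist r v + G.dist v v' := hc.dist_triangle
    have h4 : G.dist v v' = 1 := SimpleGraph.dist_eq_one_iff_adj.2 h
    refine mem_biUnion (x := v') ⟨h, by omega⟩ ?_
    change G.dist r x = G.dist r v' + G.dist v' x
    omega

/-- An infinite connected locally finite graph contains a ray from each vertex. -/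
lemma exists_ray [Infinite V] (hc : G.Connected)
    (hf : ∀ v, (G.neighborSet v).Finite) (r : V) :
    ∃ s : ℕ → V, s 0 = r ∧ Function.Injective s ∧ ∀ j, G.Adj (s j) (s (j + 1)) := by
  have hr : (beyond G r r).Infinite := by
    have : beyond G r r = univ := eq_univ_of_forall fun x => by
      simp [beyond]
    rw [this]
    exact infinite_univ
  choose next hadj hdist hinf using fun v : {v // (beyond G r v).Infinite} =>
    exists_adj_beyond_infinite hc hf v.2
  let s : ℕ → {v // (beyond G r v).Infinite} := fun j =>
    Nat.rec ⟨r, hr⟩ (fun _ v => ⟨next v, hinf v⟩) j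
  have hs : ∀ j, G.dist r (s j).1 = j := by
    intro j
    induction j with
    | zero => exact SimpleGraph.dist_self
    | succ j ih => exact (hdist (s j)).trans (by rw [ih])
  refine ⟨fun j => (s j).1, rfl, fun i j hij => ?_, fun j => hadj (s j)⟩
  rw [← hs i, ← hs j]
  exact congrArg (G.dist r) hij

end Ray

/-! ### Pushing a point to infinity -/

section Push

variable {n : ℕ} {M : Type u} [TopologicalSpace M]
  [ChartedSpace (EuclideanSpace ℝ (Fin n)) M]

/-- The map agrees locally with diffeomorphisms of `M`. -/
def IsLocallyDiff (Θ : M → M) : Prop := ∀ x, ∃ g : Diff (𝓡 n) M, ∀ᶠ y in 𝓝 x, Θ y = g y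

lemma IsLocallyDiff.contMDiff {Θ : M → M} (h : IsLocallyDiff (n := n) Θ) :
    ContMDiff (𝓡 n) (𝓡 n) ∞ Θ := fun x => by
  obtain ⟨g, hg⟩ := h x
  exact (g.contMDiff x).congr_of_eventuallyEq hg

lemma IsLocallyDiff.isOpenMap {Θ : M → M} (h : IsLocallyDiff (n := n) Θ) : IsOpenMap Θ := by
  refine IsOpenMap.of_nhds_le fun x => ?_
  obtain ⟨g, hg⟩ := h x
  rw [Filter.map_congr hg, hg.self_of_nhds]
  exact g.toHomeomorph.isOpenMap.nhds_le x

lemma IsLocallyDiff.comp {Θ Θ' : M → M} (h : IsLocallyDiff (n := n) Θ)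
    (h' : IsLocallyDiff (n := n) Θ') : IsLocallyDiff (n := n) (Θ ∘ Θ') := fun x => by
  obtain ⟨g', hg'⟩ := h' x
  obtain ⟨g, hg⟩ := h (Θ' x)
  refine ⟨g * g', ?_⟩
  filter_upwards [hg', h'.contMDiff.continuous.continuousAt.eventually hg] with y h1 h2
  rw [Function.comp_apply, h2, h1, diff_mul_apply]

lemma isLocallyDiff_id : IsLocallyDiff (n := n) (id : M → M) := fun _ =>
  ⟨1, Filter.Eventually.of_forall fun _ => rfl⟩

/-- Parametrized open sets in the range of a locally diffeomorphic injection can be pulled back. -/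
lemma IsSmoothParam.exists_pullback {W : Type*} [NormedAddCommGroup W] [NormedSpace ℝ W]
    {τ : W → M} {S : M → W} {U : Set W} (hτ : IsSmoothParam (n := n) τ S U) {Θ : M → M}
    (hΘ : IsLocallyDiff (n := n) Θ) (hinj : Function.Injective Θ) (hr : τ '' U ⊆ range Θ) :
    ∃ (T : W → M) (S' : M → W), IsSmoothParam (n := n) T S' U ∧ ∀ w ∈ U, Θ (T w) = τ w := by
  rcases isEmpty_or_nonempty M with hM | hM
  · have hU : U = ∅ := eq_empty_of_forall_notMem fun w _ => hM.false (τ w)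
    exact ⟨τ, S, hτ, by simp [hU]⟩
  have hT : ∀ w ∈ U, Θ (Function.invFun Θ (τ w)) = τ w := fun w hw =>
    Function.invFun_eq (hr ⟨w, hw, rfl⟩)
  have himg : (fun w => Function.invFun Θ (τ w)) '' U = Θ ⁻¹' (τ '' U) := by
    ext x
    constructor
    · rintro ⟨w, hw, rfl⟩
      exact ⟨w, hw, (hT w hw).symm⟩
    · rintro ⟨w, hw, hwx⟩
      exact ⟨w, hw, hinj ((hT w hw).trans hwx)⟩
  refine ⟨fun w => Function.invFun Θ (τ w), fun x => S (Θ x),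
    ⟨hτ.isOpen_source, ?_, ?_, ?_, ?_⟩, hT⟩
  · rw [himg]
    exact hτ.isOpen_image.preimage hΘ.contMDiff.continuous
  · intro w hw
    obtain ⟨g, hg⟩ := hΘ (Function.invFun Θ (τ w))
    have hτw : ContMDiffAt 𝓘(ℝ, W) (𝓡 n) ∞ τ w :=
      hτ.contMDiffOn.contMDiffAt (hτ.isOpen_source.mem_nhds hw)
    have hgτ : ContMDiffAt 𝓘(ℝ, W) (𝓡 n) ∞ (fun w => g⁻¹ (τ w)) w :=
      ((g⁻¹).contMDiff _).comp w hτw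
    have h0 : g⁻¹ (τ w) = Function.invFun Θ (τ w) := by
      -- Near the preimage `Θ` agrees with a diffeomorphism `g`, so the set-theoretic inverse is
      -- locally the smooth map `g⁻¹`.
      rw [← hT w hw, hg.self_of_nhds, diff_inv_apply_self, ← hg.self_of_nhds, hT w hw]
    refine (hgτ.congr_of_eventuallyEq ?_).contMDiffWithinAt
    have h1 : ∀ᶠ w' in 𝓝 w, Θ (g⁻¹ (τ w')) = g (g⁻¹ (τ w')) :=
      hgτ.continuousAt.eventually (p := fun y => Θ y = g y) (by simp only [h0]; exact hg)
    filter_upwards [h1, hτ.isOpen_source.mem_nhds hw] with w' h2 h3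
    rw [diff_apply_inv_self] at h2
    exact hinj ((hT w' h3).trans h2.symm)
  · rw [himg]
    exact hτ.contMDiffOn_symm.comp hΘ.contMDiff.contMDiffOn fun x hx => hx
  · intro w hw
    simp only [hT w hw, hτ.left_inv w hw]

lemma diff_inv_apply_of_apply {h : Diff (𝓡 n) M} {z : M} (hz : h z = z) : h⁻¹ z = z := by
  conv_lhs => rw [← hz]
  exact diff_inv_apply_self h z

variable [T2Space M] [IsManifold (𝓡 n) ∞ M]

/-- In a chart the map `y ↦ y + b(y) v` moves the centre by `v`. It is a diffeomorphism once `v` is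
small compared with the derivative of the bump `b`, which is supported over `D`. -/
lemma eventually_exists_diff_moving {D : Set M} (hD : IsOpen D) {x : M} (hx : x ∈ D) :
    ∀ᶠ y in 𝓝 x, ∃ h : Diff (𝓡 n) M, h x = y ∧ ∀ z ∉ D, h z = z := by
  set e := extChartAt (𝓡 n) x
  have hΩ : IsOpen (e.target ∩ e.symm ⁻¹' D) :=
    (continuousOn_extChartAt_symm x).isOpen_inter_preimage (isOpen_extChartAt_target x) hD
  have hxΩ : e x ∈ e.target ∩ e.symm ⁻¹' D :=
    ⟨mem_extChartAt_target x, by rwa [mem_preimage, extChartAt_to_inv]⟩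
  obtain ⟨R, hR, hRΩ⟩ := Metric.nhds_basis_closedBall.mem_iff.1 (hΩ.mem_nhds hxΩ)
  let b : ContDiffBump (e x) := ⟨R / 2, R, by positivity, by linarith⟩
  obtain ⟨B, hB⟩ := (b.hasCompactSupport.fderiv (𝕜 := ℝ)).exists_bound_of_continuous
    ((b.contDiff (n := 1)).continuous_fderiv (by simp))
  have hB0 : 0 ≤ B := (norm_nonneg _).trans (hB (e x))
  have hclose : ∀ᶠ y in 𝓝 x, ‖e y - e x‖ < 1 / (2 * (B + 1)) := by
    have := (continuousAt_extChartAt (I := 𝓡 n) x).sub (continuousAt_const (y := e x))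
    refine this.norm.eventually_lt continuousAt_const ?_
    simp only [Pi.sub_apply, e, sub_self, norm_zero]
    positivity
  filter_upwards [hclose, extChartAt_source_mem_nhds (I := 𝓡 n) x] with y hy hys
  set v := e y - e x
  obtain ⟨a, -, ha, haK⟩ := exists_chart_perturbation (P := ℝ) x (isCompact_closedBall (e x) R)
    (hRΩ.trans inter_subset_left) (u := fun _ y => b y • v)
    ((b.contDiff.comp contDiff_snd).smul contDiff_const)
    (fun _ y hy => by
      have : b y = 0 := b.zero_of_le_dist (not_le.1 fun h => hy h).le
      rw [this, zero_smul])
    (fun _ y => by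
      have h1 : fderiv ℝ (fun y => b y • v) y = (fderiv ℝ b y).smulRight v :=
        fderiv_smul_const ((b.contDiff (n := 1)).differentiable (by simp) y) v
      rw [h1, ContinuousLinearMap.norm_smulRight_apply]
      calc ‖fderiv ℝ b y‖ * ‖v‖ ≤ B * (1 / (2 * (B + 1))) := by
            gcongr
            exact hB y
        _ ≤ 1 / 2 := by
            rw [mul_one_div, div_le_div_iff₀ (by positivity) (by positivity)]
            linarith)
  refine ⟨a 0, ?_, fun z hz => haK 0 z ?_⟩
  · have h1 := ha 0 (e x) (mem_extChartAt_target x)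
    have h2 : b (e x) = 1 := b.one_of_mem_closedBall (Metric.mem_closedBall_self (by positivity))
    rw [extChartAt_to_inv, h2, one_smul, add_sub_cancel] at h1
    rw [h1]
    exact e.left_inv hys
  · rintro ⟨w, hw, rfl⟩
    exact hz (hRΩ hw).2

/-- Connected open sets are homogeneous under diffeomorphisms supported in them. -/
theorem exists_diff_moving {D : Set M} (hD : IsOpen D) (hDc : IsPreconnected D) {x y : M}
    (hx : x ∈ D) (hy : y ∈ D) : ∃ h : Diff (𝓡 n) M, h x = y ∧ ∀ z ∉ D, h z = z := by
  by_contra hcon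
  let A : Set M := {y | y ∈ D ∧ ∃ h : Diff (𝓡 n) M, h x = y ∧ ∀ z ∉ D, h z = z}
  let B : Set M := {y | y ∈ D ∧ ¬ ∃ h : Diff (𝓡 n) M, h x = y ∧ ∀ z ∉ D, h z = z}
  have hA : IsOpen A := isOpen_iff_eventually.2 fun y hy => by
    obtain ⟨hyD, h, hxy, hz⟩ := hy
    filter_upwards [eventually_exists_diff_moving (n := n) hD hyD, hD.mem_nhds hyD] with y' h' hy'
    obtain ⟨h', hyy', hz'⟩ := h'
    exact ⟨hy', h' * h, by rw [diff_mul_apply, hxy, hyy'], fun z hzD => by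
      rw [diff_mul_apply, hz z hzD, hz' z hzD]⟩
  have hB : IsOpen B := isOpen_iff_eventually.2 fun y hy => by
    obtain ⟨hyD, hno⟩ := hy
    filter_upwards [eventually_exists_diff_moving (n := n) hD hyD, hD.mem_nhds hyD] with y' h' hy'
    obtain ⟨h', hyy', hz'⟩ := h'
    refine ⟨hy', fun ⟨h, hxy, hz⟩ => hno ⟨h'⁻¹ * h, ?_, fun z hzD => ?_⟩⟩
    · rw [diff_mul_apply, hxy, ← hyy', diff_inv_apply_self]
    · rw [diff_mul_apply, hz z hzD, diff_inv_apply_of_apply (hz' z hzD)]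
  obtain ⟨z, -, hzA, hzB⟩ := hDc A B hA hB (fun z hz => by
    by_cases h : ∃ h : Diff (𝓡 n) M, h x = z ∧ ∀ z ∉ D, h z = z
    · exact Or.inl ⟨hz, h⟩
    · exact Or.inr ⟨hz, h⟩) ⟨x, hx, hx, 1, diff_one_apply x, fun z _ => diff_one_apply z⟩
    ⟨y, hy, hy, hcon⟩
  exact hzB.2 hzA.2

variable [SecondCountableTopology M]

/-- A locally finite cover of a closed set by connected, relatively compact open sets. -/
lemma exists_connected_cover (n : ℕ) [ChartedSpace (EuclideanSpace ℝ (Fin n)) M]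
    {F W : Set M} (hF : IsClosed F) (hW : IsOpen W) (hFW : F ⊆ W) :
    ∃ (α : Type u) (D : α → Set M), (∀ a, IsOpen (D a) ∧ IsPreconnected (D a) ∧
      (∃ K, IsCompact K ∧ D a ⊆ K) ∧ D a ⊆ W ∧ (D a ∩ F).Nonempty) ∧ F ⊆ ⋃ a, D a ∧
      LocallyFinite D := by
  have hLC : LocallyCompactSpace M := ChartedSpace.locallyCompactSpace (EuclideanSpace ℝ (Fin n)) M
  have hLcon : LocallyConnectedSpace M :=
    ChartedSpace.locallyConnectedSpace (EuclideanSpace ℝ (Fin n)) M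
  have hB : ∀ x ∈ F, (𝓝 x).HasBasis (fun U : Set M => (x ∈ U ∧ IsOpen U) ∧ IsPreconnected U ∧
      (∃ K, IsCompact K ∧ U ⊆ K) ∧ U ⊆ W) id := by
    intro x hx
    refine Filter.hasBasis_iff.2 fun t => ⟨fun ht => ?_, ?_⟩
    · obtain ⟨K, hK, hxK⟩ := exists_compact_mem_nhds x
      have hO : interior (K ∩ W ∩ t) ∈ 𝓝 x := interior_mem_nhds.2
        (Filter.inter_mem (Filter.inter_mem hxK (hW.mem_nhds (hFW hx))) ht)
      have hsub := (connectedComponentIn_subset (interior (K ∩ W ∩ t)) x).trans interior_subset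
      exact ⟨connectedComponentIn (interior (K ∩ W ∩ t)) x,
        ⟨⟨mem_connectedComponentIn (mem_of_mem_nhds hO), isOpen_interior.connectedComponentIn⟩,
          isPreconnected_connectedComponentIn, ⟨K, hK, fun y hy => (hsub hy).1.1⟩,
          fun y hy => (hsub hy).1.2⟩, fun y hy => (hsub hy).2⟩
    · rintro ⟨U, ⟨⟨hxU, hU⟩, -⟩, hUt⟩
      exact Filter.mem_of_superset (hU.mem_nhds hxU) hUt
  obtain ⟨α, c, D, hD, hcov, hlf⟩ :=
    refinement_of_locallyCompact_sigmaCompact_of_nhds_basis_set hF hB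
  exact ⟨α, D, fun a => ⟨(hD a).2.1.2, (hD a).2.2.1, (hD a).2.2.2.1, (hD a).2.2.2.2,
    ⟨c a, (hD a).2.1.1, (hD a).1⟩⟩, hcov, hlf⟩

/-- A point of a closed, connected, non-compact set can be pushed to infinity inside an open
neighbourhood of the set. -/
theorem exists_push {F W : Set M} (hF : IsClosed F) (hFc : IsPreconnected F) (hFn : ¬ IsCompact F)
    (hW : IsOpen W) (hFW : F ⊆ W) {p : M} (hp : p ∈ F) :
    ∃ Θ : M → M, IsLocallyDiff (n := n) Θ ∧ Function.Injective Θ ∧ (∀ x ∉ W, Θ x = x) ∧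
      p ∉ range Θ := by
  obtain ⟨α, D, hD, hcov, hlf⟩ := exists_connected_cover n hF hW hFW
  -- The nerve of the cover: locally finite because the cover is locally finite and relatively
  -- compact, infinite because `F` is not compact, connected because `F` is. It therefore has a ray.
  let G : SimpleGraph α := SimpleGraph.fromRel fun a b => (D a ∩ D b).Nonempty
  have hadj : ∀ a b, G.Adj a b → (D a ∩ D b).Nonempty := fun a b h => by
    rcases ((SimpleGraph.fromRel_adj _ _ _).1 h).2 with h | h
    · exact h
    · rwa [inter_comm]
  have hfin : ∀ a, (G.neighborSet a).Finite := fun a => by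
    obtain ⟨K, hK, haK⟩ := (hD a).2.2.1
    refine (hlf.finite_nonempty_inter_compact hK).subset fun b hb => ?_
    obtain ⟨x, hxa, hxb⟩ := hadj a b hb
    exact ⟨x, hxb, haK hxa⟩
  have hinf : Infinite α := by
    by_contra h
    have hfinα : Finite α := not_infinite_iff_finite.1 h
    choose K hK hDK using fun a => (hD a).2.2.1
    exact hFn ((isCompact_iUnion hK).of_isClosed_subset hF
      (hcov.trans (iUnion_mono hDK)))
  have hconn : G.Connected := by
    have hne : Nonempty α := inferInstance
    refine ⟨fun a b => ?_⟩
    by_contra hab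
    obtain ⟨x, -, hxA, hxB⟩ := hFc (⋃ c ∈ {c | G.Reachable a c}, D c)
      (⋃ c ∈ {c | ¬ G.Reachable a c}, D c) (isOpen_biUnion fun c _ => (hD c).1)
      (isOpen_biUnion fun c _ => (hD c).1) (fun x hx => by
        obtain ⟨c, hc⟩ := mem_iUnion.1 (hcov hx)
        by_cases h : G.Reachable a c
        · exact Or.inl (mem_biUnion h hc)
        · exact Or.inr (mem_biUnion h hc))
      (by
        obtain ⟨x, hx, hxF⟩ := (hD a).2.2.2.2
        exact ⟨x, hxF, mem_biUnion (show a ∈ {c | G.Reachable a c} from SimpleGraph.Reachable.refl a) hx⟩)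
      (by
        obtain ⟨x, hx, hxF⟩ := (hD b).2.2.2.2
        exact ⟨x, hxF, mem_biUnion (show b ∈ {c | ¬ G.Reachable a c} from hab) hx⟩)
    obtain ⟨c, hc, hxc⟩ := mem_iUnion₂.1 hxA
    obtain ⟨d, hd, hxd⟩ := mem_iUnion₂.1 hxB
    have hc' : G.Reachable a c := hc
    rcases eq_or_ne c d with rfl | hcd
    · exact hd hc'
    · exact hd (hc'.trans
        ((SimpleGraph.fromRel_adj _ _ _).2 ⟨hcd, Or.inl ⟨x, hxc, hxd⟩⟩ : G.Adj c d).reachable)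
  obtain ⟨r, hr⟩ := mem_iUnion.1 (hcov hp)
  obtain ⟨s, hs0, hsinj, hsadj⟩ := exists_ray hconn hfin r
  choose q hq using fun j => hadj _ _ (hsadj j)
  let pts : ℕ → M := fun j => Nat.casesOn j p q
  have hpts : ∀ j, pts j ∈ D (s j) := fun j => by
    cases j with
    | zero => exact hs0 ▸ hr
    | succ j => exact (hq j).2
  have hpts' : ∀ j, pts (j + 1) ∈ D (s j) := fun j => (hq j).1
  -- `h j` moves one point of the sequence to the next inside `D (s j)`. The injectivity of the ray
  -- makes these supports locally finite.
  choose h hhp hhD using fun j => exists_diff_moving (n := n) (hD (s j)).1 (hD (s j)).2.1 (hpts j)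
    (hpts' j)
  have hleave : ∀ x, ∃ J, ∀ᶠ y in 𝓝 x, ∀ j ≥ J, y ∉ D (s j) := by
    intro x
    obtain ⟨t, ht, htf⟩ := hlf x
    obtain ⟨J, hJ⟩ := (htf.preimage hsinj.injOn).bddAbove
    refine ⟨J + 1, ?_⟩
    filter_upwards [ht] with y hy j hj hyj
    have : j ≤ J := hJ ⟨y, hyj, hy⟩
    omega
  choose J hJ using hleave
  let a : ℕ → Diff (𝓡 n) M := fun j => (h j)⁻¹
  have haD : ∀ j, ∀ z ∉ D (s j), a j z = z := fun j z hz => diff_inv_apply_of_apply (hhD j z hz)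
  have hstab : ∀ x y N, (∀ j ≥ J x, y ∉ D (s j)) → J x ≤ N →
      partialProd a N y = partialProd a (J x) y := fun x y N hy hN =>
    partialProd_apply_eq hN fun i hi => haD i y (hy i hi)
  -- The infinite product `h₀⁻¹ h₁⁻¹ ⋯`, of which only the first `J x` factors matter near `x`. Its
  -- range misses `p`: each product of `N` factors carries `pts N` to `p`, so a preimage `x` of `p`
  -- would be `pts (J x)`, which lies in `D (s (J x))` against the choice of `J x`.
  let Θ : M → M := fun x => partialProd a (J x) x
  have hΘ : ∀ x N, J x ≤ N → Θ x = partialProd a N x := fun x N hN =>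
    (hstab x x N (hJ x).self_of_nhds hN).symm
  refine ⟨Θ, fun x => ⟨partialProd a (J x), ?_⟩, fun x y hxy => ?_, fun x hx => ?_, ?_⟩
  · filter_upwards [hJ x] with y hy
    rw [hΘ y (max (J x) (J y)) (le_max_right _ _), hstab x y _ hy (le_max_left _ _)]
  · rw [hΘ x (max (J x) (J y)) (le_max_left _ _), hΘ y (max (J x) (J y)) (le_max_right _ _)] at hxy
    exact (partialProd a (max (J x) (J y))).injective hxy
  · exact partialProd_apply_eq (Nat.zero_le _) fun i _ => haD i x fun h => hx ((hD (s i)).2.2.2.1 h)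
  · rintro ⟨x, hx⟩
    have hprod : ∀ N, partialProd a N (pts N) = p := by
      intro N
      induction N with
      | zero => rfl
      | succ N ih =>
        rw [partialProd_succ, diff_mul_apply, ← hhp N]
        simp only [a, diff_inv_apply_self]
        exact ih
    have h1 : pts (J x) = x := (partialProd a (J x)).injective ((hprod _).trans hx.symm)
    have h2 := hpts (J x)
    rw [h1] at h2
    exact (hJ x).self_of_nhds (J x) le_rfl h2

end Push

/-! ### Parametrizations and thick paths -/

section Param

variable {n k : ℕ} {M : Type u} [TopologicalSpace M]
  [ChartedSpace (EuclideanSpace ℝ (Fin n)) M]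

lemma IsSmoothParam.isOpen_image_of_subset {W : Type*} [NormedAddCommGroup W] [NormedSpace ℝ W]
    {T : W → M} {S : M → W} {U O : Set W} (h : IsSmoothParam (n := n) T S U) (hO : IsOpen O)
    (hOU : O ⊆ U) : IsOpen (T '' O) := by
  have h1 := h.contMDiffOn_symm.continuousOn.isOpen_inter_preimage h.isOpen_image hO
  convert h1 using 1
  ext x
  constructor
  · rintro ⟨w, hw, rfl⟩
    exact ⟨⟨w, hOU hw, rfl⟩, by rwa [mem_preimage, h.left_inv w (hOU hw)]⟩
  · rintro ⟨⟨w, hw, rfl⟩, hwO⟩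
    rw [mem_preimage, h.left_inv w hw] at hwO
    exact ⟨w, hwO, rfl⟩

lemma IsSmoothParam.injOn {W : Type*} [NormedAddCommGroup W] [NormedSpace ℝ W]
    {T : W → M} {S : M → W} {U : Set W} (h : IsSmoothParam (n := n) T S U) : InjOn T U :=
  fun x hx y hy hxy => by rw [← h.left_inv x hx, hxy, h.left_inv y hy]

lemma IsSmoothParam.comp {W W' : Type*} [NormedAddCommGroup W] [NormedSpace ℝ W]
    [NormedAddCommGroup W'] [NormedSpace ℝ W'] {T : W → M} {S : M → W} {U : Set W}
    (hT : IsSmoothParam (n := n) T S U) {τ : W' → W} {σ : W → W'} {U' : Set W'} (hU' : IsOpen U')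
    (himg : IsOpen (τ '' U')) (hτ : ContDiffOn ℝ ∞ τ U') (hσ : ContDiffOn ℝ ∞ σ (τ '' U'))
    (hinv : ∀ w ∈ U', σ (τ w) = w) (hmaps : MapsTo τ U' U) :
    IsSmoothParam (n := n) (fun w => T (τ w)) (fun x => σ (S x)) U' := by
  have himg' : (fun w => T (τ w)) '' U' = T '' (τ '' U') := (image_image T τ U').symm
  refine ⟨hU', ?_, hT.contMDiffOn.comp hτ.contMDiffOn hmaps, ?_, fun w hw => ?_⟩
  · rw [himg']
    exact hT.isOpen_image_of_subset himg hmaps.image_subset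
  · rw [himg']
    refine hσ.contMDiffOn.comp
      (hT.contMDiffOn_symm.mono (image_mono hmaps.image_subset)) ?_
    rintro _ ⟨y, hy, rfl⟩
    rwa [mem_preimage, hT.left_inv y (hmaps.image_subset hy)]
  · simp only [hT.left_inv _ (hmaps hw), hinv w hw]

lemma IsSmoothParam.isThickPath {T : ℝ × EuclideanSpace ℝ (Fin k) → M}
    {S : M → ℝ × EuclideanSpace ℝ (Fin k)} (h : IsSmoothParam (n := n) T S (tubeDomain k))
    (hn : n = k + 1)
    (hcl : ∀ r < (1 : ℝ), IsClosed (T '' (Ioo 0 1 ×ˢ Metric.closedBall 0 r))) :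
    IsThickPath (n := n) T where
  codim_zero := hn
  smooth := h.contMDiffOn
  immersion z hz := by
    have hTz := (h.contMDiffOn.contMDiffAt (h.isOpen_source.mem_nhds hz)).mdifferentiableAt
      (by simp)
    have hSz := (h.contMDiffOn_symm.contMDiffAt
      (h.isOpen_image.mem_nhds ⟨z, hz, rfl⟩)).mdifferentiableAt (by simp)
    have hid : S ∘ T =ᶠ[𝓝 z] id := by
      filter_upwards [h.isOpen_source.mem_nhds hz] with w hw
      exact h.left_inv w hw
    have h1 := (hSz.hasMFDerivAt.comp z hTz.hasMFDerivAt).mfderiv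
    have h2 := hid.mfderiv_eq (I := 𝓘(ℝ, ℝ × EuclideanSpace ℝ (Fin k)))
      (I' := 𝓘(ℝ, ℝ × EuclideanSpace ℝ (Fin k)))
    let A : ℝ × EuclideanSpace ℝ (Fin k) →L[ℝ] EuclideanSpace ℝ (Fin n) :=
      mfderiv 𝓘(ℝ, ℝ × EuclideanSpace ℝ (Fin k)) (𝓡 n) T z
    let B : EuclideanSpace ℝ (Fin n) →L[ℝ] ℝ × EuclideanSpace ℝ (Fin k) :=
      mfderiv (𝓡 n) 𝓘(ℝ, ℝ × EuclideanSpace ℝ (Fin k)) S (T z)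
    have h3 : B.comp A = ContinuousLinearMap.id ℝ _ := h1.symm.trans (h2.trans mfderiv_id)
    have h4 : ∀ v, B (A v) = v := fun v => congrArg (fun L : _ →L[ℝ] _ => L v) h3
    exact Function.LeftInverse.injective (g := B) (f := A) h4
  embedding := by
    refine (IsOpenEmbedding.of_continuous_injective_isOpenMap
      (continuousOn_iff_continuous_domRestrict.1 h.contMDiffOn.continuousOn)
      (injOn_iff_injective.1 h.injOn) fun O hO => ?_).isEmbedding
    have h1 : (tubeDomain k).domRestrict T '' O = T '' (Subtype.val '' O) :=
      (image_image T Subtype.val O).symm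
    rw [h1]
    exact h.isOpen_image_of_subset (h.isOpen_source.isOpenMap_subtype_val O hO)
      (Subtype.coe_image_subset _ _)
  closed := hcl

end Param

/-! ### A ball touching the boundary of the range in one point -/

section BoundaryBall

variable {n : ℕ} {M : Type u} [TopologicalSpace M]
  [ChartedSpace (EuclideanSpace ℝ (Fin n)) M]

/-- At some boundary point of the range of a locally diffeomorphic injection, the range contains a
closed ball of a chart with only one point of the boundary sphere removed. -/
lemma exists_boundary_ball {C : Set M} (hCo : IsOpen C) (hC : IsPreconnected C) {Θ : M → M}
    (hΘ : IsLocallyDiff (n := n) Θ) {p y : M} (hp : p ∈ C) (hpr : p ∉ range Θ) (hy : y ∈ C)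
    (hyr : y ∈ range Θ) :
    ∃ (x₁ : M) (m z : EuclideanSpace ℝ (Fin n)) (R : ℝ), 0 < R ∧ dist z m = R ∧
      (∀ x ∈ Metric.closedBall m R, x ∈ (extChartAt (𝓡 n) x₁).target ∧
        (extChartAt (𝓡 n) x₁).symm x ∈ C) ∧ (extChartAt (𝓡 n) x₁).symm z ∉ range Θ ∧
      ∀ x ∈ Metric.closedBall m R, x ≠ z → (extChartAt (𝓡 n) x₁).symm x ∈ range Θ := by
  have hro : IsOpen (range Θ) := hΘ.isOpenMap.isOpen_range
  obtain ⟨q, hqC, hqr, hqcl⟩ : ∃ q ∈ C, q ∉ range Θ ∧ q ∈ closure (range Θ) := by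
    by_contra! hcon
    obtain ⟨x, -, hx1, hx2⟩ := hC (range Θ) (closure (range Θ))ᶜ hro isClosed_closure.isOpen_compl
      (fun x hx => by
        by_cases h : x ∈ range Θ
        · exact Or.inl h
        · exact Or.inr (hcon x hx h)) ⟨y, hy, hyr⟩ ⟨p, hp, hcon p hp hpr⟩
    exact hx2 (subset_closure hx1)
  set e := extChartAt (𝓡 n) q
  have hΩ : IsOpen (e.target ∩ e.symm ⁻¹' C) :=
    (continuousOn_extChartAt_symm q).isOpen_inter_preimage (isOpen_extChartAt_target q) hCo
  have hqΩ : e q ∈ e.target ∩ e.symm ⁻¹' C :=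
    ⟨mem_extChartAt_target q, by rwa [mem_preimage, extChartAt_to_inv]⟩
  obtain ⟨ε, hε, hεΩ⟩ := Metric.nhds_basis_closedBall.mem_iff.1 (hΩ.mem_nhds hqΩ)
  have hnear : ∀ᶠ x in 𝓝 q, x ∈ e.source ∧ e x ∈ Metric.ball (e q) (ε / 3) :=
    Filter.inter_mem (extChartAt_source_mem_nhds (I := 𝓡 n) q)
      ((continuousAt_extChartAt (I := 𝓡 n) q).preimage_mem_nhds (Metric.ball_mem_nhds _ (by positivity)))
  obtain ⟨x, ⟨hxs, hxb⟩, hxr⟩ := mem_closure_iff_nhds.1 hqcl _ hnear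
  set m₀ := e x
  have hm₀ : dist m₀ (e q) < ε / 3 := hxb
  have hm₀r : e.symm m₀ ∈ range Θ := by rwa [e.left_inv hxs]
  let A : Set (EuclideanSpace ℝ (Fin n)) := Metric.closedBall (e q) ε ∩ e.symm ⁻¹' (range Θ)ᶜ
  have hA : IsCompact A := (isCompact_closedBall (e q) ε).of_isClosed_subset
    (((continuousOn_extChartAt_symm q).mono fun y hy => (hεΩ hy).1).preimage_isClosed_of_isClosed
      Metric.isClosed_closedBall hro.isClosed_compl) inter_subset_left
  have hqA : e q ∈ A := ⟨Metric.mem_closedBall_self hε.le, by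
    rwa [mem_preimage, extChartAt_to_inv]⟩
  -- `z` is a point of the complement nearest to `m₀`. The bounds `ε / 3` keep the whole
  -- construction inside the ball of radius `ε` in the chart.
  obtain ⟨z, hzA, hzmin⟩ := hA.exists_isMinOn ⟨_, hqA⟩
    (continuous_const.dist continuous_id : Continuous fun y => dist m₀ y).continuousOn
  have hzmin' : ∀ y ∈ A, dist m₀ z ≤ dist m₀ y := fun y hy => hzmin hy
  have hR₀ : 0 < dist m₀ z := dist_pos.2 fun h => hzA.2 (h ▸ hm₀r)
  have hR₀' : dist m₀ z < ε / 3 := (hzmin' _ hqA).trans_lt hm₀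
  -- The ball with diameter `[m₀, z]` lies in the ball about `m₀` through `z` and touches its sphere
  -- only at `z`. This is the parallelogram law: `‖w - m₀‖² + ‖w - z‖² ≤ ‖m₀ - z‖²` on the smaller
  -- ball.
  refine ⟨q, midpoint ℝ m₀ z, z, dist m₀ z / 2, by positivity, ?_, fun w hw => ?_, hzA.2,
    fun w hw hwz => ?_⟩
  · rw [dist_right_midpoint]
    simp
    ring
  all_goals
    have hpar := parallelogram_law_with_norm ℝ (w - midpoint ℝ m₀ z) (midpoint ℝ m₀ z - m₀)
    have e1 : w - midpoint ℝ m₀ z + (midpoint ℝ m₀ z - m₀) = w - m₀ := by abel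
    have e2 : w - midpoint ℝ m₀ z - (midpoint ℝ m₀ z - m₀) = w - z := by
      have : midpoint ℝ m₀ z + midpoint ℝ m₀ z = m₀ + z := midpoint_add_self ℝ m₀ z
      have h' : w - midpoint ℝ m₀ z - (midpoint ℝ m₀ z - m₀) =
        w + m₀ - (midpoint ℝ m₀ z + midpoint ℝ m₀ z) := by abel
      rw [h', this]
      abel
    have e3 : ‖midpoint ℝ m₀ z - m₀‖ = dist m₀ z / 2 := by
      rw [← dist_eq_norm, dist_midpoint_left]
      simp
      ring
    have hw' : ‖w - midpoint ℝ m₀ z‖ ≤ dist m₀ z / 2 := by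
      rwa [← dist_eq_norm]
    rw [e1, e2, e3] at hpar
    have hw2 : dist w m₀ ≤ dist m₀ z := by
      rw [dist_eq_norm]
      nlinarith [norm_nonneg (w - m₀), norm_nonneg (w - z), norm_nonneg (w - midpoint ℝ m₀ z)]
    have hwε : w ∈ Metric.closedBall (e q) ε := by
      have := dist_triangle w m₀ (e q)
      rw [Metric.mem_closedBall]
      linarith
  · exact hεΩ hwε
  · by_contra hwr
    have h1 := hzmin' w ⟨hwε, hwr⟩
    have h2 : 0 < ‖w - z‖ := norm_pos_iff.2 (sub_ne_zero.2 hwz)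
    have h3 : ‖w - m₀‖ = dist m₀ w := by rw [dist_comm, dist_eq_norm]
    rw [h3] at hpar
    nlinarith [norm_nonneg (w - midpoint ℝ m₀ z)]

end BoundaryBall

/-! ### A tube with both ends at one boundary point -/

section InversionTube

open EuclideanGeometry

variable {n k : ℕ}

lemma contDiffOn_logit : ContDiffOn ℝ ∞ (fun s : ℝ => Real.log s - Real.log (1 - s)) (Ioo 0 1) :=
  (contDiffOn_id.log fun _ hs => hs.1.ne').sub
    ((contDiffOn_const.sub contDiffOn_id).log fun _ hs => (sub_pos.2 hs.2).ne')

lemma contDiff_logistic : ContDiff ℝ ∞ (fun x : ℝ => Real.exp x / (1 + Real.exp x)) :=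
  Real.contDiff_exp.div (contDiff_const.add Real.contDiff_exp) fun x => by positivity

lemma logistic_mem (x : ℝ) : Real.exp x / (1 + Real.exp x) ∈ Ioo (0 : ℝ) 1 :=
  ⟨by positivity, by rw [div_lt_one (by positivity)]; linarith [Real.exp_pos x]⟩

lemma logistic_logit {s : ℝ} (hs : s ∈ Ioo (0 : ℝ) 1) :
    Real.exp (Real.log s - Real.log (1 - s)) / (1 + Real.exp (Real.log s - Real.log (1 - s))) =
      s := by
  have h1 : 0 < 1 - s := sub_pos.2 hs.2
  rw [Real.exp_sub, Real.exp_log hs.1, Real.exp_log h1]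
  field_simp
  ring

lemma logit_logistic (x : ℝ) : Real.log (Real.exp x / (1 + Real.exp x)) -
    Real.log (1 - Real.exp x / (1 + Real.exp x)) = x := by
  have h1 : 1 - Real.exp x / (1 + Real.exp x) = 1 / (1 + Real.exp x) := by
    field_simp
    ring
  rw [h1, Real.log_div (by positivity) (by positivity), Real.log_div (by positivity) (by positivity),
    Real.log_exp, Real.log_one]
  ring

/-- A tube in a ball both of whose ends converge to a point of the boundary sphere. -/
lemma exists_tube_in_ball (hn : n = k + 1) (hk : 1 ≤ k) {m z : EuclideanSpace ℝ (Fin n)} {R : ℝ}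
    (hR : 0 < R) (hz : dist z m = R) :
    ∃ (τ : ℝ × EuclideanSpace ℝ (Fin k) → EuclideanSpace ℝ (Fin n))
      (σ : EuclideanSpace ℝ (Fin n) → ℝ × EuclideanSpace ℝ (Fin k)),
      IsSmoothParam (n := n) τ σ (tubeDomain k) ∧
      (∀ w ∈ tubeDomain k, τ w ∈ Metric.closedBall m R ∧ τ w ≠ z) ∧
      ∀ r < (1 : ℝ), IsCompact (insert z (τ '' (Ioo 0 1 ×ˢ Metric.closedBall 0 r))) := by
  set ν : EuclideanSpace ℝ (Fin n) := R⁻¹ • (m - z)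
  have hmz : ‖m - z‖ = R := by rw [← dist_eq_norm, dist_comm, hz]
  have hν : ‖ν‖ = 1 := by
    rw [norm_smul, hmz, norm_inv, Real.norm_of_nonneg hR.le, inv_mul_cancel₀ hR.ne']
  have hνm : m - z = R • ν := by rw [smul_smul, mul_inv_cancel₀ hR.ne', one_smul]
  -- A direction orthogonal to `ν` for the axis of the cylinder; this is where dimension at least
  -- two is used.
  obtain ⟨a, ha, ha0⟩ : ∃ a : EuclideanSpace ℝ (Fin n), inner ℝ ν a = 0 ∧ a ≠ 0 := by
    have hker : LinearMap.ker (innerSL ℝ ν).toLinearMap ≠ ⊥ :=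
      LinearMap.ker_ne_bot_of_finrank_lt (by
        rw [Module.finrank_self, finrank_euclideanSpace_fin]
        omega)
    obtain ⟨a, ha, ha0⟩ := Submodule.exists_mem_ne_zero_of_ne_bot hker
    exact ⟨a, ha, ha0⟩
  have hdim : Module.finrank ℝ (ℝ × EuclideanSpace ℝ (Fin k)) =
      Module.finrank ℝ (EuclideanSpace ℝ (Fin n)) := by
    rw [Module.finrank_prod, Module.finrank_self, finrank_euclideanSpace_fin,
      finrank_euclideanSpace_fin, hn, add_comm]
  let A₀ := ContinuousLinearEquiv.ofFinrankEq hdim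
  obtain ⟨A₁, hA₁⟩ := SeparatingDual.exists_continuousLinearEquiv_apply_eq (R := ℝ)
    (x := A₀ (1, 0)) (y := a) (by
      rw [Ne, map_eq_zero_iff A₀ A₀.injective]
      simp) ha0
  let A : (ℝ × EuclideanSpace ℝ (Fin k)) ≃L[ℝ] EuclideanSpace ℝ (Fin n) := A₀.trans A₁
  have hA : A (1, 0) = a := hA₁
  let L : (ℝ × EuclideanSpace ℝ (Fin k)) →L[ℝ] EuclideanSpace ℝ (Fin n) := A
  -- Inversion at `z` with radius `R` maps the half-space where the inner product with `ν` is at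
  -- least `R / 2` into the ball. The shift by `κ • ν` gives at least `R` on the whole solid
  -- cylinder.
  set κ := ‖L‖ + R
  have hinner : ∀ w : ℝ × EuclideanSpace ℝ (Fin k), ‖w.2‖ ≤ 1 → R ≤ inner ℝ ν (A w + κ • ν) := by
    intro w hw
    have h1 : A w = w.1 • a + L (0, w.2) := by
      rw [← hA, ← map_smul]
      change A w = A _ + A _
      rw [← map_add]
      simp
    have h2 : |inner ℝ ν (L (0, w.2))| ≤ ‖L‖ := by
      refine (abs_real_inner_le_norm _ _).trans ?_
      rw [hν, one_mul]
      refine (L.le_opNorm _).trans (mul_le_of_le_one_right (norm_nonneg _) ?_)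
      simpa [Prod.norm_def] using hw
    rw [h1, inner_add_right, inner_add_right, inner_smul_right, ha, inner_smul_right,
      real_inner_self_eq_norm_sq, hν]
    have := (abs_le.1 h2).1
    simp only [κ]
    linarith
  let N : ℝ × EuclideanSpace ℝ (Fin k) → EuclideanSpace ℝ (Fin n) := fun w =>
    inversion z R (z + (A w + κ • ν))
  let D : EuclideanSpace ℝ (Fin n) → ℝ × EuclideanSpace ℝ (Fin k) := fun x =>
    A.symm (inversion z R x - z - κ • ν)
  have hDN : ∀ w, D (N w) = w := fun w => by
    simp only [D, N, inversion_inversion z hR.ne', add_sub_cancel_left, add_sub_cancel_right,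
      ContinuousLinearEquiv.symm_apply_apply]
  have hND : ∀ x, N (D x) = x := fun x => by
    simp only [D, N, ContinuousLinearEquiv.apply_symm_apply, sub_add_cancel, add_sub_cancel,
      inversion_inversion z hR.ne']
  have hNz : ∀ w : ℝ × EuclideanSpace ℝ (Fin k), ‖w.2‖ ≤ 1 → z + (A w + κ • ν) ≠ z := fun w hw h => by
    have h1 := hinner w hw
    rw [add_eq_left.1 h, inner_zero_right] at h1
    linarith
  have hDc : ContDiffOn ℝ ∞ D {z}ᶜ :=
    A.symm.contDiff.comp_contDiffOn (((contDiffOn_const.inversion contDiffOn_const contDiffOn_id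
      fun x hx => hx).sub contDiffOn_const).sub contDiffOn_const)
  have hNball : ∀ w : ℝ × EuclideanSpace ℝ (Fin k), ‖w.2‖ ≤ 1 → N w ∈ Metric.closedBall m R := by
    intro w hw
    have h1 := hinner w hw
    set y := A w + κ • ν
    have hy0 : 0 < ‖y‖ := norm_pos_iff.2 fun h => by
      rw [h, inner_zero_right] at h1
      linarith
    have h2 : N w - m = (R / ‖y‖) ^ 2 • y - R • ν := by
      change inversion z R (z + y) - m = _
      rw [← hνm, inversion, dist_eq_norm, add_sub_cancel_left, vsub_eq_sub, vadd_eq_add,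
        add_sub_cancel_left]
      abel
    rw [mem_closedBall_iff_norm, h2]
    refine abs_le_of_sq_le_sq' ?_ hR.le |>.2
    rw [norm_sub_sq_real, norm_smul, norm_smul, hν, inner_smul_left, inner_smul_right,
      real_inner_comm]
    simp only [norm_pow, norm_div, norm_norm, Real.norm_of_nonneg hR.le, mul_one, conj_trivial]
    have h3 : ((R / ‖y‖) ^ 2 * ‖y‖) ^ 2 = (R / ‖y‖) ^ 2 * R ^ 2 := by field_simp
    rw [h3]
    have h4 : (R / ‖y‖) ^ 2 * (R * R) ≤ (R / ‖y‖) ^ 2 * (R * inner ℝ ν y) := by gcongr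
    have h5 : 0 ≤ (R / ‖y‖) ^ 2 * (R * R) := by positivity
    linarith
  have hNne : ∀ w : ℝ × EuclideanSpace ℝ (Fin k), ‖w.2‖ ≤ 1 → N w ≠ z := fun w hw h =>
    hNz w hw ((inversion_eq_center hR.ne').1 h)
  have hball : ∀ w ∈ tubeDomain k, ‖w.2‖ ≤ 1 := fun w hw => (mem_ball_zero_iff.1 hw.2).le
  -- The logit stretches `]0, 1[` to `ℝ`, so the tube is the inverted infinite cylinder, both of
  -- whose ends tend to `z`.
  let τ : ℝ × EuclideanSpace ℝ (Fin k) → EuclideanSpace ℝ (Fin n) := fun w =>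
    N (Real.log w.1 - Real.log (1 - w.1), w.2)
  let σ : EuclideanSpace ℝ (Fin n) → ℝ × EuclideanSpace ℝ (Fin k) := fun x =>
    (Real.exp (D x).1 / (1 + Real.exp (D x).1), (D x).2)
  have himg : ∀ s : Set (EuclideanSpace ℝ (Fin k)), s ⊆ Metric.ball 0 1 →
      τ '' (Ioo 0 1 ×ˢ s) = {z}ᶜ ∩ D ⁻¹' (univ ×ˢ s) := by
    intro s hs
    ext x
    constructor
    · rintro ⟨w, ⟨hw1, hw2⟩, rfl⟩
      refine ⟨hNne _ (mem_ball_zero_iff.1 (hs hw2)).le, ?_⟩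
      simp only [τ, mem_preimage, hDN]
      exact ⟨mem_univ _, hw2⟩
    · rintro ⟨hxz, -, hx⟩
      refine ⟨σ x, ⟨logistic_mem _, hx⟩, ?_⟩
      simp only [τ, σ, logit_logistic, Prod.mk.eta, hND]
  have hopen : IsOpen (τ '' tubeDomain k) := by
    rw [tubeDomain, himg _ subset_rfl]
    exact hDc.continuousOn.isOpen_inter_preimage isOpen_compl_singleton
      (isOpen_univ.prod Metric.isOpen_ball)
  refine ⟨τ, σ, ⟨isOpen_tubeDomain, hopen, ?_, ?_, fun w hw => ?_⟩, fun w hw =>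
    ⟨hNball _ (hball w hw), hNne _ (hball w hw)⟩, fun r hr => ?_⟩
  · refine ContDiffOn.contMDiffOn ?_
    refine contDiffOn_const.inversion contDiffOn_const ?_ fun w hw => hNz _ (hball w hw)
    refine contDiffOn_const.add ((A.contDiff.comp_contDiffOn (ContDiffOn.prodMk ?_
      contDiffOn_snd)).add contDiffOn_const)
    exact contDiffOn_logit.comp contDiffOn_fst fun w hw => hw.1
  · refine ContDiffOn.contMDiffOn ?_
    rw [tubeDomain, himg _ subset_rfl]
    have hD' := hDc.mono (inter_subset_left (t := D ⁻¹' (univ ×ˢ Metric.ball 0 1)))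
    exact ContDiffOn.prodMk (contDiff_logistic.comp_contDiffOn (contDiff_fst.comp_contDiffOn hD'))
      (contDiff_snd.comp_contDiffOn hD')
  · simp only [τ, σ, hDN, logistic_logit hw.1]
  · have hsub : Metric.closedBall (0 : EuclideanSpace ℝ (Fin k)) r ⊆ Metric.ball 0 1 :=
      Metric.closedBall_subset_ball hr
    rw [himg _ hsub]
    -- Off `z` the image is the preimage of a closed set under the continuous map `D`, so adding `z`
    -- makes it closed; it is bounded because it lies in the ball.
    refine Metric.isCompact_of_isClosed_isBounded ?_
      ((Metric.isBounded_closedBall (x := m) (r := R)).subset ?_)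
    · rw [← isOpen_compl_iff, isOpen_iff_eventually]
      intro x hx
      have hxz : x ≠ z := fun h => hx (Or.inl h)
      have hxD : D x ∉ univ ×ˢ Metric.closedBall (0 : EuclideanSpace ℝ (Fin k)) r := fun h =>
        hx (Or.inr ⟨hxz, h⟩)
      have hDx : ContinuousAt D x :=
        hDc.continuousOn.continuousAt (isOpen_compl_singleton.mem_nhds hxz)
      filter_upwards [hDx.preimage_mem_nhds
        ((isClosed_univ.prod Metric.isClosed_closedBall).isOpen_compl.mem_nhds hxD),
        isOpen_compl_singleton.mem_nhds hxz] with y hy hyz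
      rintro (h | ⟨-, h⟩)
      · exact hyz h
      · exact hy h
    · rintro x (rfl | ⟨hxz, -, hx⟩)
      · rw [Metric.mem_closedBall, hz]
      · rw [← hND x]
        exact hNball _ (mem_ball_zero_iff.1 (hsub hx)).le

end InversionTube

/-! ### Thick paths in dimension at least two, and finite pushes -/

lemma mem_of_apply_mem {M : Type u} {C : Set M} {Θ : M → M} (hfix : ∀ x ∉ C, Θ x = x) {x : M}
    (hx : Θ x ∈ C) : x ∈ C := by
  by_contra h
  exact h (hfix x h ▸ hx)

lemma apply_mem_of_mem {M : Type u} {C : Set M} {Θ : M → M} (hinj : Function.Injective Θ)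
    (hfix : ∀ x ∉ C, Θ x = x) {x : M} (hx : x ∈ C) : Θ x ∈ C := by
  by_contra h
  exact h ((hinj (hfix _ h)).symm ▸ hx)

section Component

variable {n : ℕ} {M : Type u} [TopologicalSpace M]
  [ChartedSpace (EuclideanSpace ℝ (Fin n)) M]

lemma isOpen_connectedComponent_of_chartedSpace (n : ℕ)
    [ChartedSpace (EuclideanSpace ℝ (Fin n)) M] (x : M) : IsOpen (connectedComponent x) := by
  have : LocallyConnectedSpace M :=
    ChartedSpace.locallyConnectedSpace (EuclideanSpace ℝ (Fin n)) M
  exact isOpen_connectedComponent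

variable [T2Space M]

/-- A half-open tube whose closed end has been pushed off to infinity is closed. -/
lemma isClosed_image_pullback {W : Type*} {Θ : M → M} (hΘ : IsLocallyDiff (n := n) Θ)
    (hinj : Function.Injective Θ) {x₁ : M} {z : EuclideanSpace ℝ (Fin n)}
    (hz : (extChartAt (𝓡 n) x₁).symm z ∉ range Θ) {T : W → M}
    {τ : W → EuclideanSpace ℝ (Fin n)} {A : Set W}
    (hT : ∀ w ∈ A, Θ (T w) = (extChartAt (𝓡 n) x₁).symm (τ w))
    (hK : IsCompact (insert z (τ '' A)))
    (hKt : insert z (τ '' A) ⊆ (extChartAt (𝓡 n) x₁).target) : IsClosed (T '' A) := by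
  convert (hK.image_of_continuousOn
    ((continuousOn_extChartAt_symm x₁).mono hKt)).isClosed.preimage hΘ.contMDiff.continuous using 1
  ext y
  constructor
  · rintro ⟨w, hw, rfl⟩
    exact ⟨τ w, Or.inr ⟨w, hw, rfl⟩, (hT w hw).symm⟩
  · rintro ⟨_, rfl | ⟨w, hw, rfl⟩, h⟩
    · exact absurd ⟨y, h.symm⟩ hz
    · exact ⟨w, hw, hinj ((hT w hw).trans h)⟩

variable [SecondCountableTopology M] [IsManifold (𝓡 n) ∞ M]

/-- The tube in the boundary ball lies in the range of `Θ` and accumulates, at its two ends, only at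
`z`. As `z` is not in the range, pulling back by `Θ` sends both ends to infinity and the closed
subtubes become closed in `M`. -/
theorem exists_isThickPath_of_two_le {k : ℕ} (hn : n = k + 1) (hk : 1 ≤ k) {x : M}
    (hx : ¬ IsCompact (connectedComponent x)) :
    ∃ T : ℝ × EuclideanSpace ℝ (Fin k) → M, IsThickPath (n := n) T := by
  have hCo := isOpen_connectedComponent_of_chartedSpace n x
  obtain ⟨Θ, hΘ, hinj, hfix, hp⟩ := exists_push (n := n) isClosed_connectedComponent
    isPreconnected_connectedComponent hx hCo subset_rfl mem_connectedComponent
  obtain ⟨x₁, m, z, R, hR, hzm, hball, hzr, hzR⟩ := exists_boundary_ball hCo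
    isPreconnected_connectedComponent hΘ mem_connectedComponent hp
    (apply_mem_of_mem hinj hfix mem_connectedComponent) (mem_range_self x)
  obtain ⟨τ, σ, hτ, hτm, hτc⟩ := exists_tube_in_ball hn hk hR hzm
  have hτt : MapsTo τ (tubeDomain k) (extChartAt (𝓡 n) x₁).target := fun w hw =>
    (hball _ (hτm w hw).1).1
  obtain ⟨T, S, hT, hΘT⟩ := ((isSmoothParam_extChartAt_symm x₁).comp hτ.isOpen_source
    hτ.isOpen_image hτ.contMDiffOn.contDiffOn hτ.contMDiffOn_symm.contDiffOn hτ.left_inv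
    hτt).exists_pullback hΘ hinj (by
      rintro _ ⟨w, hw, rfl⟩
      exact hzR _ (hτm w hw).1 (hτm w hw).2)
  refine ⟨T, hT.isThickPath hn fun r hr => ?_⟩
  have hsub : Ioo (0 : ℝ) 1 ×ˢ Metric.closedBall (0 : EuclideanSpace ℝ (Fin k)) r ⊆ tubeDomain k :=
    prod_mono subset_rfl (Metric.closedBall_subset_ball hr)
  refine isClosed_image_pullback hΘ hinj hzr (fun w hw => hΘT w (hsub hw)) (hτc r hr) ?_
  rintro _ (rfl | ⟨w, hw, rfl⟩)
  · exact (hball _ (by rw [Metric.mem_closedBall, hzm])).1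
  · exact hτt (hsub hw)

/-- A noncompact component can be pushed off any finite subset of it. -/
lemma exists_push_finite {x : M} (hx : ¬ IsCompact (connectedComponent x)) {Q : Set M}
    (hQ : Q.Finite) : ∃ Θ : M → M, IsLocallyDiff (n := n) Θ ∧ Function.Injective Θ ∧
      (∀ y ∉ connectedComponent x, Θ y = y) ∧ ∀ q ∈ Q, q ∈ connectedComponent x → q ∉ range Θ := by
  induction Q, hQ using Set.Finite.induction_on with
  | empty => exact ⟨id, isLocallyDiff_id, Function.injective_id, fun _ _ => rfl, by simp⟩
  | @insert q Q _ _ ih =>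
    obtain ⟨Θ, hΘ, hinj, hfix, hQ⟩ := ih
    by_cases hq : q ∈ connectedComponent x ∧ q ∈ range Θ
    · obtain ⟨hqC, p, rfl⟩ := hq
      obtain ⟨Θ', hΘ', hinj', hfix', hp⟩ := exists_push (n := n) isClosed_connectedComponent
        isPreconnected_connectedComponent hx (isOpen_connectedComponent_of_chartedSpace n x)
        subset_rfl (mem_of_apply_mem hfix hqC)
      -- `Θ'` misses the preimage `p` of the new point `q = Θ p`. Composing on the right only
      -- shrinks the range, so the earlier points stay avoided.
      refine ⟨Θ ∘ Θ', hΘ.comp hΘ', hinj.comp hinj', fun y hy => ?_, ?_⟩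
      · rw [Function.comp_apply, hfix' y hy, hfix y hy]
      · rintro q' (rfl | hq') hq'C ⟨y, hy⟩
        · exact hp ⟨y, hinj hy⟩
        · exact hQ q' hq' hq'C ⟨Θ' y, hy⟩
    · refine ⟨Θ, hΘ, hinj, hfix, ?_⟩
      rintro q' (rfl | hq') hq'C hq'r
      · exact hq ⟨hq'C, hq'r⟩
      · exact hQ q' hq' hq'C hq'r

end Component

/-! ### Connectedness lemmas -/

section Topological

/-- A preconnected set which meets an open set, but not the frontier of it, is contained in it. -/
lemma subset_of_isPreconnected_of_inter {M : Type*} [TopologicalSpace M] {A U K : Set M}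
    (hA : IsPreconnected A) (hU : IsOpen U) (hK : IsClosed K) (hUK : U ⊆ K)
    (hAK : A ∩ K ⊆ U) (hAU : (A ∩ U).Nonempty) : A ⊆ U :=
  hA.subset_left_of_subset_union hU hK.isOpen_compl
    (disjoint_compl_right_iff_subset.2 hUK)
    (fun x hx => by
      by_cases h : x ∈ K
      · exact Or.inl (hAK ⟨hx, h⟩)
      · exact Or.inr h) hAU

/-- Removing from a connected set an open set with only one frontier point leaves a connected
set. -/
lemma IsPreconnected.diff_of_isClosed_insert {M : Type*} [TopologicalSpace M] {C U : Set M}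
    {p : M} (hC : IsPreconnected C) (hCc : IsClosed C) (hU : IsOpen U) (hp : p ∈ C \ U)
    (hK : IsClosed (insert p U)) : IsPreconnected (C \ U) := by
  have key : ∀ t t' : Set M, IsClosed t → IsClosed t' → C \ U ⊆ t ∪ t' → p ∈ t →
      (C \ U ∩ t').Nonempty → (C \ U ∩ (t ∩ t')).Nonempty := by
    rintro t t' ht ht' hcov hpt ⟨y, hy, hyt'⟩
    -- The removed set is added to the part `t` that contains its only frontier point, giving a
    -- cover of `C` itself by two closed sets. A common point lies outside `U`, hence in `t` and in
    -- `t'`.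
    obtain ⟨c, hc, hc1, hc2, hc3⟩ := isPreconnected_closed_iff.1 hC (t ∪ insert p U)
      (t' ∩ (C \ U)) (ht.union hK) (ht'.inter (hCc.sdiff hU)) (fun c hc => by
        by_cases hcU : c ∈ U
        · exact Or.inl (Or.inr (Or.inr hcU))
        · rcases hcov ⟨hc, hcU⟩ with h | h
          · exact Or.inl (Or.inl h)
          · exact Or.inr ⟨h, hc, hcU⟩) ⟨p, hp.1, Or.inl hpt⟩ ⟨y, hy.1, hyt', hy⟩
    refine ⟨c, hc3, ?_, hc2⟩
    rcases hc1 with h | rfl | h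
    · exact h
    · exact hpt
    · exact absurd h hc3.2
  refine isPreconnected_closed_iff.2 fun t t' ht ht' hcov hnt hnt' => ?_
  rcases hcov hp with h | h
  · exact key t t' ht ht' hcov h hnt'
  · rw [inter_comm t t']
    exact key t' t ht' ht (union_comm t t' ▸ hcov) h hnt

lemma eq_Ioo_of_isOpen_of_isPreconnected {J : Set ℝ} (hJ : IsOpen J) (hJc : IsPreconnected J)
    (hJn : J.Nonempty) (ha : BddAbove J) (hb : BddBelow J) : ∃ a b, a < b ∧ J = Ioo a b := by
  have hsub : J ⊆ Ioo (sInf J) (sSup J) := by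
    rw [← interior_Icc]
    exact hJ.subset_interior_iff.2 (subset_Icc_csInf_csSup hb ha)
  obtain ⟨y, hy⟩ := hJn
  exact ⟨sInf J, sSup J, (hsub hy).1.trans (hsub hy).2,
    hsub.antisymm (IsConnected.Ioo_csInf_csSup_subset ⟨⟨y, hy⟩, hJc⟩ hb ha)⟩

end Topological

/-! ### Thick paths in dimension one -/

section OneDimensional

variable {M : Type u} [TopologicalSpace M] [ChartedSpace (EuclideanSpace ℝ (Fin 1)) M]

lemma IsSmoothParam.comp_line {T : EuclideanSpace ℝ (Fin 1) → M}
    {S : M → EuclideanSpace ℝ (Fin 1)} {U : Set (EuclideanSpace ℝ (Fin 1))}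
    (h : IsSmoothParam (n := 1) T S U) (z : EuclideanSpace ℝ (Fin 1))
    {v : EuclideanSpace ℝ (Fin 1)} (hv : v ≠ 0) {O : Set ℝ} (hO : IsOpen O)
    (hOU : MapsTo (fun s => z + s • v) O U) :
    ∃ S', IsSmoothParam (n := 1) (fun s : ℝ => T (z + s • v)) S' O := by
  have hdim : Module.finrank ℝ ℝ = Module.finrank ℝ (EuclideanSpace ℝ (Fin 1)) := by
    rw [Module.finrank_self, finrank_euclideanSpace_fin]
  let A₀ := ContinuousLinearEquiv.ofFinrankEq hdim
  obtain ⟨A₁, hA₁⟩ := SeparatingDual.exists_continuousLinearEquiv_apply_eq (R := ℝ)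
    (x := A₀ 1) (y := v) (by
      rw [Ne, map_eq_zero_iff A₀ A₀.injective]
      exact one_ne_zero) hv
  let A : ℝ ≃L[ℝ] EuclideanSpace ℝ (Fin 1) := A₀.trans A₁
  have hA : ∀ s, A s = s • v := fun s => by
    rw [← hA₁]
    change A s = s • A 1
    rw [← map_smul, smul_eq_mul, mul_one]
  have himg : (fun s => z + s • v) '' O = (fun y => A.symm (y - z)) ⁻¹' O := by
    ext y
    constructor
    · rintro ⟨s, hs, rfl⟩
      simpa [← hA] using hs
    · intro hy
      exact ⟨_, hy, by simp [← hA]⟩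
  refine ⟨_, h.comp (σ := fun y => A.symm (y - z)) hO ?_ ?_ ?_ (fun s _ => ?_) hOU⟩
  · rw [himg]
    exact hO.preimage (A.symm.continuous.comp (continuous_id.sub continuous_const))
  · exact (contDiff_const.add (contDiff_id.smul contDiff_const)).contDiffOn
  · exact (A.symm.contDiff.comp (contDiff_id.sub contDiff_const)).contDiffOn
  · simp [← hA]

lemma exists_interval_param [IsManifold (𝓡 1) ∞ M] (x : M) :
    ∃ (f : ℝ → M) (S : M → ℝ), IsSmoothParam (n := 1) f S (Ioo (-1) 2) ∧ x ∈ f '' Ioo 0 1 := by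
  set e := extChartAt (𝓡 1) x
  obtain ⟨v, hv⟩ := exists_ne (0 : EuclideanSpace ℝ (Fin 1))
  have hc : ContinuousAt (fun s : ℝ => e x + s • v) 0 := by fun_prop
  have hnhds : (fun s : ℝ => e x + s • v) ⁻¹' e.target ∈ 𝓝 (0 : ℝ) := by
    refine hc.preimage_mem_nhds ?_
    rw [zero_smul, add_zero]
    exact extChartAt_target_mem_nhds x
  obtain ⟨δ, hδ, hδe⟩ := Metric.mem_nhds_iff.1 hnhds
  have hδ2 : 0 < δ / 2 := by positivity
  have hpt : ∀ s : ℝ, e x - (δ / 2 / 2) • v + s • (δ / 2) • v =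
      e x + (δ / 2 * (s - 1 / 2)) • v := fun s => by module
  obtain ⟨S, hS⟩ := (isSmoothParam_extChartAt_symm (n := 1) x).comp_line
    (e x - (δ / 2 / 2) • v) (smul_ne_zero hδ2.ne' hv) (isOpen_Ioo (a := (-1 : ℝ)) (b := 2))
    (fun s hs => by
      simp only [hpt]
      refine hδe (mem_ball_zero_iff.2 ?_)
      rw [Real.norm_eq_abs, abs_lt]
      constructor <;> nlinarith [hs.1, hs.2])
  refine ⟨_, S, hS, 1 / 2, by norm_num, ?_⟩
  simp only [hpt]
  simp [e]

/-- If a clopen connected set can be embedded in an arc, it is the image of a thick path. -/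
lemma exists_isThickPath_of_image_subset {C : Set M} (hCo : IsOpen C) (hCc : IsClosed C)
    (hC : IsPreconnected C) (hCn : C.Nonempty) {Θ : M → M} (hΘ : IsLocallyDiff (n := 1) Θ)
    (hinj : Function.Injective Θ) {f : ℝ → M} {S : M → ℝ} {U : Set ℝ}
    (hf : IsSmoothParam (n := 1) f S U) {c d : ℝ} (hU : Ioo c d ⊆ U)
    (hCf : Θ '' C ⊆ f '' Ioo c d) :
    ∃ T : ℝ × EuclideanSpace ℝ (Fin 0) → M, IsThickPath (n := 1) T := by
  have hJ : S '' (Θ '' C) = U ∩ f ⁻¹' (Θ '' C) := by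
    ext t
    constructor
    · rintro ⟨y, hy, rfl⟩
      obtain ⟨s, hs, rfl⟩ := hCf hy
      rw [hf.left_inv s (hU hs)]
      exact ⟨hU hs, hy⟩
    · rintro ⟨ht, hft⟩
      exact ⟨f t, hft, hf.left_inv t ht⟩
  have hJsub : S '' (Θ '' C) ⊆ Ioo c d := by
    rintro _ ⟨y, hy, rfl⟩
    obtain ⟨s, hs, rfl⟩ := hCf hy
    rwa [hf.left_inv s (hU hs)]
  have hJo : IsOpen (S '' (Θ '' C)) := by
    rw [hJ]
    exact hf.contMDiffOn.continuousOn.isOpen_inter_preimage hf.isOpen_source (hΘ.isOpenMap C hCo)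
  have hJc : IsPreconnected (S '' (Θ '' C)) :=
    (hC.image Θ hΘ.contMDiff.continuous.continuousOn).image S
      (hf.contMDiffOn_symm.continuousOn.mono (hCf.trans (image_mono hU)))
  -- In the parameter of the arc, the embedded component is an open, connected, bounded set, that
  -- is, an open interval. The thick path is the whole component, closed by hypothesis; the ball `B`
  -- is a point.
  obtain ⟨a, b, hab, hJab⟩ := eq_Ioo_of_isOpen_of_isPreconnected hJo hJc
    ((hCn.image Θ).image S) (bddAbove_Ioo.mono hJsub) (bddBelow_Ioo.mono hJsub)
  have hab' : 0 < b - a := sub_pos.2 hab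
  let ψ : ℝ × EuclideanSpace ℝ (Fin 0) → ℝ := fun w => a + w.1 * (b - a)
  let χ : ℝ → ℝ × EuclideanSpace ℝ (Fin 0) := fun t => ((t - a) / (b - a), 0)
  have hψχ : ∀ t, ψ (χ t) = t := fun t => by
    simp only [ψ, χ]
    field_simp
    ring
  have hψimg : ψ '' tubeDomain 0 = Ioo a b := by
    ext t
    constructor
    · rintro ⟨w, hw, rfl⟩
      have h1 := mul_pos hw.1.1 hab'
      have h2 := mul_pos (sub_pos.2 hw.1.2) hab'
      constructor <;> simp only [ψ] <;> linarith
    · rintro ⟨h1, h2⟩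
      refine ⟨χ t, ⟨⟨div_pos (sub_pos.2 h1) hab', ?_⟩, ?_⟩, hψχ t⟩
      · rw [div_lt_one hab']
        linarith
      · simp [χ]
  have hψmaps : MapsTo ψ (tubeDomain 0) U := fun w hw =>
    hU (hJsub (hJab ▸ hψimg ▸ mem_image_of_mem ψ hw))
  have hψmem : ∀ w ∈ tubeDomain 0, f (ψ w) ∈ Θ '' C := fun w hw => by
    have h : ψ w ∈ S '' (Θ '' C) := hJab ▸ hψimg ▸ mem_image_of_mem ψ hw
    rw [hJ] at h
    exact h.2
  have hcomp : IsSmoothParam (n := 1) (fun w => f (ψ w)) (fun x => χ (S x)) (tubeDomain 0) := by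
    refine hf.comp isOpen_tubeDomain (hψimg ▸ isOpen_Ioo) ?_ ?_ (fun w _ => ?_) hψmaps
    · exact (contDiff_const.add (contDiff_fst.mul contDiff_const)).contDiffOn
    · exact (((contDiff_id.sub contDiff_const).div_const _).prodMk contDiff_const).contDiffOn
    · refine Prod.ext ?_ (Subsingleton.elim _ _)
      simp only [ψ, χ]
      field_simp
      ring
  obtain ⟨T, S', hT, hΘT⟩ := hcomp.exists_pullback hΘ hinj (by
    rintro _ ⟨w, hw, rfl⟩
    exact image_subset_range Θ C (hψmem w hw))
  refine ⟨T, hT.isThickPath rfl fun r hr => ?_⟩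
  rcases lt_or_ge r 0 with h | h
  · simp [Metric.closedBall_eq_empty.2 h]
  · have hdom : Ioo (0 : ℝ) 1 ×ˢ Metric.closedBall (0 : EuclideanSpace ℝ (Fin 0)) r =
        tubeDomain 0 := by
      ext w
      simp [tubeDomain, Subsingleton.elim w.2 0, h]
    rw [hdom]
    convert hCc
    ext y
    constructor
    · rintro ⟨w, hw, rfl⟩
      obtain ⟨y, hy, hyw⟩ := hψmem w hw
      rwa [hinj ((hΘT w hw).trans hyw.symm)]
    · intro hy
      have h1 : S (Θ y) ∈ Ioo a b := hJab ▸ mem_image_of_mem S (mem_image_of_mem Θ hy)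
      obtain ⟨w, hw, hwy⟩ := hψimg ▸ h1
      obtain ⟨s, hs, hsy⟩ := hCf (mem_image_of_mem Θ hy)
      refine ⟨w, hw, hinj ?_⟩
      rw [hΘT w hw, hwy, ← hsy, hf.left_inv s (hU hs)]

variable [T2Space M] [SecondCountableTopology M] [IsManifold (𝓡 1) ∞ M]

/-- A noncompact component of a curve contains a properly embedded half-line. -/
lemma exists_halfLine {x : M} (hx : ¬ IsCompact (connectedComponent x)) :
    ∃ (ρ : ℝ → M) (S : M → ℝ), IsSmoothParam (n := 1) ρ S (Ioo 0 1) ∧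
      ρ '' Ioo 0 1 ⊆ connectedComponent x ∧ ∀ s < (1 : ℝ), IsClosed (ρ '' Ioc 0 s) := by
  have hCo := isOpen_connectedComponent_of_chartedSpace 1 x
  obtain ⟨Θ, hΘ, hinj, hfix, hp⟩ := exists_push (n := 1) isClosed_connectedComponent
    isPreconnected_connectedComponent hx hCo subset_rfl mem_connectedComponent
  obtain ⟨x₁, m, z, R, hR, hzm, hball, hzr, hzR⟩ := exists_boundary_ball hCo
    isPreconnected_connectedComponent hΘ mem_connectedComponent hp
    (apply_mem_of_mem hinj hfix mem_connectedComponent) (mem_range_self x)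
  have hmz : m - z ≠ 0 := sub_ne_zero.2 fun h => by
    rw [h, dist_self] at hzm
    exact hR.ne hzm
  have hmem : ∀ s : ℝ, 0 ≤ s → s ≤ 1 → z + s • (m - z) ∈ Metric.closedBall m R := by
    intro s h0 h1
    have : z + s • (m - z) - m = (1 - s) • (z - m) := by module
    rw [mem_closedBall_iff_norm, this, norm_smul, Real.norm_of_nonneg (by linarith),
      ← dist_eq_norm, hzm]
    nlinarith
  obtain ⟨S₀, hS₀⟩ := (isSmoothParam_extChartAt_symm (n := 1) x₁).comp_line z hmz
    (isOpen_Ioo (a := (0 : ℝ)) (b := 1)) fun s hs => (hball _ (hmem s hs.1.le hs.2.le)).1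
  obtain ⟨ρ, S, hρ, hΘρ⟩ := hS₀.exists_pullback hΘ hinj (by
    rintro _ ⟨s, hs, rfl⟩
    refine hzR _ (hmem s hs.1.le hs.2.le) fun h => ?_
    exact smul_ne_zero hs.1.ne' hmz (add_eq_left.1 h))
  refine ⟨ρ, S, hρ, ?_, fun s hs => ?_⟩
  · rintro _ ⟨s, hs, rfl⟩
    refine mem_of_apply_mem hfix ?_
    rw [hΘρ s hs]
    exact (hball _ (hmem s hs.1.le hs.2.le)).2
  rcases le_or_gt s 0 with h0 | h0
  · simp [Ioc_eq_empty h0.not_gt]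
  have hins : insert z ((fun s : ℝ => z + s • (m - z)) '' Ioc 0 s) =
      (fun s : ℝ => z + s • (m - z)) '' Icc 0 s := by
    rw [← Ioc_insert_left h0.le, image_insert_eq, zero_smul, add_zero]
  refine isClosed_image_pullback hΘ hinj hzr (fun t ht => hΘρ t ⟨ht.1, ht.2.trans_lt hs⟩) ?_ ?_
  · rw [hins]
    exact isCompact_Icc.image (by fun_prop)
  · rw [hins]
    rintro _ ⟨t, ht, rfl⟩
    exact (hball _ (hmem t ht.1 (ht.2.trans hs.le))).1

/-- The half-line ends at infinity for `s → 0`, so its piece `U = ρ(]0, 3/4[)` has `ρ(3/4)` as its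
only frontier point. A connected set meeting `U` and avoiding `ρ(3/4)` lies in `U`, so it is enough
to push the component off suitable points. -/
theorem exists_isThickPath_of_dim_one {x : M} (hx : ¬ IsCompact (connectedComponent x)) :
    ∃ T : ℝ × EuclideanSpace ℝ (Fin 0) → M, IsThickPath (n := 1) T := by
  have hCo := isOpen_connectedComponent_of_chartedSpace 1 x
  obtain ⟨ρ, S, hρ, hρC, hρcl⟩ := exists_halfLine hx
  set C := connectedComponent x
  have hCc : IsClosed C := isClosed_connectedComponent
  have hC : IsPreconnected C := isPreconnected_connectedComponent
  have hCn : C.Nonempty := ⟨x, mem_connectedComponent⟩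
  have h34 : (3 / 4 : ℝ) ∈ Ioo (0 : ℝ) 1 := by norm_num
  have hsub : Ioo (0 : ℝ) (3 / 4) ⊆ Ioo 0 1 := Ioo_subset_Ioo_right (by norm_num)
  have hins : ρ '' Ioc 0 (3 / 4) = insert (ρ (3 / 4)) (ρ '' Ioo 0 (3 / 4)) := by
    rw [← Ioo_insert_right (by norm_num), image_insert_eq]
  have hUo : IsOpen (ρ '' Ioo 0 (3 / 4)) := hρ.isOpen_image_of_subset isOpen_Ioo hsub
  have hpF : ρ (3 / 4) ∈ C \ ρ '' Ioo 0 (3 / 4) := by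
    refine ⟨hρC ⟨_, h34, rfl⟩, ?_⟩
    rintro ⟨s, hs, h⟩
    exact hs.2.ne (hρ.injOn (hsub hs) h34 h)
  have hKcl : IsClosed (insert (ρ (3 / 4)) (ρ '' Ioo 0 (3 / 4))) :=
    hins ▸ hρcl _ (by norm_num)
  have hFc : IsPreconnected (C \ ρ '' Ioo 0 (3 / 4)) :=
    IsPreconnected.diff_of_isClosed_insert hC hCc hUo hpF hKcl
  -- a push whose range avoids the end of the arc and meets the arc maps into the arc
  have harc : ∀ Θ : M → M, IsLocallyDiff (n := 1) Θ → ρ (3 / 4) ∉ range Θ →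
      (Θ '' C ∩ ρ '' Ioo 0 (3 / 4)).Nonempty → Θ '' C ⊆ ρ '' Ioo 0 (3 / 4) := by
    intro Θ hΘ hp hne
    refine subset_of_isPreconnected_of_inter
      (hC.image Θ hΘ.contMDiff.continuous.continuousOn) hUo hKcl (subset_insert _ _) ?_ hne
    rintro _ ⟨⟨y, -, rfl⟩, h | h⟩
    · exact absurd ⟨y, h⟩ hp
    · exact h
  by_cases hF : IsCompact (C \ ρ '' Ioo 0 (3 / 4))
  · choose f Sf hf hxf using exists_interval_param (M := M)
    have hfsub : Ioo (0 : ℝ) 1 ⊆ Ioo (-1) 2 := Ioo_subset_Ioo (by norm_num) (by norm_num)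
    have hfo : ∀ y, IsOpen (f y '' Ioo 0 1) := fun y =>
      (hf y).isOpen_image_of_subset isOpen_Ioo hfsub
    obtain ⟨I, -, hI⟩ := hF.elim_nhds_subcover (fun y => f y '' Ioo 0 1) fun y _ =>
      (hfo y).mem_nhds (hxf y)
    -- If the rest of the component is compact, finitely many small arcs cover it. Once the
    -- component is pushed off `ρ(3/4)` and off the end points of these arcs, its connected image
    -- must lie in `U` or in a single one of the arcs.
    obtain ⟨Θ, hΘ, hinj, hfix, hQ⟩ := exists_push_finite (n := 1) hx
      (Q := insert (ρ (3 / 4)) (((fun y => f y 0) '' I) ∪ ((fun y => f y 1) '' I)))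
      (((I.finite_toSet.image _).union (I.finite_toSet.image _)).insert _)
    have hmem : ∀ y ∈ C, Θ y ∈ C := fun y hy => apply_mem_of_mem hinj hfix hy
    by_cases hxU : Θ x ∈ ρ '' Ioo 0 (3 / 4)
    · exact exists_isThickPath_of_image_subset hCo hCc hC hCn hΘ hinj hρ hsub
        (harc Θ hΘ (hQ _ (mem_insert _ _) hpF.1)
          ⟨Θ x, mem_image_of_mem Θ mem_connectedComponent, hxU⟩)
    · obtain ⟨y, hy, hxy⟩ := mem_iUnion₂.1 (hI ⟨hmem x mem_connectedComponent, hxU⟩)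
      refine exists_isThickPath_of_image_subset hCo hCc hC hCn hΘ hinj (hf y) hfsub ?_
      have hIcc : Icc (0 : ℝ) 1 ⊆ Ioo (-1) 2 := Icc_subset_Ioo (by norm_num) (by norm_num)
      refine subset_of_isPreconnected_of_inter
        (hC.image Θ hΘ.contMDiff.continuous.continuousOn) (hfo y)
        (isCompact_Icc.image_of_continuousOn
          ((hf y).contMDiffOn.continuousOn.mono hIcc)).isClosed (image_mono Ioo_subset_Icc_self)
        ?_ ⟨Θ x, mem_image_of_mem Θ mem_connectedComponent, hxy⟩
      rintro _ ⟨⟨c, hc, rfl⟩, t, ht, htc⟩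
      refine ⟨t, ⟨ht.1.lt_of_ne ?_, ht.2.lt_of_ne ?_⟩, htc⟩
      · rintro rfl
        exact hQ (f y 0) (Or.inr (Or.inl ⟨y, hy, rfl⟩)) (htc ▸ hmem c hc) ⟨c, htc.symm⟩
      · rintro rfl
        exact hQ (f y 1) (Or.inr (Or.inr ⟨y, hy, rfl⟩)) (htc ▸ hmem c hc) ⟨c, htc.symm⟩
  -- If the rest is not compact, `ρ(3/4)` can be pushed to infinity within the complement of `ρ(]0,
  -- 1/2])`. Then `ρ(1/4)` stays fixed, so the image of the component meets `U` and hence lies in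
  -- it.
  · obtain ⟨Θ, hΘ, hinj, hfix, hp⟩ := exists_push (n := 1) (hCc.sdiff hUo) hFc hF
      (hCo.sdiff (hρcl (1 / 2) (by norm_num)))
      (sdiff_subset_sdiff_right (image_mono fun s hs => ⟨hs.1, hs.2.trans_lt (by norm_num)⟩)) hpF
    refine exists_isThickPath_of_image_subset hCo hCc hC hCn hΘ hinj hρ hsub
      (harc Θ hΘ hp ⟨ρ (1 / 4), ⟨ρ (1 / 4), hρC ⟨1 / 4, by norm_num, rfl⟩, ?_⟩, 1 / 4,
        by norm_num, rfl⟩)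
    exact hfix _ fun h => h.2 ⟨1 / 4, by norm_num, rfl⟩

end OneDimensional

/-! ### Existence of thick paths and the main theorem -/

/-- A manifold with a noncompact component contains a thick path. -/
theorem exists_isThickPath {n : ℕ} {M : Type u} [TopologicalSpace M] [T2Space M]
    [SecondCountableTopology M] [ChartedSpace (EuclideanSpace ℝ (Fin n)) M]
    [IsManifold (𝓡 n) ∞ M] {x : M} (hx : ¬ IsCompact (connectedComponent x)) :
    ∃ (k : ℕ) (T : ℝ × EuclideanSpace ℝ (Fin k) → M), IsThickPath (n := n) T := by
  rcases n with _ | _ | k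
  · refine absurd ?_ hx
    have : DiscreteTopology M := ChartedSpace.discreteTopology (EuclideanSpace ℝ (Fin 0)) M
    rw [isPreconnected_connectedComponent.subsingleton.eq_singleton_of_mem mem_connectedComponent]
    exact isCompact_singleton
  · exact ⟨0, exists_isThickPath_of_dim_one hx⟩
  · exact ⟨k + 1, exists_isThickPath_of_two_le rfl (by omega) hx⟩

end DiffLie

end

open DiffLie
theorem theorem0p1 (n : ℕ) (M : Type*) [TopologicalSpace M]
    [ChartedSpace (EuclideanSpace ℝ (Fin n)) M] [IsManifold (𝓡 n) ∞ M]
    [T2Space M] [SecondCountableTopology M]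
    (hM : ∃ x : M, ¬ IsCompact (connectedComponent x)) :
    IsDiffeologicalLieGroup (Diff (𝓡 n) M) ∧
    ¬ DiffLie.IsRegular (Diff (𝓡 n) M) ∧
    (∃ (k : ℕ) (T : ℝ × EuclideanSpace ℝ (Fin k) → M), IsThickPath (n := n) T) ∧
    ∀ (k : ℕ) (T : ℝ × EuclideanSpace ℝ (Fin k) → M) (φ : ℝ → ℝ),
      IsThickPath (n := n) T → IsCutoff φ →
      ∃ C : CurvesAt (1 : Diff (𝓡 n) M),
        IsTransported T φ C ∧
        ContMDiff (𝓡 n) (𝓡 n).tangent ∞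
          (fun x => (⟨x, velocityField (𝓡 n) C x⟩ : TangentBundle (𝓡 n) M)) ∧
        (∀ x ∈ Set.Ioo (0 : ℝ) 1, velocityField (𝓡 n) C (T (x, 0)) =
          mfderiv 𝓘(ℝ, ℝ) (𝓡 n) (fun s : ℝ => T (s, 0)) x (1 : ℝ)) ∧
        ¬ HasGlobalFlow (𝓡 n) (velocityField (𝓡 n) C) ∧
        ¬ ∃ g : SmoothMap (Set.Icc (0 : ℝ) 1) (Diff (𝓡 n) M),
          IsSolution ⟨fun _ => tangent C, dSmooth_const⟩ g := by
  have hcurve : ∀ (k : ℕ) (T : ℝ × EuclideanSpace ℝ (Fin k) → M) (φ : ℝ → ℝ),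
      IsThickPath (n := n) T → IsCutoff φ →
      ∃ C : CurvesAt (1 : Diff (𝓡 n) M),
        IsTransported T φ C ∧
        ContMDiff (𝓡 n) (𝓡 n).tangent ∞
          (fun x => (⟨x, velocityField (𝓡 n) C x⟩ : TangentBundle (𝓡 n) M)) ∧
        (∀ x ∈ Set.Ioo (0 : ℝ) 1, velocityField (𝓡 n) C (T (x, 0)) =
          mfderiv 𝓘(ℝ, ℝ) (𝓡 n) (fun s : ℝ => T (s, 0)) x (1 : ℝ)) ∧
        ¬ HasGlobalFlow (𝓡 n) (velocityField (𝓡 n) C) ∧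
        ¬ ∃ g : SmoothMap (Set.Icc (0 : ℝ) 1) (Diff (𝓡 n) M),
          IsSolution ⟨fun _ => tangent C, dSmooth_const⟩ g := by
    intro k T φ hT hφ
    obtain ⟨C, hC, hCX⟩ := hT.exists_transported hφ
    exact ⟨C, hC, contMDiff_velocityField C, hCX,
      hT.not_hasGlobalFlow (contMDiff_velocityField C) hCX, fun ⟨_, hg⟩ => hT.not_isSolution hCX hg⟩
  have hthick : ∃ (k : ℕ) (T : ℝ × EuclideanSpace ℝ (Fin k) → M), IsThickPath (n := n) T := by
    obtain ⟨x, hx⟩ := hM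
    exact exists_isThickPath hx
  refine ⟨isDiffeologicalLieGroup_diff, ?_, hthick, hcurve⟩
  -- Mere existence of solutions fails: the smoothness of `Exp` and uniqueness play no role in the
  -- contradiction.
  rintro ⟨Exp, -, hExp⟩
  obtain ⟨k, T, hT⟩ := hthick
  obtain ⟨φ, hφ⟩ := exists_isCutoff
  obtain ⟨C, -, -, -, -, hC⟩ := hcurve k T φ hT hφ
  exact hC ⟨_, (hExp _).1⟩
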